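/- Let $0<\alpha<2$, $\alpha\neq1$, $c_\pm\ge 0$, $\kappa_+\ge1$, $\kappa_-\ge0$, $\sigma\ge0$, with $c_++c_->0$ or $\sigma>0$. Let $X$ be a real Lévy process with diffusion coefficient $\sigma$ and tempered stable Lévy measure $$\nu(dx)=\Big(\frac{c_+}{x^{\alpha+1}}e^{-\kappa_+x}1_{x>0}+\frac{c_-}{|x|^{\alpha+1}}e^{-\kappa_-|x|}1_{x<0}\Big)dx,$$ such that $\mathrm E\,e^{X(t)}=1$ for all $t\ge 0$. Let $\mathsf C(\tau,k)=\mathrm E\,(e^{X(\tau)}-e^k)^+$ be the normalized call price with maturity $\tau$ and log-strike $k$, and let $\sigma_{imp}(\tau,k)>0$ be the Black–Scholes implied volatility: $\mathsf C^{BS}(\sigma_{imp}^2\tau,k)=\mathsf C(\tau,k)$, where $\mathsf C^{BS}(v,k)=\Phi\big(\tfrac{-k+v/2}{\sqrt v}\big)-e^k\Phi\big(\tfrac{-k-v/2}{\sqrt v}\big)$ and $\Phi$ is the standard normal distribution function. Then for each $\tau>0$ the implied volatility $\sigma_{imp}(\tau,k)$ exists and is unique for $k$ near $0$ and is twice continuously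 differentiable in $k$ at $0$. Put $\chi_n(\tau)=\partial_k^n\sigma_{imp}(\tau,k)|_{k=0}$ for $n=0,1,2$, and write $f\approx c\,\tau^e$ for $f(\tau)=c\,\tau^e+o(\tau^e)$ as $\tau\to0+$ (for $c\ne0$ this is $f\sim c\tau^e$). Put $$a_\pm=\Gamma(-\alpha)c_\pm,\quad \zeta_\pm=\kappa_\pm^\alpha-(\kappa_\pm\mp1)^\alpha,\quad \gamma=a_+\zeta_++a_-\zeta_-,\quad \delta=-a_+\kappa_+^\alpha-a_-\kappa_-^\alpha,$$ for $\alpha<1$ $$\varrho=\frac1\pi\,\mathrm{Re}\int_0^\infty\frac{a_+\big(\kappa_+-(iu+\frac12)\big)^\alpha+a_-\big(\kappa_-+(iu+\frac12)\big)^\alpha}{u^2+\frac14}\,du$$ (principal powers), and $$p=(a_++a_-)\cos\tfrac{\pi\alpha}2,\quad q=-(a_+-a_-)\sin\tfrac{\pi\alpha}2,\quad r=\sqrt{p^2+q^2},\quad \chi=\arctan(-q/p),\quad \alpha'=1/\alpha.$$ **(A)** If $0<\alpha<1$, $\sigma=0$, then with $C_L=-(\min(\gamma,0)+\delta+\varrho)$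 and $C_M=-\frac12\,\mathrm{sign}(\gamma)$: $\chi_0-\sigma\approx\sqrt{2\pi}\,C_L\,\tau^{1/2}$, and, provided $\gamma\neq0$ or $c_+=c_-$, $\chi_1\approx\sqrt{2\pi}\,C_M\,\tau^{-1/2}$ (nothing is claimed on $\chi_2$). **(B)** If $1<\alpha<2$, $\sigma=0$, then with $C_L=\frac1\pi\Gamma(1-\alpha')r^{\alpha'}\cos(\alpha'\chi)$, $C_M=-\frac1\pi\alpha'\chi$, $C_N=\frac1\pi\Gamma(1+\alpha')r^{-\alpha'}\cos(\alpha'\chi)$: $\chi_0-\sigma\approx\sqrt{2\pi}\,C_L\,\tau^{\alpha'-1/2}$, $\ \chi_1\approx\sqrt{2\pi}\,C_M\,\tau^{-1/2}$, $\ \chi_2\approx\Big(-\frac1{\sqrt{2\pi}\,C_L}+\sqrt{2\pi}\,C_N\Big)\tau^{-\alpha'-1/2}$. **(C)** If $0<\alpha<1$, $\sigma>0$, then with $C_L=-(\frac12\gamma+\delta+\varrho)$, $C_M=-\frac1{\sqrt{2\pi}}\gamma\sigma^{-1}$: $\chi_0-\sigma\approx\sqrt{2\pi}\,C_L\,\tau^{1/2}$,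 $\ \chi_1\approx\sqrt{2\pi}\,C_M$, $\ \chi_2\approx\frac{\sqrt{2\pi}\,C_L}{\sigma^2}\,\tau^{-1/2}$. **(D)** If $1<\alpha<2$, $\sigma>0$, then with $C_L=-\frac1\pi2^{(\alpha-3)/2}\Gamma(\frac{\alpha-1}2)\,p\,\sigma^{-(\alpha-1)}$, $C_M=-\frac1\pi2^{(\alpha-2)/2}\Gamma(\frac\alpha2)\,q\,\sigma^{-\alpha}$, $C_N=\frac1\pi2^{(\alpha-1)/2}\Gamma(\frac{\alpha+1}2)\,p\,\sigma^{-(\alpha+1)}$: $\chi_0-\sigma\approx\sqrt{2\pi}\,C_L\,\tau^{(2-\alpha)/2}$, $\ \chi_1\approx\sqrt{2\pi}\,C_M\,\tau^{(1-\alpha)/2}$, $\ \chi_2\approx\sqrt{2\pi}\Big(\frac{C_L}{\sigma^2}+C_N\Big)\tau^{-\alpha/2}$. -/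

import Mathlib

open MeasureTheory ProbabilityTheory Filter Topology Set Asymptotics
open scoped NNReal

namespace ShortTimeSmile

noncomputable section

/-! ### Lévy processes -/

/-- A real Lévy process: a càdlàg process started at `0` with independent and stationary
increments. -/
structure IsLevyProcess {Ω : Type*} [MeasurableSpace Ω] (X : ℝ≥0 → Ω → ℝ) (P : Measure Ω) :
    Prop where
  measurable : ∀ t, Measurable (X t)
  start_zero : ∀ᵐ ω ∂P, X 0 ω = 0
  indep_increments : HasIndepIncrements X P
  stationary_increments : ∀ s t, IdentDistrib (fun ω => X (s + t) ω - X s ω) (X t) P P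
  cadlag : ∀ᵐ ω ∂P, ∀ t : ℝ≥0, ContinuousWithinAt (fun s => X s ω) (Ici t) t ∧
    ∃ l : ℝ, Tendsto (fun s => X s ω) (𝓝[<] t) (𝓝 l)

/-- The Lévy–Khinchine exponent of the triplet `(b, σ, ν)`, with the truncation `1_{|x| ≤ 1}`. -/
def levyExponent (b σ : ℝ) (ν : Measure ℝ) (u : ℝ) : ℂ :=
  Complex.I * u * b - (σ : ℂ) ^ 2 * (u : ℂ) ^ 2 / 2 +
    ∫ x : ℝ, (Complex.exp (Complex.I * u * x) - 1 -
      (if |x| ≤ 1 then Complex.I * u * x else 0)) ∂ν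

/-- `X` has characteristic triplet `(b, σ, ν)`: `E e^{iuX(t)} = e^{tψ(u)}`. -/
def HasLevyTriplet {Ω : Type*} [MeasurableSpace Ω] (X : ℝ≥0 → Ω → ℝ) (P : Measure Ω)
    (b σ : ℝ) (ν : Measure ℝ) : Prop :=
  ∀ (t : ℝ≥0) (u : ℝ), ∫ ω, Complex.exp (Complex.I * u * (X t ω : ℝ)) ∂P =
    Complex.exp ((t : ℝ) * levyExponent b σ ν u)

/-! ### Call prices and implied volatility -/

/-- The normalized call price `C(τ, k) = E (e^{X(τ)} - e^k)⁺` on an asset `F = F(0) e^X`, where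
`k` is the log-moneyness. -/
def callPrice {Ω : Type*} [MeasurableSpace Ω] (X : ℝ≥0 → Ω → ℝ) (P : Measure Ω) (τ k : ℝ) : ℝ :=
  ∫ ω, max (Real.exp (X τ.toNNReal ω) - Real.exp k) 0 ∂P

/-- The standard normal distribution function. -/
def stdNormalCDF (x : ℝ) : ℝ := cdf (gaussianReal 0 1) x

/-- The non-dimensional Black–Scholes call price with total variance `v` and log-strike `k`. -/
def bsCall (v k : ℝ) : ℝ :=
  stdNormalCDF ((-k + v / 2) / √v) - Real.exp k * stdNormalCDF ((-k - v / 2) / √v)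

/-- `s` is a Black–Scholes implied volatility of the price surface `C` at `(τ, k)`. -/
def IsImpliedVol (C : ℝ → ℝ → ℝ) (τ k s : ℝ) : Prop :=
  0 < s ∧ bsCall (s ^ 2 * τ) k = C τ k

open Classical in
/-- The implied volatility surface of `C` (with value `0` where there is no implied volatility). -/
def impliedVol (C : ℝ → ℝ → ℝ) (τ k : ℝ) : ℝ :=
  if h : ∃ s, IsImpliedVol C τ k s then h.choose else 0

/-- The coefficient `χ_n(τ)` of `k^n / n!` in the expansion of the implied volatility in powers of
the log-strike at the money. -/
def smileCoeff (C : ℝ → ℝ → ℝ) (n : ℕ) (τ : ℝ) : ℝ :=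
  iteratedDeriv n (fun k => impliedVol C τ k) 0

/-- `f(τ) = c τ^e + o(τ^e)` as `τ → 0+`. -/
def HasLeadingTerm (f : ℝ → ℝ) (c e : ℝ) : Prop :=
  (fun τ => f τ - c * τ ^ e) =o[𝓝[>] 0] (fun τ => τ ^ e)

/-! ### Tempered stable processes -/

/-- The parameters of a tempered stable process with an added Brownian component of volatility
`σ`. -/
structure TSParams where
  α : ℝ
  cPos : ℝ
  cNeg : ℝ
  κPos : ℝ
  κNeg : ℝ
  σ : ℝ

namespace TSParams

/-- The parameter range; the last condition says that the process is not deterministic. -/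
structure Admissible (θ : TSParams) : Prop where
  α_pos : 0 < θ.α
  α_lt_two : θ.α < 2
  α_ne_one : θ.α ≠ 1
  cPos_nonneg : 0 ≤ θ.cPos
  cNeg_nonneg : 0 ≤ θ.cNeg
  one_le_κPos : 1 ≤ θ.κPos
  κNeg_nonneg : 0 ≤ θ.κNeg
  σ_nonneg : 0 ≤ θ.σ
  nondegenerate : 0 < θ.cPos + θ.cNeg ∨ 0 < θ.σ

/-- The tempered stable Lévy measure. -/
def levyMeasure (θ : TSParams) : Measure ℝ :=
  volume.withDensity fun x => ENNReal.ofReal <|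
    if 0 < x then θ.cPos / x ^ (θ.α + 1) * Real.exp (-θ.κPos * x)
    else if x < 0 then θ.cNeg / |x| ^ (θ.α + 1) * Real.exp (-θ.κNeg * |x|)
    else 0

def aPos (θ : TSParams) : ℝ := Real.Gamma (-θ.α) * θ.cPos

def aNeg (θ : TSParams) : ℝ := Real.Gamma (-θ.α) * θ.cNeg

def ζPos (θ : TSParams) : ℝ := θ.κPos ^ θ.α - (θ.κPos - 1) ^ θ.α

def ζNeg (θ : TSParams) : ℝ := θ.κNeg ^ θ.α - (θ.κNeg + 1) ^ θ.α

def γ (θ : TSParams) : ℝ := θ.aPos * θ.ζPos + θ.aNeg * θ.ζNeg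

def δ (θ : TSParams) : ℝ := -(θ.aPos * θ.κPos ^ θ.α) - θ.aNeg * θ.κNeg ^ θ.α

/-- `Σ_s a_s (κ_s - s (iu + 1/2))^α`, with principal powers. -/
def upsilonTilde (θ : TSParams) (u : ℝ) : ℂ :=
  θ.aPos * ((θ.κPos : ℂ) - (Complex.I * u + 1 / 2)) ^ (θ.α : ℂ) +
    θ.aNeg * ((θ.κNeg : ℂ) + (Complex.I * u + 1 / 2)) ^ (θ.α : ℂ)

/-- `ϱ = (1/π) Re ∫_0^∞ υ̃(u) / (u² + 1/4) du`; used for `α < 1`, where the integral converges. -/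
def ϱ (θ : TSParams) : ℝ :=
  1 / Real.pi * (∫ u in Ioi (0 : ℝ), θ.upsilonTilde u / ((u : ℂ) ^ 2 + 1 / 4)).re

def p (θ : TSParams) : ℝ := (θ.aPos + θ.aNeg) * Real.cos (Real.pi * θ.α / 2)

def q (θ : TSParams) : ℝ := -((θ.aPos - θ.aNeg) * Real.sin (Real.pi * θ.α / 2))

def r (θ : TSParams) : ℝ := √(θ.p ^ 2 + θ.q ^ 2)

/-- The angle `arctan (-q / p)`. -/
def angle (θ : TSParams) : ℝ := Real.arctan (-θ.q / θ.p)

/-- `α' = 1 / α`. -/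
def α' (θ : TSParams) : ℝ := 1 / θ.α

/-! Coefficients in case (A): `0 < α < 1`, `σ = 0`. Here `(γ)⁻ = -max (-γ) 0 = min γ 0`. -/

def CL_A (θ : TSParams) : ℝ := -(min θ.γ 0 + θ.δ + θ.ϱ)

def CM_A (θ : TSParams) : ℝ := -(1 / 2) * Real.sign θ.γ

/-! Coefficients in case (B): `1 < α < 2`, `σ = 0`. -/

def CL_B (θ : TSParams) : ℝ :=
  1 / Real.pi * Real.Gamma (1 - θ.α') * θ.r ^ θ.α' * Real.cos (θ.α' * θ.angle)

def CM_B (θ : TSParams) : ℝ := -(1 / Real.pi) * θ.α' * θ.angle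

def CN_B (θ : TSParams) : ℝ :=
  1 / Real.pi * Real.Gamma (1 + θ.α') * θ.r ^ (-θ.α') * Real.cos (θ.α' * θ.angle)

/-! Coefficients in case (C): `0 < α < 1`, `σ > 0`. -/

def CL_C (θ : TSParams) : ℝ := -(θ.γ / 2 + θ.δ + θ.ϱ)

def CM_C (θ : TSParams) : ℝ := -(1 / √(2 * Real.pi)) * θ.γ * θ.σ⁻¹

/-! Coefficients in case (D): `1 < α < 2`, `σ > 0`. -/

def CL_D (θ : TSParams) : ℝ :=
  -(1 / Real.pi) * 2 ^ ((θ.α - 3) / 2) * Real.Gamma ((θ.α - 1) / 2) * θ.p * θ.σ ^ (-(θ.α - 1))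

def CM_D (θ : TSParams) : ℝ :=
  -(1 / Real.pi) * 2 ^ ((θ.α - 2) / 2) * Real.Gamma (θ.α / 2) * θ.q * θ.σ ^ (-θ.α)

def CN_D (θ : TSParams) : ℝ :=
  1 / Real.pi * 2 ^ ((θ.α - 1) / 2) * Real.Gamma ((θ.α + 1) / 2) * θ.p * θ.σ ^ (-(θ.α + 1))

end TSParams

end

end ShortTimeSmile

namespace ShortTimeSmile

/-! ### Laplace integrals of powers -/

/-! Everything is read off Fourier integrals on the line `z = iu + 1/2`, where `z (1 - z) = u² +
1/4`. If `E e^{zX(τ)} = e^{τψ(u)}` there, then the at-the-money call price, digital price and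
log-price density are, up to constants and signs, the real parts of the integrals of `e^{τψ(u)}`
against `1/(u² + 1/4)`, `1/(iu + 1/2)` and `1`, because each strike derivative removes one factor of
`u² + 1/4`. The Black–Scholes model has the same representation with `e^{τψ}` replaced by a
Gaussian. Differentiating the equation that defines implied volatility (`implicit_bsPrice_derivs`,
`smile_at_money`) expresses `χ₀, χ₁, χ₂` through these three numbers, so the theorem reduces to
their behaviour as `τ → 0+`.

The exponent `ψ` is known a priori only on the imaginary axis. The Lévy integral is computed up to
an affine function by differentiating twice in the spectral variable
(`exists_integral_temperedIntegrand_eq`). The formula is carried into the strip `0 ≤ Re z ≤ 1` by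
the three lines theorem (`eq_zero_of_strip`), and the affine part is fixed by the values `E 1 = 1`
and `E e^X = 1`. The result is `ψ = γ z + δ + υ̃ - σ² (u² + 1/4) / 2`, where `υ̃` grows like `|u|^α`
and rescales to a strictly stable exponent.

Three mechanisms give the limits. Stable scaling: for `σ = 0`, `α > 1`, put `u = v/h` with `h =
τ^{1/α}`. Then `τψ` tends to the stable exponent, and the limit integrals are Gamma functions and an
arctangent. The same scaling serves the digital price when `α < 1` and `γ = 0`. Gaussian scaling:
for `σ > 0`, put `u = v/√τ`. The Gaussian factor survives, the jumps are a perturbation of relative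
order `τ^{(2-β)/2}` with `β = max α 1`, and the limit integrals are Gaussian moments
(`tendsto_gauss_integral`). Finite variation: for `α < 1` the price needs no scaling, since `|u|^α /
(u² + 1/4)` is integrable and `(e^{τψ} - 1)/τ` can be passed to the limit once the oscillation
`e^{iτγu}` is split off. That oscillation contributes a multiple of `|γ|` without diffusion and
nothing with it. If moreover `σ = 0` and `γ ≠ 0`, the digital price is `P(X(τ) > 0)`, which is
decided by `X(τ)/τ → γ` in probability.

The passage back from prices to volatilities uses that the at-the-money Black–Scholes price has
slope `1/√(2π)` at zero total volatility, which is the source of every factor `√(2π)`. -/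

lemma integrableOn_rpow_mul_exp_neg {s ε : ℝ} (hs : -1 < s) (hε : 0 < ε) :
    IntegrableOn (fun x : ℝ => x ^ s * Real.exp (-(ε * x))) (Ioi 0) := by
  simpa using integrableOn_rpow_mul_exp_neg_mul_rpow hs one_pos hε

lemma norm_exp_neg_mul_ofReal (w : ℂ) (x : ℝ) :
    ‖Complex.exp (-(w * x))‖ = Real.exp (-(w.re * x)) := by
  simp [Complex.norm_exp]

lemma norm_exp_neg_mul_le {w : ℂ} {ε x : ℝ} (hw : ε ≤ w.re) (hx : 0 ≤ x) :
    ‖Complex.exp (-(w * x))‖ ≤ Real.exp (-(ε * x)) := by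
  rw [norm_exp_neg_mul_ofReal]; gcongr

lemma half_le_re_of_mem_ball {w₀ w : ℂ} (hw : w ∈ Metric.ball w₀ (w₀.re / 2)) :
    w₀.re / 2 ≤ w.re := by
  have h1 : |(w - w₀).re| < w₀.re / 2 :=
    (Complex.abs_re_le_norm _).trans_lt (by simpa [dist_eq_norm] using hw)
  rw [Complex.sub_re, abs_lt] at h1
  linarith

lemma hasDerivAt_exp_neg_mul (w : ℂ) (x : ℝ) :
    HasDerivAt (fun w : ℂ => Complex.exp (-(w * x))) (-(x * Complex.exp (-(w * x)))) w := by
  have := ((hasDerivAt_id w).mul_const (x : ℂ)).neg.cexp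
  refine this.congr_deriv ?_
  simp [mul_comm]

lemma aestronglyMeasurable_rpow_mul_exp (s : ℝ) (w : ℂ) :
    AEStronglyMeasurable (fun x : ℝ => ((x ^ s : ℝ) : ℂ) * Complex.exp (-(w * x)))
      (volume.restrict (Ioi 0)) := by
  apply Measurable.aestronglyMeasurable
  fun_prop

lemma integrableOn_rpow_mul_cexp {s : ℝ} (hs : -1 < s) {w : ℂ} (hw : 0 < w.re) :
    IntegrableOn (fun x : ℝ => ((x ^ s : ℝ) : ℂ) * Complex.exp (-(w * x))) (Ioi 0) := by
  refine (integrableOn_rpow_mul_exp_neg hs hw).mono' (aestronglyMeasurable_rpow_mul_exp s w) ?_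
  filter_upwards [ae_restrict_mem measurableSet_Ioi] with x hx
  rw [norm_mul, norm_exp_neg_mul_ofReal, Complex.norm_real,
    Real.norm_of_nonneg (Real.rpow_nonneg (le_of_lt hx) _)]

lemma isOpen_re_pos : IsOpen {w : ℂ | 0 < w.re} := isOpen_lt continuous_const Complex.continuous_re

lemma isPreconnected_re_pos : IsPreconnected {w : ℂ | 0 < w.re} :=
  (convex_halfSpace_re_gt 0).isPreconnected

/-- Both sides are holomorphic in the right half-plane and agree on the positive reals, so the
identity theorem applies. -/
lemma integral_rpow_mul_cexp {s : ℝ} (hs : 0 < s) {w : ℂ} (hw : 0 < w.re) :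
    ∫ x in Ioi (0 : ℝ), ((x ^ (s - 1) : ℝ) : ℂ) * Complex.exp (-(w * x)) =
      Real.Gamma s * w ^ (-(s : ℂ)) := by
  have hs1 : -1 < s - 1 := by linarith
  have hd : DifferentiableOn ℂ (fun w : ℂ => ∫ x in Ioi (0 : ℝ),
      ((x ^ (s - 1) : ℝ) : ℂ) * Complex.exp (-(w * x))) {w : ℂ | 0 < w.re} := by
    intro w₀ hw₀
    have hw₀' : 0 < w₀.re / 2 := half_pos hw₀
    refine (hasDerivAt_integral_of_dominated_loc_of_deriv_le
      (F' := fun w x => ((x ^ (s - 1) : ℝ) : ℂ) * -(x * Complex.exp (-(w * x))))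
      (bound := fun x => x ^ s * Real.exp (-(w₀.re / 2 * x)))
      (Metric.ball_mem_nhds w₀ hw₀') (Eventually.of_forall fun w =>
        aestronglyMeasurable_rpow_mul_exp _ w) (integrableOn_rpow_mul_cexp hs1 hw₀)
      ?_ ?_ (integrableOn_rpow_mul_exp_neg (by linarith) hw₀') ?_).2.differentiableAt.differentiableWithinAt
    · apply Measurable.aestronglyMeasurable
      fun_prop
    · filter_upwards [ae_restrict_mem measurableSet_Ioi] with x hx w hw
      have hx0 : 0 < x := hx
      have hx' : x ^ s = x ^ (s - 1) * x := by rw [← Real.rpow_add_one hx0.ne']; simp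
      rw [norm_mul, norm_neg, norm_mul, Complex.norm_real, Complex.norm_real,
        Real.norm_of_nonneg (Real.rpow_nonneg hx0.le _), Real.norm_of_nonneg hx0.le, hx', mul_assoc]
      have := norm_exp_neg_mul_le (half_le_re_of_mem_ball hw) hx0.le
      gcongr
    · filter_upwards with x w _
      exact (hasDerivAt_exp_neg_mul w x).const_mul _
  have hd2 : DifferentiableOn ℂ (fun w : ℂ => (Real.Gamma s : ℂ) * w ^ (-(s : ℂ)))
      {w : ℂ | 0 < w.re} := by
    intro w hw
    refine (DifferentiableAt.const_mul ?_ _).differentiableWithinAt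
    exact differentiableAt_id.cpow_const (Or.inl hw)
  refine (hd.analyticOnNhd isOpen_re_pos).eqOn_of_preconnected_of_frequently_eq
    (hd2.analyticOnNhd isOpen_re_pos) isPreconnected_re_pos (z₀ := 1) (by simp) ?_ hw
  have hreal : ∀ r : ℝ, 0 < r → ∫ x in Ioi (0 : ℝ), ((x ^ (s - 1) : ℝ) : ℂ) *
      Complex.exp (-((r : ℂ) * x)) = Real.Gamma s * (r : ℂ) ^ (-(s : ℂ)) := by
    intro r hr
    have := Complex.integral_cpow_mul_exp_neg_mul_Ioi (a := s) (r := r) (by simpa using hs) hr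
    rw [Complex.Gamma_ofReal] at this
    rw [mul_comm, Complex.cpow_neg, ← Complex.inv_cpow, ← one_div, ← this]
    · refine setIntegral_congr_fun measurableSet_Ioi fun x hx => ?_
      rw [Complex.ofReal_cpow (le_of_lt hx)]
      push_cast
      rfl
    · rw [Complex.arg_ofReal_of_nonneg hr.le]
      exact Real.pi_pos.ne
  -- Real points accumulating at `1` without reaching it, as the identity theorem requires.
  have ht : Tendsto (fun n : ℕ => (((1 + 1 / ((n : ℝ) + 1) : ℝ)) : ℂ)) atTop (𝓝[≠] 1) := by
    refine tendsto_nhdsWithin_iff.2 ⟨?_, Eventually.of_forall fun n => ?_⟩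
    · have := (tendsto_one_div_add_atTop_nhds_zero_nat (𝕜 := ℝ)).const_add 1
      rw [add_zero] at this
      exact_mod_cast (Complex.continuous_ofReal.tendsto 1).comp this
    · have : (0 : ℝ) < 1 / ((n : ℝ) + 1) := by positivity
      intro h
      rw [mem_singleton_iff, Complex.ofReal_eq_one] at h
      linarith
  exact ht.frequently (Frequently.of_forall fun n => hreal _ (by positivity))

/-! ### The Lévy integral of a one-sided tempered stable measure -/

/-- The integrand of the Lévy–Khinchine formula of a one-sided tempered stable measure with
tempering `κ`, at `κ - z = w`. -/
noncomputable def temperedIntegrand (α κ : ℝ) (w : ℂ) (x : ℝ) : ℂ :=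
  ((x ^ (-α - 1) : ℝ) : ℂ) * (Complex.exp (-(w * x)) - Complex.exp (-((κ : ℂ) * x)) +
    if x ≤ 1 then (w - κ) * x * Complex.exp (-((κ : ℂ) * x)) else 0)

/-- The derivative of `temperedIntegrand` in `w`. -/
noncomputable def temperedIntegrandDeriv (α κ : ℝ) (w : ℂ) (x : ℝ) : ℂ :=
  ((x ^ (-α) : ℝ) : ℂ) * (-Complex.exp (-(w * x)) +
    if x ≤ 1 then Complex.exp (-((κ : ℂ) * x)) else 0)

/-- A function behaving like `x ^ a` on `(0, 1]` and like `x ^ b` on `(1, ∞)`. -/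
noncomputable def powMajorant (a b : ℝ) (x : ℝ) : ℝ :=
  if x ≤ 1 then x ^ a else x ^ b

lemma integrableOn_powMajorant {a b : ℝ} (ha : -1 < a) (hb : b < -1) :
    IntegrableOn (powMajorant a b) (Ioi 0) := by
  rw [← Ioc_union_Ioi_eq_Ioi (zero_le_one (α := ℝ))]
  refine IntegrableOn.union ?_ ?_
  · refine IntegrableOn.congr_fun (f := fun x : ℝ => x ^ a) ?_ (fun x hx => ?_)
      measurableSet_Ioc
    · rw [← intervalIntegrable_iff_integrableOn_Ioc_of_le zero_le_one]
      exact intervalIntegral.intervalIntegrable_rpow' ha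
    · simp [powMajorant, hx.2]
  · refine IntegrableOn.congr_fun (f := fun x : ℝ => x ^ b)
      (integrableOn_Ioi_rpow_of_lt hb one_pos) (fun x hx => ?_) measurableSet_Ioi
    simp [powMajorant, not_le.2 (mem_Ioi.1 hx)]

lemma integrableOn_powMajorant_of_lt_two {α : ℝ} (h0 : 0 < α) (h2 : α < 2) :
    IntegrableOn (powMajorant (1 - α) (-α - 1)) (Ioi 0) :=
  integrableOn_powMajorant (by linarith) (by linarith)

lemma measurable_temperedIntegrand (α κ : ℝ) (w : ℂ) : Measurable (temperedIntegrand α κ w) := by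
  unfold temperedIntegrand
  refine Measurable.mul (by fun_prop) (Measurable.add (by fun_prop) ?_)
  exact Measurable.ite measurableSet_Iic (by fun_prop) (by fun_prop)

lemma measurable_temperedIntegrandDeriv (α κ : ℝ) (w : ℂ) :
    Measurable (temperedIntegrandDeriv α κ w) := by
  unfold temperedIntegrandDeriv
  refine Measurable.mul (by fun_prop) (Measurable.add (by fun_prop) ?_)
  exact Measurable.ite measurableSet_Iic (by fun_prop) (by fun_prop)

lemma norm_exp_sub_one_sub_le (y : ℂ) : ‖Complex.exp y - 1 - y‖ ≤ ‖y‖ ^ 2 * Real.exp ‖y‖ := by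
  have := Complex.norm_exp_sub_sum_le_norm_mul_exp y 2
  simpa [Finset.sum_range_succ, sub_sub] using this

lemma norm_exp_sub_one_le (y : ℂ) : ‖Complex.exp y - 1‖ ≤ ‖y‖ * Real.exp ‖y‖ := by
  have := Complex.norm_exp_sub_sum_le_norm_mul_exp y 1
  simpa using this

/-- On `(0, 1]` the compensator leaves a second-order Taylor remainder, worth two powers of `x`;
beyond `1` both exponentials are at most `1` in modulus. No decay from `w` is used, so the bound
survives on the imaginary axis. -/
lemma norm_temperedIntegrand_le {α κ R : ℝ} (hκ : 0 ≤ κ) {w : ℂ} (hw : 0 ≤ w.re)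
    (hR : ‖w - κ‖ ≤ R) {x : ℝ} (hx : 0 < x) :
    ‖temperedIntegrand α κ w x‖ ≤ (R ^ 2 * Real.exp R + 2) * powMajorant (1 - α) (-α - 1) x := by
  have hR0 : 0 ≤ R := (norm_nonneg _).trans hR
  have hxp : ∀ s : ℝ, 0 ≤ x ^ s := fun s => Real.rpow_nonneg hx.le s
  have hκx : ‖Complex.exp (-((κ : ℂ) * x))‖ ≤ 1 := by
    rw [norm_exp_neg_mul_ofReal, Real.exp_le_one_iff]
    simpa using mul_nonneg hκ hx.le
  rw [temperedIntegrand, powMajorant, norm_mul, Complex.norm_real, Real.norm_of_nonneg (hxp _)]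
  split_ifs with h1
  · have e : Complex.exp (-(w * x)) - Complex.exp (-((κ : ℂ) * x)) +
        (w - κ) * x * Complex.exp (-((κ : ℂ) * x)) =
        Complex.exp (-((κ : ℂ) * x)) *
          (Complex.exp (-((w - κ) * x)) - 1 - (-((w - κ) * x))) := by
      have : Complex.exp (-(w * x)) = Complex.exp (-((κ : ℂ) * x)) *
          Complex.exp (-((w - κ) * x)) := by rw [← Complex.exp_add]; ring_nf
      rw [this]; ring
    have hn : ‖-((w - κ) * x)‖ ≤ R * x := by
      rw [norm_neg, norm_mul, Complex.norm_real, Real.norm_of_nonneg hx.le]; gcongr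
    have hn' : ‖-((w - κ) * x)‖ ≤ R := hn.trans (mul_le_of_le_one_right hR0 h1)
    have hx2 : x ^ (1 - α) = x ^ (-α - 1) * x ^ 2 := by
      rw [← Real.rpow_natCast, ← Real.rpow_add hx]; norm_num; ring_nf
    rw [e, norm_mul, hx2]
    calc x ^ (-α - 1) * (_ * _) ≤ x ^ (-α - 1) * (1 * ((R * x) ^ 2 * Real.exp R)) := by
          have := (norm_exp_sub_one_sub_le (-((w - κ) * x))).trans
            (mul_le_mul (pow_le_pow_left₀ (norm_nonneg _) hn 2) (Real.exp_le_exp.2 hn')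
              (Real.exp_pos _).le (by positivity))
          gcongr
      _ ≤ _ := by
          have := mul_nonneg (hxp (-α - 1)) (sq_nonneg x)
          nlinarith
  · rw [add_zero, mul_comm]
    have : ‖Complex.exp (-(w * x)) - Complex.exp (-((κ : ℂ) * x))‖ ≤ 2 := by
      refine (norm_sub_le _ _).trans ?_
      have : ‖Complex.exp (-(w * x))‖ ≤ 1 := by
        rw [norm_exp_neg_mul_ofReal, Real.exp_le_one_iff]
        simpa using mul_nonneg hw hx.le
      linarith
    refine mul_le_mul_of_nonneg_right (this.trans ?_) (hxp _)
    have : 0 ≤ R ^ 2 * Real.exp R := by positivity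
    linarith

lemma integrableOn_temperedIntegrand {α κ : ℝ} (h0 : 0 < α) (h2 : α < 2) (hκ : 0 ≤ κ) {w : ℂ}
    (hw : 0 ≤ w.re) : IntegrableOn (temperedIntegrand α κ w) (Ioi 0) := by
  refine ((integrableOn_powMajorant_of_lt_two h0 h2).const_mul
    (‖w - κ‖ ^ 2 * Real.exp ‖w - κ‖ + 2)).mono'
    (measurable_temperedIntegrand α κ w).aestronglyMeasurable ?_
  filter_upwards [ae_restrict_mem measurableSet_Ioi] with x hx
  exact norm_temperedIntegrand_le hκ hw le_rfl hx

lemma norm_temperedIntegrandDeriv_le {α κ R ε : ℝ} (hκ : 0 ≤ κ) {w : ℂ} (hε : 0 < ε)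
    (hw : ε ≤ w.re) (hR : ‖w - κ‖ ≤ R) {x : ℝ} (hx : 0 < x) :
    ‖temperedIntegrandDeriv α κ w x‖ ≤
      (R * Real.exp (R + ε) + 1) * (x ^ (1 - α) * Real.exp (-(ε * x))) := by
  have hR0 : 0 ≤ R := (norm_nonneg _).trans hR
  have hxp : ∀ s : ℝ, 0 ≤ x ^ s := fun s => Real.rpow_nonneg hx.le s
  have hx1 : x ^ (1 - α) = x ^ (-α) * x := by
    rw [← Real.rpow_add_one hx.ne']; ring_nf
  rw [temperedIntegrandDeriv, norm_mul, Complex.norm_real, Real.norm_of_nonneg (hxp _), hx1]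
  split_ifs with h1
  · have hκx : ‖Complex.exp (-((κ : ℂ) * x))‖ ≤ 1 := by
      rw [norm_exp_neg_mul_ofReal, Real.exp_le_one_iff]
      simpa using mul_nonneg hκ hx.le
    have e : -Complex.exp (-(w * x)) + Complex.exp (-((κ : ℂ) * x)) =
        -(Complex.exp (-((κ : ℂ) * x)) * (Complex.exp (-((w - κ) * x)) - 1)) := by
      have : Complex.exp (-(w * x)) = Complex.exp (-((κ : ℂ) * x)) *
          Complex.exp (-((w - κ) * x)) := by rw [← Complex.exp_add]; ring_nf
      rw [this]; ring
    have hn : ‖-((w - κ) * x)‖ ≤ R * x := by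
      rw [norm_neg, norm_mul, Complex.norm_real, Real.norm_of_nonneg hx.le]; gcongr
    have hn' : ‖-((w - κ) * x)‖ ≤ R := hn.trans (mul_le_of_le_one_right hR0 h1)
    have h3 : ‖Complex.exp (-((w - κ) * x)) - 1‖ ≤ R * x * Real.exp R :=
      (norm_exp_sub_one_le _).trans (mul_le_mul hn (Real.exp_le_exp.2 hn')
        (Real.exp_pos _).le (by positivity))
    -- On `x ≤ 1` the factor `e^ε` pays for inserting `e^{-εx}`, so that one majorant serves both
    -- ranges.
    have h4 : Real.exp R ≤ Real.exp (R + ε) * Real.exp (-(ε * x)) := by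
      rw [← Real.exp_add]
      gcongr
      nlinarith
    rw [e, norm_neg, norm_mul]
    calc x ^ (-α) * (_ * _) ≤ x ^ (-α) * (1 * (R * x * (Real.exp (R + ε) * Real.exp (-(ε * x))))) := by
          have := h3.trans (mul_le_mul_of_nonneg_left h4 (by positivity))
          gcongr
      _ ≤ _ := by
          have := mul_nonneg (mul_nonneg (hxp (-α)) hx.le) (Real.exp_pos (-(ε * x))).le
          nlinarith
  · rw [add_zero, norm_neg]
    have h3 := norm_exp_neg_mul_le hw hx.le
    have h5 : 0 ≤ R * Real.exp (R + ε) := by positivity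
    push Not at h1
    calc x ^ (-α) * ‖Complex.exp (-(w * x))‖ ≤ x ^ (-α) * Real.exp (-(ε * x)) :=
          mul_le_mul_of_nonneg_left h3 (hxp _)
      _ ≤ x ^ (-α) * x * Real.exp (-(ε * x)) := by
          have := hxp (-α)
          gcongr
          nlinarith
      _ ≤ _ := by
          have := mul_nonneg (mul_nonneg (hxp (-α)) hx.le) (Real.exp_pos (-(ε * x))).le
          nlinarith

lemma norm_sub_le_of_mem_ball {w₀ w : ℂ} {r : ℝ} (c : ℂ) (hw : w ∈ Metric.ball w₀ r) :
    ‖w - c‖ ≤ ‖w₀ - c‖ + r := by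
  have h : ‖w - w₀‖ < r := by simpa [dist_eq_norm] using hw
  calc ‖w - c‖ = ‖(w₀ - c) + (w - w₀)‖ := by ring_nf
    _ ≤ _ := (norm_add_le _ _).trans (by linarith)

lemma hasDerivAt_integral_temperedIntegrand {α κ : ℝ} (h0 : 0 < α) (h2 : α < 2) (hκ : 0 ≤ κ)
    {w₀ : ℂ} (hw₀ : 0 < w₀.re) :
    HasDerivAt (fun w => ∫ x in Ioi (0 : ℝ), temperedIntegrand α κ w x)
      (∫ x in Ioi (0 : ℝ), temperedIntegrandDeriv α κ w₀ x) w₀ := by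
  have hε : 0 < w₀.re / 2 := half_pos hw₀
  refine (hasDerivAt_integral_of_dominated_loc_of_deriv_le
    (F' := temperedIntegrandDeriv α κ)
    (bound := fun x => ((‖w₀ - κ‖ + w₀.re / 2) * Real.exp ((‖w₀ - κ‖ + w₀.re / 2) + w₀.re / 2) + 1)
      * (x ^ (1 - α) * Real.exp (-(w₀.re / 2 * x))))
    (Metric.ball_mem_nhds w₀ hε) (Eventually.of_forall fun w =>
      (measurable_temperedIntegrand α κ w).aestronglyMeasurable)
    (integrableOn_temperedIntegrand h0 h2 hκ hw₀.le)
    (measurable_temperedIntegrandDeriv α κ w₀).aestronglyMeasurable ?_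
    ((integrableOn_rpow_mul_exp_neg (by linarith) hε).const_mul _) ?_).2
  · filter_upwards [ae_restrict_mem measurableSet_Ioi] with x hx w hw
    exact norm_temperedIntegrandDeriv_le hκ hε (half_le_re_of_mem_ball hw)
      (norm_sub_le_of_mem_ball _ hw) hx
  · filter_upwards [ae_restrict_mem measurableSet_Ioi] with x hx w _
    have hx0 : (0 : ℝ) < x := hx
    have hxp : ((x ^ (-α) : ℝ) : ℂ) = ((x ^ (-α - 1) : ℝ) : ℂ) * x := by
      rw [← Complex.ofReal_mul, ← Real.rpow_add_one hx0.ne']; ring_nf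
    unfold temperedIntegrand temperedIntegrandDeriv
    rw [hxp, mul_assoc]
    refine HasDerivAt.const_mul _ ?_
    split_ifs with h1
    · refine (((hasDerivAt_exp_neg_mul w x).sub_const _).add
        ((((hasDerivAt_id w).sub_const (κ : ℂ)).mul_const (x : ℂ)).mul_const _)).congr_deriv ?_
      ring
    · refine (((hasDerivAt_exp_neg_mul w x).sub_const _).add_const _).congr_deriv ?_
      ring

/-- The compensating terms are affine in `w`, so the second derivative retains only `x^{1-α}
e^{-wx}`, whose integral is a convergent Gamma integral for every `α < 2`. -/
lemma hasDerivAt_integral_temperedIntegrandDeriv {α κ : ℝ} (h2 : α < 2) (hκ : 0 ≤ κ)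
    {w₀ : ℂ} (hw₀ : 0 < w₀.re) :
    HasDerivAt (fun w => ∫ x in Ioi (0 : ℝ), temperedIntegrandDeriv α κ w x)
      (Real.Gamma (2 - α) * w₀ ^ (((α - 2 : ℝ)) : ℂ)) w₀ := by
  have hε : 0 < w₀.re / 2 := half_pos hw₀
  have key := (hasDerivAt_integral_of_dominated_loc_of_deriv_le
    (μ := volume.restrict (Ioi (0 : ℝ)))
    (F := temperedIntegrandDeriv α κ)
    (F' := fun w x => ((x ^ ((2 - α) - 1) : ℝ) : ℂ) * Complex.exp (-(w * x)))
    (bound := fun x => x ^ (1 - α) * Real.exp (-(w₀.re / 2 * x)))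
    (Metric.ball_mem_nhds w₀ hε) (Eventually.of_forall fun w =>
      (measurable_temperedIntegrandDeriv α κ w).aestronglyMeasurable)
    ?_ (aestronglyMeasurable_rpow_mul_exp _ w₀) ?_
    (integrableOn_rpow_mul_exp_neg (by linarith) hε) ?_).2
  · refine key.congr_deriv ?_
    rw [integral_rpow_mul_cexp (by linarith) hw₀]
    push_cast
    ring_nf
  · refine ((integrableOn_rpow_mul_exp_neg (s := 1 - α) (by linarith) hw₀).const_mul
      (‖w₀ - κ‖ * Real.exp (‖w₀ - κ‖ + w₀.re) + 1)).mono'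
      (measurable_temperedIntegrandDeriv α κ w₀).aestronglyMeasurable ?_
    filter_upwards [ae_restrict_mem measurableSet_Ioi] with x hx
    exact norm_temperedIntegrandDeriv_le hκ hw₀ le_rfl le_rfl hx
  · filter_upwards [ae_restrict_mem measurableSet_Ioi] with x hx w hw
    have hx0 : (0 : ℝ) < x := hx
    rw [norm_mul, Complex.norm_real, Real.norm_of_nonneg (Real.rpow_nonneg hx0.le _)]
    have := norm_exp_neg_mul_le (half_le_re_of_mem_ball hw) hx0.le
    rw [show 2 - α - 1 = 1 - α by ring]
    gcongr
  · filter_upwards [ae_restrict_mem measurableSet_Ioi] with x hx w _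
    have hx0 : (0 : ℝ) < x := hx
    have hxp : ((x ^ (2 - α - 1) : ℝ) : ℂ) = ((x ^ (-α) : ℝ) : ℂ) * x := by
      rw [← Complex.ofReal_mul, ← Real.rpow_add_one hx0.ne']; ring_nf
    unfold temperedIntegrandDeriv
    rw [hxp, mul_assoc]
    refine HasDerivAt.const_mul _ ?_
    refine ((hasDerivAt_exp_neg_mul w x).neg.add_const _).congr_deriv ?_
    ring

lemma Gamma_two_sub {α : ℝ} (h0 : α ≠ 0) (h1 : α ≠ 1) :
    Real.Gamma (2 - α) = α * (α - 1) * Real.Gamma (-α) := by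
  have e1 : Real.Gamma (2 - α) = (1 - α) * Real.Gamma (1 - α) := by
    rw [← Real.Gamma_add_one (sub_ne_zero.2 h1.symm)]; ring_nf
  have e2 : Real.Gamma (1 - α) = -α * Real.Gamma (-α) := by
    rw [← Real.Gamma_add_one (neg_ne_zero.2 h0)]; ring_nf
  rw [e1, e2]; ring

/-- Continuity up to the boundary is needed because the formula is used at `w = κ ± iu`, and `κ` may
vanish on the negative side. -/
lemma continuousOn_integral_temperedIntegrand {α κ : ℝ} (h0 : 0 < α) (h2 : α < 2) (hκ : 0 ≤ κ) :
    ContinuousOn (fun w => ∫ x in Ioi (0 : ℝ), temperedIntegrand α κ w x) {w | 0 ≤ w.re} := by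
  intro w₀ _
  refine continuousWithinAt_of_dominated
    (bound := fun x => ((‖w₀ - κ‖ + 1) ^ 2 * Real.exp (‖w₀ - κ‖ + 1) + 2) * powMajorant (1 - α) (-α - 1) x)
    (Eventually.of_forall fun w => (measurable_temperedIntegrand α κ w).aestronglyMeasurable)
    ?_ ((integrableOn_powMajorant_of_lt_two h0 h2).const_mul _) ?_
  · filter_upwards [self_mem_nhdsWithin,
      mem_nhdsWithin_of_mem_nhds (Metric.ball_mem_nhds w₀ one_pos)] with w hw hw'
    filter_upwards [ae_restrict_mem measurableSet_Ioi] with x hx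
    exact norm_temperedIntegrand_le hκ hw (norm_sub_le_of_mem_ball _ hw') hx
  · filter_upwards with x
    refine Continuous.continuousWithinAt ?_
    unfold temperedIntegrand
    split_ifs <;> fun_prop

/-- The Lévy integral of a one-sided tempered stable measure, up to an affine function. -/
lemma exists_integral_temperedIntegrand_eq {α κ : ℝ} (h0 : 0 < α) (h2 : α < 2) (h1 : α ≠ 1)
    (hκ : 0 ≤ κ) : ∃ A B : ℂ, ∀ w : ℂ, 0 ≤ w.re →
      ∫ x in Ioi (0 : ℝ), temperedIntegrand α κ w x =
        Real.Gamma (-α) * w ^ (α : ℂ) + A * w + B := by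
  set J' : ℂ → ℂ := fun w => ∫ x in Ioi (0 : ℝ), temperedIntegrandDeriv α κ w x with hJ'
  set J : ℂ → ℂ := fun w => ∫ x in Ioi (0 : ℝ), temperedIntegrand α κ w x with hJ
  have hpow : ∀ (c : ℂ) (w : ℂ), 0 < w.re →
      HasDerivAt (fun w : ℂ => w ^ c) (c * w ^ (c - 1)) w := fun c w hw => by
    simpa using (hasDerivAt_id w).cpow_const (c := c) (Or.inl hw)
  have hG : (Real.Gamma (2 - α) : ℂ) = α * (α - 1) * Real.Gamma (-α) := by
    rw [Gamma_two_sub h0.ne' h1]; push_cast; ring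
  -- The second derivatives of the integral and of `Γ(-α) w^α` coincide because `Γ(2-α) = α (α-1)
  -- Γ(-α)`. Two integrations over a connected set produce the constants `A` and `B`.
  have d2 : ∀ w : ℂ, 0 < w.re → HasDerivAt
      (fun w => J' w - Real.Gamma (-α) * (α * w ^ ((α : ℂ) - 1))) 0 w := fun w hw => by
    refine ((hasDerivAt_integral_temperedIntegrandDeriv h2 hκ hw).sub
      (((hpow ((α : ℂ) - 1) w hw).const_mul (α : ℂ)).const_mul (Real.Gamma (-α) : ℂ))).congr_deriv ?_
    rw [hG]
    push_cast
    ring_nf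
  obtain ⟨A, hA⟩ := isOpen_re_pos.exists_is_const_of_deriv_eq_zero isPreconnected_re_pos
    (fun w hw => (d2 w hw).differentiableAt.differentiableWithinAt) (fun w hw => (d2 w hw).deriv)
  have d1 : ∀ w : ℂ, 0 < w.re → HasDerivAt
      (fun w => J w - Real.Gamma (-α) * w ^ (α : ℂ) - A * w) 0 w := fun w hw => by
    refine (((hasDerivAt_integral_temperedIntegrand h0 h2 hκ hw).sub
      ((hpow (α : ℂ) w hw).const_mul (Real.Gamma (-α) : ℂ))).sub
      ((hasDerivAt_id w).const_mul A)).congr_deriv ?_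
    have := hA w hw
    simp only [hJ'] at this
    rw [this]; ring
  obtain ⟨B, hB⟩ := isOpen_re_pos.exists_is_const_of_deriv_eq_zero isPreconnected_re_pos
    (fun w hw => (d1 w hw).differentiableAt.differentiableWithinAt) (fun w hw => (d1 w hw).deriv)
  refine ⟨A, B, fun w hw => ?_⟩
  have hc : ContinuousOn (fun w : ℂ => Real.Gamma (-α) * w ^ (α : ℂ) + A * w + B)
      {w | 0 ≤ w.re} := by
    intro w hw
    refine ContinuousAt.continuousWithinAt ?_
    have := Complex.continuousAt_cpow_const_of_re_pos (z := w) (w := (α : ℂ)) (Or.inl hw)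
      (by simpa using h0)
    exact ((this.const_mul _).add (continuousAt_id.const_mul _)).add_const _
  have hcl : closure {w : ℂ | 0 < w.re} = {w | 0 ≤ w.re} := Complex.closure_setOfPred_lt_re 0
  have heq : EqOn J (fun w : ℂ => Real.Gamma (-α) * w ^ (α : ℂ) + A * w + B) {w | 0 < w.re} := by
    intro w hw
    have := hB w hw
    simp only at this ⊢
    rw [← this]; ring
  exact heq.of_subset_closure (continuousOn_integral_temperedIntegrand h0 h2 hκ) hc
    (fun w hw => le_of_lt (a := (0 : ℝ)) hw) hcl.ge hw

/-! ### The characteristic exponent of a tempered stable process -/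

lemma integral_eq_integral_Ioi_add_neg {f g h : ℝ → ℂ} (hg : IntegrableOn g (Ioi 0))
    (hh : IntegrableOn h (Ioi 0)) (hfg : ∀ x, 0 < x → f x = g x)
    (hfh : ∀ x, 0 < x → f (-x) = h x) :
    ∫ x, f x = (∫ x in Ioi (0 : ℝ), g x) + ∫ x in Ioi (0 : ℝ), h x := by
  have h1 : IntegrableOn f (Ioi 0) :=
    hg.congr_fun (fun x hx => (hfg x hx).symm) measurableSet_Ioi
  have h2' : IntegrableOn (f ∘ Neg.neg) (Neg.neg ⁻¹' Iio (0 : ℝ)) := by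
    refine IntegrableOn.congr_fun (f := h) ?_ (fun x hx => (hfh x (by simpa using hx)).symm)
      (measurableSet_Iio.preimage measurable_neg)
    simpa using hh
  have h2 : IntegrableOn f (Iic 0) := by
    rw [integrableOn_Iic_iff_integrableOn_Iio]
    exact ((Measure.measurePreserving_neg (volume : Measure ℝ)).integrableOn_comp_preimage
      (MeasurableEquiv.neg ℝ).measurableEmbedding).1 h2'
  have h3 : ∫ x in Iic (0 : ℝ), f x = ∫ x in Ioi (0 : ℝ), h x := by
    have := integral_comp_neg_Ioi (0 : ℝ) f
    rw [neg_zero] at this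
    rw [← this]
    exact setIntegral_congr_fun measurableSet_Ioi fun x hx => hfh x hx
  rw [← intervalIntegral.integral_Iic_add_Ioi h2 h1, h3, add_comm]
  congr 1
  exact setIntegral_congr_fun measurableSet_Ioi fun x hx => hfg x hx

namespace TSParams

/-- The cumulant function of a tempered stable process with an affine term `A z + B`. -/
noncomputable def affineCumulant (θ : TSParams) (A B z : ℂ) : ℂ :=
  A * z + B + (θ.σ : ℂ) ^ 2 * z ^ 2 / 2 + θ.aPos * ((θ.κPos : ℂ) - z) ^ (θ.α : ℂ) +
    θ.aNeg * ((θ.κNeg : ℂ) + z) ^ (θ.α : ℂ)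

/-- The drift `b`, the truncation terms and the constants of integration are all absorbed in `A` and
`B`. They need not be computed, because normalisation and the martingale condition determine them
later. -/
lemma exists_levyExponent_eq {θ : TSParams} (hθ : θ.Admissible) (b : ℝ) : ∃ A B : ℂ, ∀ u : ℝ,
    levyExponent b θ.σ θ.levyMeasure u = θ.affineCumulant A B (Complex.I * u) := by
  have hκP : 0 ≤ θ.κPos := zero_le_one.trans hθ.one_le_κPos
  obtain ⟨A₁, B₁, h₁⟩ :=
    exists_integral_temperedIntegrand_eq hθ.α_pos hθ.α_lt_two hθ.α_ne_one hκP
  obtain ⟨A₂, B₂, h₂⟩ :=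
    exists_integral_temperedIntegrand_eq hθ.α_pos hθ.α_lt_two hθ.α_ne_one hθ.κNeg_nonneg
  refine ⟨b - θ.cPos * A₁ + θ.cNeg * A₂,
    θ.cPos * (A₁ * θ.κPos + B₁) + θ.cNeg * (A₂ * θ.κNeg + B₂), fun u => ?_⟩
  have hr1 : 0 ≤ ((θ.κPos : ℂ) - Complex.I * u).re := by simpa using hκP
  have hr2 : 0 ≤ ((θ.κNeg : ℂ) + Complex.I * u).re := by simpa using hθ.κNeg_nonneg
  have hint : ∫ x : ℝ, (Complex.exp (Complex.I * u * x) - 1 -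
      (if |x| ≤ 1 then Complex.I * u * x else 0)) ∂θ.levyMeasure =
      (∫ x in Ioi (0 : ℝ), θ.cPos * temperedIntegrand θ.α θ.κPos (θ.κPos - Complex.I * u) x) +
      ∫ x in Ioi (0 : ℝ), θ.cNeg * temperedIntegrand θ.α θ.κNeg (θ.κNeg + Complex.I * u) x := by
    rw [levyMeasure, integral_withDensity_eq_integral_toReal_smul]
    · refine integral_eq_integral_Ioi_add_neg
        ((integrableOn_temperedIntegrand hθ.α_pos hθ.α_lt_two hκP hr1).const_mul _)
        ((integrableOn_temperedIntegrand hθ.α_pos hθ.α_lt_two hθ.κNeg_nonneg hr2).const_mul _)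
        (fun x hx => ?_) (fun x hx => ?_)
      · have hxp : θ.cPos / x ^ (θ.α + 1) = θ.cPos * x ^ (-θ.α - 1) := by
          rw [div_eq_mul_inv, ← Real.rpow_neg hx.le]; ring_nf
        have e1 : Complex.exp (-(((θ.κPos : ℂ) - Complex.I * u) * x)) =
            Complex.exp (Complex.I * u * x) * Complex.exp (-((θ.κPos : ℂ) * x)) := by
          rw [← Complex.exp_add]; ring_nf
        rw [if_pos hx, hxp, ENNReal.toReal_ofReal (mul_nonneg (mul_nonneg hθ.cPos_nonneg
          (Real.rpow_nonneg hx.le _)) (Real.exp_pos _).le), Complex.real_smul, temperedIntegrand,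
          e1, abs_of_pos hx]
        push_cast
        split_ifs <;> ring_nf
      · have hxp : θ.cNeg / x ^ (θ.α + 1) = θ.cNeg * x ^ (-θ.α - 1) := by
          rw [div_eq_mul_inv, ← Real.rpow_neg hx.le]; ring_nf
        have e1 : Complex.exp (-(((θ.κNeg : ℂ) + Complex.I * u) * x)) =
            Complex.exp (-(Complex.I * u * x)) * Complex.exp (-((θ.κNeg : ℂ) * x)) := by
          rw [← Complex.exp_add]; ring_nf
        rw [if_neg (by linarith), if_pos (by linarith), abs_neg, abs_of_pos hx, hxp,
          ENNReal.toReal_ofReal (mul_nonneg (mul_nonneg hθ.cNeg_nonneg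
          (Real.rpow_nonneg hx.le _)) (Real.exp_pos _).le), Complex.real_smul, temperedIntegrand, e1]
        push_cast
        split_ifs <;> ring_nf
    · refine ENNReal.measurable_ofReal.comp ?_
      refine Measurable.ite measurableSet_Ioi (by fun_prop)
        (Measurable.ite measurableSet_Iio ?_ measurable_const)
      exact (measurable_const.div ((continuous_abs.measurable).pow_const _)).mul
        (Real.measurable_exp.comp (continuous_abs.measurable.const_mul _))
    · exact Eventually.of_forall fun x => ENNReal.ofReal_lt_top
  rw [levyExponent, hint, integral_const_mul, integral_const_mul, h₁ _ hr1, h₂ _ hr2,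
    affineCumulant, aPos, aNeg, mul_pow, Complex.I_sq]
  push_cast
  ring

end TSParams

/-! ### Extension of the characteristic function to a strip -/

/-- Two functions on a strip which agree on one boundary line are equal, if their difference grows
at most like the exponential of a quadratic function. -/
lemma eq_zero_of_strip {f : ℂ → ℂ} {C : ℝ}
    (hc : ContinuousOn f {z | 0 ≤ z.re ∧ z.re ≤ 1})
    (hd : DifferentiableOn ℂ f {z | 0 < z.re ∧ z.re < 1})
    (hbound : ∀ z : ℂ, 0 ≤ z.re → z.re ≤ 1 → ‖f z‖ ≤ Real.exp (C * (1 + z.im ^ 2)))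
    (hzero : ∀ z : ℂ, z.re = 0 → f z = 0) {z : ℂ} (h0 : 0 ≤ z.re) (h1 : z.re ≤ 1) : f z = 0 := by
  -- In the strip `|e^{-z⁴}| ≤ e^{6y² - y⁴}` with `y = Im z`, which beats the quadratic exponent and
  -- makes `g` bounded. The constant `C + (C+6)²/4` below bounds `C (1 + y²) + 6y² - y⁴` from above.
  set g : ℂ → ℂ := fun z => f z * Complex.exp (-z ^ 4) with hg
  have hclosed : Complex.HadamardThreeLines.verticalClosedStrip 0 1 =
      {z : ℂ | 0 ≤ z.re ∧ z.re ≤ 1} := rfl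
  have hopen : Complex.HadamardThreeLines.verticalStrip 0 1 =
      {z : ℂ | 0 < z.re ∧ z.re < 1} := rfl
  have hcl : closure {z : ℂ | 0 < z.re ∧ z.re < 1} ⊆ {z : ℂ | 0 ≤ z.re ∧ z.re ≤ 1} := by
    refine closure_minimal (fun z hz => ⟨hz.1.le, hz.2.le⟩) ?_
    exact (isClosed_le continuous_const Complex.continuous_re).inter
      (isClosed_le Complex.continuous_re continuous_const)
  have hgc : ContinuousOn g {z | 0 ≤ z.re ∧ z.re ≤ 1} := hc.mul (by fun_prop)
  have hgd : DiffContOnCl ℂ g (Complex.HadamardThreeLines.verticalStrip 0 1) := by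
    rw [hopen]
    exact ⟨hd.mul (by fun_prop), hgc.mono hcl⟩
  have hgb : ∀ z : ℂ, 0 ≤ z.re → z.re ≤ 1 → ‖g z‖ ≤ Real.exp (C + (C + 6) ^ 2 / 4) := by
    intro z h0 h1
    have e : (-z ^ 4).re = -(z.re ^ 4 - 6 * z.re ^ 2 * z.im ^ 2 + z.im ^ 4) := by
      have : z ^ 4 = ((z.re : ℂ) + z.im * Complex.I) ^ 4 := by rw [Complex.re_add_im]
      rw [this]
      simp [pow_succ]
      ring
    rw [hg]
    simp only [norm_mul, Complex.norm_exp, e]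
    refine (mul_le_mul_of_nonneg_right (hbound z h0 h1) (Real.exp_pos _).le).trans ?_
    rw [← Real.exp_add, Real.exp_le_exp]
    have h2 : z.re ^ 2 ≤ 1 := by nlinarith
    have h3 : z.re ^ 2 * z.im ^ 2 ≤ z.im ^ 2 := mul_le_of_le_one_left (sq_nonneg _) h2
    have h4 : 0 ≤ z.re ^ 4 := by positivity
    nlinarith [sq_nonneg (z.im ^ 2 - (C + 6) / 2)]
  -- The three lines bound contains the factor `0 ^ (1 - Re z)`, which vanishes for `Re z < 1`. The
  -- right edge is recovered by continuity.
  have key : ∀ z : ℂ, 0 ≤ z.re → z.re < 1 → f z = 0 := by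
    intro z h0 h1
    have := Complex.HadamardThreeLines.norm_le_interp_of_mem_verticalClosedStrip' (f := g) (z := z)
      (a := 0) (b := Real.exp (C + (C + 6) ^ 2 / 4)) zero_lt_one
      (by rw [hclosed]; exact ⟨h0, h1.le⟩) hgd
      ⟨Real.exp (C + (C + 6) ^ 2 / 4), by
        rintro _ ⟨z, hz, rfl⟩
        exact hgb z hz.1 hz.2⟩
      (fun z hz => by simp [hg, hzero z hz])
      (fun z hz => by
        have : z.re = 1 := hz
        exact hgb z (by linarith) (by linarith))
    rw [Real.zero_rpow (by simp; linarith), zero_mul, norm_le_zero_iff] at this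
    simpa [hg, Complex.exp_ne_zero] using this
  rcases h1.lt_or_eq with h1 | h1
  · exact key z h0 h1
  have hmem : z ∈ closure {z : ℂ | 0 < z.re ∧ z.re < 1} := by
    have ht : Tendsto (fun n : ℕ => z - ((1 / ((n : ℝ) + 2) : ℝ) : ℂ)) atTop (𝓝 z) := by
      have h5 : Tendsto (fun n : ℕ => 1 / ((n : ℝ) + 2)) atTop (𝓝 0) := by
        have := (tendsto_one_div_add_atTop_nhds_zero_nat (𝕜 := ℝ)).comp (tendsto_add_atTop_nat 1)
        refine this.congr fun n => ?_
        simp only [Function.comp]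
        push_cast
        ring_nf
      have := ((Complex.continuous_ofReal.tendsto 0).comp h5).const_sub z
      simpa using this
    refine mem_closure_of_tendsto ht (Eventually.of_forall fun n => ?_)
    have h6 : (0 : ℝ) < 1 / ((n : ℝ) + 2) := by positivity
    have h7 : 1 / ((n : ℝ) + 2) < 1 := by
      rw [div_lt_one (by positivity)]
      have : (0 : ℝ) ≤ n := n.cast_nonneg
      linarith
    constructor <;> simp only [Complex.sub_re, Complex.ofReal_re, h1] <;> linarith
  have heq : EqOn f (fun _ => 0) {z : ℂ | 0 < z.re ∧ z.re < 1} := fun z hz => key z hz.1.le hz.2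
  exact heq.of_subset_closure (hc.mono hcl) continuousOn_const subset_closure le_rfl hmem

section Moment

variable {Ω : Type*} [MeasurableSpace Ω] {P : Measure Ω} {Y : Ω → ℝ}

lemma norm_exp_mul_ofReal_le {z : ℂ} (h0 : 0 ≤ z.re) (h1 : z.re ≤ 1) (y : ℝ) :
    ‖Complex.exp (z * y)‖ ≤ 1 + Real.exp y := by
  rw [Complex.norm_exp]
  have e : (z * y).re = z.re * y := by simp
  rw [e]
  rcases le_total 0 y with hy | hy
  · have : Real.exp (z.re * y) ≤ Real.exp y := by gcongr; nlinarith
    linarith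
  · have : Real.exp (z.re * y) ≤ 1 := Real.exp_le_one_iff.2 (by nlinarith)
    have := Real.exp_pos y
    linarith

lemma integrable_exp_mul [IsProbabilityMeasure P] (hY : Measurable Y)
    (hexp : Integrable (fun ω => Real.exp (Y ω)) P) {z : ℂ} (h0 : 0 ≤ z.re) (h1 : z.re ≤ 1) :
    Integrable (fun ω => Complex.exp (z * Y ω)) P := by
  refine ((integrable_const 1).add hexp).mono' ?_ ?_
  · exact Measurable.aestronglyMeasurable (by fun_prop)
  · filter_upwards with ω using norm_exp_mul_ofReal_le h0 h1 (Y ω)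

lemma continuousOn_integral_exp_mul [IsProbabilityMeasure P] (hY : Measurable Y)
    (hexp : Integrable (fun ω => Real.exp (Y ω)) P) :
    ContinuousOn (fun z : ℂ => ∫ ω, Complex.exp (z * Y ω) ∂P) {z | 0 ≤ z.re ∧ z.re ≤ 1} := by
  intro z₀ _
  refine continuousWithinAt_of_dominated (bound := fun ω => 1 + Real.exp (Y ω))
    (Eventually.of_forall fun z => Measurable.aestronglyMeasurable (by fun_prop)) ?_
    ((integrable_const 1).add hexp) ?_
  · filter_upwards [self_mem_nhdsWithin] with z hz
    filter_upwards with ω using norm_exp_mul_ofReal_le hz.1 hz.2 (Y ω)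
  · filter_upwards with ω
    exact Continuous.continuousWithinAt (by fun_prop)

lemma differentiableOn_integral_exp_mul [IsProbabilityMeasure P]
    (hexp : Integrable (fun ω => Real.exp (Y ω)) P) :
    DifferentiableOn ℂ (fun z : ℂ => ∫ ω, Complex.exp (z * Y ω) ∂P)
      {z | 0 < z.re ∧ z.re < 1} := by
  refine DifferentiableOn.mono (differentiableOn_complexMGF (X := Y) (μ := P)) fun z hz => ?_
  have h : Icc (0 : ℝ) 1 ⊆ integrableExpSet Y P := by
    refine (convex_integrableExpSet (X := Y) (μ := P)).ordConnected.out ?_ ?_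
    · simp [integrableExpSet]
    · simpa [integrableExpSet] using hexp
  have := interior_mono h
  rw [interior_Icc] at this
  exact this ⟨hz.1, hz.2⟩

end Moment

/-- A single time would leave the ambiguity `2πiℤ`. At `t = 1/‖c‖` the exponent has modulus `1`,
which no multiple of `2πi` has. -/
lemma eq_zero_of_exp_mul_eq_one {c : ℂ} (h : ∀ t : ℝ≥0, Complex.exp ((t : ℝ) * c) = 1) :
    c = 0 := by
  by_contra hc
  have hc' : 0 < ‖c‖ := norm_pos_iff.2 hc
  obtain ⟨n, hn⟩ := Complex.exp_eq_one_iff.1 (h (1 / ‖c‖).toNNReal)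
  have h1 : ‖(((1 / ‖c‖ : ℝ)) : ℂ) * c‖ = 1 := by
    rw [norm_mul, Complex.norm_real, Real.norm_of_nonneg (by positivity)]
    field_simp
  rw [Real.coe_toNNReal _ (by positivity)] at hn
  rw [hn] at h1
  have h2 : ‖(n : ℂ) * (2 * Real.pi * Complex.I)‖ = |(n : ℝ)| * (2 * Real.pi) := by
    simp [abs_of_pos Real.pi_pos]
  rw [h2] at h1
  rcases eq_or_ne n 0 with rfl | hn0
  · simp at h1
  · have : (1 : ℝ) ≤ |(n : ℝ)| := by exact_mod_cast Int.one_le_abs hn0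
    nlinarith [Real.pi_gt_three]

lemma norm_cpow_ofReal_le {α : ℝ} (h0 : 0 < α) (h2 : α < 2) (w : ℂ) :
    ‖w ^ (α : ℂ)‖ ≤ 1 + ‖w‖ ^ 2 := by
  rw [Complex.norm_cpow_real]
  rcases le_total ‖w‖ 1 with h | h
  · have := Real.rpow_le_one (norm_nonneg w) h h0.le
    have := sq_nonneg ‖w‖
    linarith
  · have := Real.rpow_le_rpow_of_exponent_le h h2.le
    rw [Real.rpow_two] at this
    linarith

namespace TSParams

variable {θ : TSParams}

lemma continuousOn_affineCumulant (hθ : θ.Admissible) (A B : ℂ) :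
    ContinuousOn (θ.affineCumulant A B) {z | 0 ≤ z.re ∧ z.re ≤ 1} := by
  intro z hz
  refine ContinuousAt.continuousWithinAt ?_
  have hα : 0 < (θ.α : ℂ).re := by simpa using hθ.α_pos
  have h1 : ContinuousAt (fun z : ℂ => ((θ.κPos : ℂ) - z) ^ (θ.α : ℂ)) z :=
    ContinuousAt.comp (f := fun z : ℂ => (θ.κPos : ℂ) - z) (g := fun w : ℂ => w ^ (θ.α : ℂ))
      (Complex.continuousAt_cpow_const_of_re_pos
        (Or.inl (by have := hθ.one_le_κPos; have := hz.2; simp; linarith)) hα) (by fun_prop)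
  have h2 : ContinuousAt (fun z : ℂ => ((θ.κNeg : ℂ) + z) ^ (θ.α : ℂ)) z :=
    ContinuousAt.comp (f := fun z : ℂ => (θ.κNeg : ℂ) + z) (g := fun w : ℂ => w ^ (θ.α : ℂ))
      (Complex.continuousAt_cpow_const_of_re_pos
        (Or.inl (by have := hθ.κNeg_nonneg; have := hz.1; simp; linarith)) hα) (by fun_prop)
  unfold affineCumulant
  fun_prop

lemma differentiableOn_affineCumulant (hθ : θ.Admissible) (A B : ℂ) :
    DifferentiableOn ℂ (θ.affineCumulant A B) {z | 0 < z.re ∧ z.re < 1} := by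
  intro z hz
  refine DifferentiableAt.differentiableWithinAt ?_
  have h1 : DifferentiableAt ℂ (fun z : ℂ => ((θ.κPos : ℂ) - z) ^ (θ.α : ℂ)) z :=
    DifferentiableAt.cpow_const (by fun_prop)
      (Or.inl (by have := hθ.one_le_κPos; have := hz.2; simp; linarith))
  have h2 : DifferentiableAt ℂ (fun z : ℂ => ((θ.κNeg : ℂ) + z) ^ (θ.α : ℂ)) z :=
    DifferentiableAt.cpow_const (by fun_prop)
      (Or.inl (by have := hθ.κNeg_nonneg; have := hz.1; simp; linarith))
  unfold affineCumulant
  fun_prop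

/-- Quadratic growth, available because `α < 2`, is exactly what `eq_zero_of_strip` tolerates. -/
lemma exists_norm_affineCumulant_le (hθ : θ.Admissible) (A B : ℂ) : ∃ C : ℝ, 0 ≤ C ∧
    ∀ z : ℂ, 0 ≤ z.re → z.re ≤ 1 → ‖θ.affineCumulant A B z‖ ≤ C * (1 + z.im ^ 2) := by
  have hκ : 0 ≤ θ.κPos := zero_le_one.trans hθ.one_le_κPos
  refine ⟨‖A‖ + ‖B‖ + θ.σ ^ 2 + |θ.aPos| * (3 + 2 * θ.κPos ^ 2) +
    |θ.aNeg| * (3 + 2 * θ.κNeg ^ 2), by positivity, fun z h0 h1 => ?_⟩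
  have hz2 : ‖z‖ ^ 2 ≤ 1 + z.im ^ 2 := by
    rw [← Complex.normSq_eq_norm_sq, Complex.normSq_apply]; nlinarith
  have hz1 : ‖z‖ ≤ 1 + z.im ^ 2 := by
    rcases le_total ‖z‖ 1 with h | h <;> nlinarith [sq_nonneg z.im]
  have hw : ∀ (k : ℝ) (w : ℂ), ‖w‖ ≤ |k| + ‖z‖ →
      ‖w ^ (θ.α : ℂ)‖ ≤ (3 + 2 * k ^ 2) * (1 + z.im ^ 2) := fun k w h => by
    have h3 := norm_cpow_ofReal_le hθ.α_pos hθ.α_lt_two w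
    have h4 : ‖w‖ ^ 2 ≤ 2 * k ^ 2 + 2 * ‖z‖ ^ 2 := by
      rw [← sq_abs k]
      nlinarith [sq_nonneg (|k| - ‖z‖), norm_nonneg w, norm_nonneg z]
    have := mul_nonneg (sq_nonneg k) (sq_nonneg z.im)
    nlinarith [sq_nonneg z.im]
  have hP := hw θ.κPos ((θ.κPos : ℂ) - z) (by simpa using norm_sub_le (θ.κPos : ℂ) z)
  have hN := hw θ.κNeg ((θ.κNeg : ℂ) + z) (by simpa using norm_add_le (θ.κNeg : ℂ) z)
  have t1 : ‖A * z‖ ≤ ‖A‖ * (1 + z.im ^ 2) := by rw [norm_mul]; gcongr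
  have t2 : ‖B‖ ≤ ‖B‖ * (1 + z.im ^ 2) :=
    le_mul_of_one_le_right (norm_nonneg _) (by nlinarith [sq_nonneg z.im])
  have t3 : ‖(θ.σ : ℂ) ^ 2 * z ^ 2 / 2‖ ≤ θ.σ ^ 2 * (1 + z.im ^ 2) := by
    rw [norm_div, norm_mul, norm_pow, norm_pow, Complex.norm_real, Real.norm_eq_abs, sq_abs]
    have : ‖(2 : ℂ)‖ = 2 := by simp
    rw [this]
    nlinarith [mul_nonneg (sq_nonneg θ.σ) (sq_nonneg ‖z‖), mul_le_mul_of_nonneg_left hz2 (sq_nonneg θ.σ)]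
  have t4 : ‖(θ.aPos : ℂ) * ((θ.κPos : ℂ) - z) ^ (θ.α : ℂ)‖ ≤
      |θ.aPos| * (3 + 2 * θ.κPos ^ 2) * (1 + z.im ^ 2) := by
    rw [norm_mul, Complex.norm_real, Real.norm_eq_abs, mul_assoc]; gcongr
  have t5 : ‖(θ.aNeg : ℂ) * ((θ.κNeg : ℂ) + z) ^ (θ.α : ℂ)‖ ≤
      |θ.aNeg| * (3 + 2 * θ.κNeg ^ 2) * (1 + z.im ^ 2) := by
    rw [norm_mul, Complex.norm_real, Real.norm_eq_abs, mul_assoc]; gcongr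
  unfold affineCumulant
  calc _ ≤ _ := norm_add₃_le.trans (add_le_add_left (add_le_add_left norm_add₃_le _) _)
    _ ≤ _ := by linarith

/-- The jump and drift part of the cumulant function on the line `Re z = 1 / 2`. -/
noncomputable def jumpCumulant (θ : TSParams) (u : ℝ) : ℂ :=
  θ.γ * (Complex.I * u + 1 / 2) + θ.δ + θ.upsilonTilde u

/-- The cumulant function on the line `Re z = 1 / 2`. -/
noncomputable def cumulant (θ : TSParams) (u : ℝ) : ℂ :=
  θ.jumpCumulant u - (θ.σ : ℂ) ^ 2 / 2 * ((u : ℂ) ^ 2 + 1 / 4)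

/-- The moment generating function of a tempered stable martingale on the strip `0 ≤ Re z ≤ 1`. -/
theorem integral_exp_mul_eq {Ω : Type*} [MeasurableSpace Ω] {P : Measure Ω}
    [IsProbabilityMeasure P] (hθ : θ.Admissible) {X : ℝ≥0 → Ω → ℝ} {b : ℝ}
    (hX : ∀ t, Measurable (X t)) (htriplet : HasLevyTriplet X P b θ.σ θ.levyMeasure)
    (hmart : ∀ t : ℝ≥0, ∫ ω, Real.exp (X t ω) ∂P = 1) (t : ℝ≥0) {z : ℂ}
    (hz0 : 0 ≤ z.re) (hz1 : z.re ≤ 1) : ∫ ω, Complex.exp (z * X t ω) ∂P =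
      Complex.exp ((t : ℝ) * θ.affineCumulant (θ.γ - (θ.σ : ℂ) ^ 2 / 2) θ.δ z) := by
  have hexp : ∀ t, Integrable (fun ω => Real.exp (X t ω)) P := fun t =>
    Integrable.of_integral_ne_zero (by rw [hmart t]; exact one_ne_zero)
  obtain ⟨A, B, hAB⟩ := exists_levyExponent_eq hθ b
  obtain ⟨C, hC, hbound⟩ := exists_norm_affineCumulant_le hθ A B
  have key : ∀ (t : ℝ≥0) (z : ℂ), 0 ≤ z.re → z.re ≤ 1 → ∫ ω, Complex.exp (z * X t ω) ∂P =
      Complex.exp ((t : ℝ) * θ.affineCumulant A B z) := by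
    intro t z h0 h1
    rw [← sub_eq_zero]
    -- The expectation is at most `2` in modulus and the exponential at most `e^{tC(1+y²)}`. Their
    -- sum is below `e^{(2+tC)(1+y²)}` because `3 ≤ e²`.
    refine eq_zero_of_strip (f := fun z => ∫ ω, Complex.exp (z * X t ω) ∂P -
      Complex.exp ((t : ℝ) * θ.affineCumulant A B z)) (C := 2 + t * C)
      ((continuousOn_integral_exp_mul (hX t) (hexp t)).sub
        (continuousOn_const.mul (continuousOn_affineCumulant hθ A B)).cexp)
      ((differentiableOn_integral_exp_mul (hexp t)).sub
        ((differentiableOn_affineCumulant hθ A B).const_mul _).cexp) ?_ ?_ h0 h1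
    · intro z h0 h1
      have e1 : ‖∫ ω, Complex.exp (z * X t ω) ∂P‖ ≤ 2 := by
        refine (norm_integral_le_integral_norm _).trans ?_
        calc _ ≤ ∫ ω, (1 + Real.exp (X t ω)) ∂P :=
              integral_mono (integrable_exp_mul (hX t) (hexp t) h0 h1).norm
                ((integrable_const 1).add (hexp t)) fun ω => norm_exp_mul_ofReal_le h0 h1 _
          _ = 2 := by
              rw [integral_add (integrable_const 1) (hexp t), hmart t]
              simp
              norm_num
      have e2 : ‖Complex.exp ((t : ℝ) * θ.affineCumulant A B z)‖ ≤
          Real.exp (t * C * (1 + z.im ^ 2)) := by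
        refine (Complex.norm_exp_le_exp_norm _).trans ?_
        rw [norm_mul, Complex.norm_real, Real.norm_of_nonneg t.coe_nonneg, mul_assoc]
        have := hbound z h0 h1
        gcongr
      refine (norm_sub_le _ _).trans ((add_le_add e1 e2).trans ?_)
      have e3 : (1 : ℝ) ≤ Real.exp (t * C * (1 + z.im ^ 2)) := Real.one_le_exp (by positivity)
      have e4 : (3 : ℝ) ≤ Real.exp (2 * (1 + z.im ^ 2)) := by
        have := Real.add_one_le_exp (2 * (1 + z.im ^ 2))
        nlinarith [sq_nonneg z.im]
      rw [add_mul, Real.exp_add]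
      nlinarith
    · intro z hz
      have hz' : z = Complex.I * (z.im : ℝ) := by
        apply Complex.ext <;> simp [hz]
      rw [hz', ← hAB z.im, ← htriplet t z.im, sub_self]
  -- Total mass one at `z = 0` gives `B = δ`, and the martingale condition at `z = 1` then gives `A
  -- = γ - σ²/2`. The latter involves `(κ₊ - 1)^α`, a real power because `κ₊ ≥ 1`.
  have h0 : θ.affineCumulant A B 0 = 0 := eq_zero_of_exp_mul_eq_one fun t => by
    rw [← key t 0 (by simp) (by simp)]
    simp
  have h1 : θ.affineCumulant A B 1 = 0 := eq_zero_of_exp_mul_eq_one fun t => by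
    rw [← key t 1 (by simp) (by simp)]
    have := hmart t
    rw [← Complex.ofReal_inj, ← integral_complex_ofReal] at this
    simpa using this
  have hκ1 : 0 ≤ θ.κPos - 1 := sub_nonneg.2 hθ.one_le_κPos
  have hκ : 0 ≤ θ.κPos := zero_le_one.trans hθ.one_le_κPos
  have c1 : (θ.κPos : ℂ) ^ (θ.α : ℂ) = ((θ.κPos ^ θ.α : ℝ) : ℂ) :=
    (Complex.ofReal_cpow hκ _).symm
  have c2 : (θ.κNeg : ℂ) ^ (θ.α : ℂ) = ((θ.κNeg ^ θ.α : ℝ) : ℂ) :=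
    (Complex.ofReal_cpow hθ.κNeg_nonneg _).symm
  have c3 : ((θ.κPos : ℂ) - 1) ^ (θ.α : ℂ) = (((θ.κPos - 1) ^ θ.α : ℝ) : ℂ) := by
    rw [Complex.ofReal_cpow hκ1]; push_cast; rfl
  have c4 : ((θ.κNeg : ℂ) + 1) ^ (θ.α : ℂ) = (((θ.κNeg + 1) ^ θ.α : ℝ) : ℂ) := by
    rw [Complex.ofReal_cpow (by linarith [hθ.κNeg_nonneg])]; push_cast; rfl
  have hB : B = θ.δ := by
    simp only [affineCumulant, mul_zero, sub_zero, add_zero, zero_add, c1, c2, ne_eq,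
      OfNat.ofNat_ne_zero, not_false_eq_true, zero_pow, zero_div] at h0
    rw [δ]
    push_cast
    linear_combination h0
  have hA : A = θ.γ - (θ.σ : ℂ) ^ 2 / 2 := by
    simp only [affineCumulant, mul_one, one_pow, c3, c4] at h1
    rw [γ, ζPos, ζNeg]
    rw [hB, δ] at h1
    push_cast at h1 ⊢
    linear_combination h1
  rw [key t z hz0 hz1, hA, hB]

/-- The moment generating function of a tempered stable martingale on the line `Re z = 1 / 2`. -/
theorem integral_exp_half_add_eq {Ω : Type*} [MeasurableSpace Ω] {P : Measure Ω}
    [IsProbabilityMeasure P] (hθ : θ.Admissible) {X : ℝ≥0 → Ω → ℝ} {b : ℝ}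
    (hX : ∀ t, Measurable (X t)) (htriplet : HasLevyTriplet X P b θ.σ θ.levyMeasure)
    (hmart : ∀ t : ℝ≥0, ∫ ω, Real.exp (X t ω) ∂P = 1) (t : ℝ≥0) (u : ℝ) :
    ∫ ω, Complex.exp ((Complex.I * u + 1 / 2) * X t ω) ∂P =
      Complex.exp ((t : ℝ) * θ.cumulant u) := by
  rw [integral_exp_mul_eq hθ hX htriplet hmart t (by simp) (by simp; norm_num)]
  congr 2
  rw [affineCumulant, cumulant, jumpCumulant, upsilonTilde]
  linear_combination (-(θ.σ : ℂ) ^ 2 * (u : ℂ) ^ 2 * (-1/2)) * Complex.I_sq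

end TSParams

/-! ### The Fourier transform of the Cauchy density -/

lemma integrable_inv_sq_add_quarter : Integrable fun u : ℝ => (u ^ 2 + 1 / 4)⁻¹ := by
  refine (integrable_inv_one_add_sq.const_mul 4).mono' ?_ ?_
  · exact Measurable.aestronglyMeasurable (by fun_prop)
  · filter_upwards with u
    rw [Real.norm_of_nonneg (by positivity), ← div_eq_mul_inv, ← one_div,
      div_le_div_iff₀ (by positivity) (by positivity)]
    nlinarith [sq_nonneg u]

lemma ofReal_sq_add_quarter (u : ℝ) : (u : ℂ) ^ 2 + 1 / 4 = ((u ^ 2 + 1 / 4 : ℝ) : ℂ) := by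
  push_cast; rfl

lemma half_line_mul_conj (u : ℝ) :
    (Complex.I * u + 1 / 2) * (1 / 2 - Complex.I * u) = (u : ℂ) ^ 2 + 1 / 4 := by
  linear_combination (-(u : ℂ) ^ 2) * Complex.I_sq

lemma sq_add_quarter_ne_zero (u : ℝ) : (u : ℂ) ^ 2 + 1 / 4 ≠ 0 := by
  rw [ofReal_sq_add_quarter, Complex.ofReal_ne_zero]
  positivity

lemma half_line_ne_zero (u : ℝ) : Complex.I * u + 1 / 2 ≠ 0 := fun h =>
  sq_add_quarter_ne_zero u (by rw [← half_line_mul_conj, h, zero_mul])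

lemma norm_sq_add_quarter (u : ℝ) : ‖(u : ℂ) ^ 2 + 1 / 4‖ = u ^ 2 + 1 / 4 := by
  rw [ofReal_sq_add_quarter, Complex.norm_real, Real.norm_of_nonneg (by positivity)]

lemma normSq_half_line (u : ℝ) : ‖Complex.I * u + 1 / 2‖ ^ 2 = u ^ 2 + 1 / 4 := by
  rw [← Complex.normSq_eq_norm_sq, Complex.normSq_apply]
  simp
  ring

lemma half_le_norm_half_line (u : ℝ) : 1 / 2 ≤ ‖Complex.I * u + 1 / 2‖ := by
  have := Complex.abs_re_le_norm (Complex.I * u + 1 / 2)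
  have h : (Complex.I * u + 1 / 2).re = 1 / 2 := by simp
  rw [h] at this
  exact (le_abs_self _).trans this

lemma norm_conj_half_line (u : ℝ) : ‖1 / 2 - Complex.I * u‖ = ‖Complex.I * u + 1 / 2‖ := by
  rw [Complex.norm_def, Complex.norm_def]
  congr 1
  simp [Complex.normSq_apply]

lemma integral_cexp_mul_Ioi_zero {a : ℂ} (ha : a.re < 0) :
    ∫ x : ℝ in Ioi 0, Complex.exp (a * x) = -1 / a := by
  simpa using integral_exp_mul_complex_Ioi ha 0

/-- The Fourier transform of `e^{-|x|/2}` is an elementary sum of two half-line integrals and is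
itself integrable, so Fourier inversion gives the converse formula. -/
lemma integral_cexp_mul_div_sq_add_quarter (y : ℝ) :
    ∫ u : ℝ, Complex.exp (Complex.I * u * y) / ((u : ℂ) ^ 2 + 1 / 4) =
      ((2 * Real.pi * Real.exp (-(|y| / 2)) : ℝ) : ℂ) := by
  set f : ℝ → ℂ := fun x => ((Real.exp (-(|x| / 2)) : ℝ) : ℂ) with hf
  have hπ := Real.pi_pos
  have hint : ∀ a : ℂ, a.re < 0 → IntegrableOn (fun x : ℝ => Complex.exp (a * x)) (Ioi 0) :=
    fun a ha => integrableOn_exp_mul_complex_Ioi ha 0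
  have hfc : Continuous f := by rw [hf]; fun_prop
  have hF : ∀ ξ : ℝ, FourierTransform.fourier f ξ =
      ((((2 * Real.pi * ξ) ^ 2 + 1 / 4)⁻¹ : ℝ) : ℂ) := by
    intro ξ
    rw [Real.fourier_real_eq_integral_exp_smul]
    set a : ℂ := -(1 / 2) - 2 * Real.pi * ξ * Complex.I with ha
    set b : ℂ := -(1 / 2) + 2 * Real.pi * ξ * Complex.I with hb
    have har : a.re < 0 := by simp [ha]
    have hbr : b.re < 0 := by simp [hb]
    rw [integral_eq_integral_Ioi_add_neg (hint a har) (hint b hbr),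
      integral_cexp_mul_Ioi_zero har, integral_cexp_mul_Ioi_zero hbr]
    · have ha0 : a ≠ 0 := fun h => by simp [h] at har
      have hb0 : b ≠ 0 := fun h => by simp [h] at hbr
      have hab : a * b = (2 * Real.pi * ξ) ^ 2 + 1 / 4 := by
        rw [ha, hb]
        linear_combination (-(2 * Real.pi * ξ : ℂ) ^ 2) * Complex.I_sq
      have hs : a + b = -1 := by rw [ha, hb]; ring
      push_cast
      rw [← hab]
      field_simp
      linear_combination -hs
    · intro x hx
      simp only [hf, abs_of_pos hx, smul_eq_mul, Complex.ofReal_exp]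
      rw [← Complex.exp_add]
      congr 1
      rw [ha]
      push_cast
      ring
    · intro x hx
      simp only [hf, abs_neg, abs_of_pos hx, smul_eq_mul, Complex.ofReal_exp]
      rw [← Complex.exp_add]
      congr 1
      rw [hb]
      push_cast
      ring
  have hfi : Integrable f := by
    have h1 : IntegrableOn f (Ioi 0) :=
      (hint (-(1 / 2)) (by simp)).congr_fun (fun x hx => by
        have hx' : (0 : ℝ) < x := hx
        simp only [hf, abs_of_pos hx', Complex.ofReal_exp]
        congr 1
        push_cast
        ring) measurableSet_Ioi
    have h2 : IntegrableOn f (Iic 0) :=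
      (integrableOn_exp_mul_complex_Iic (a := 1 / 2) (by simp) 0).congr_fun (fun x hx => by
        have hx' : x ≤ (0 : ℝ) := hx
        simp only [hf, abs_of_nonpos hx', Complex.ofReal_exp]
        congr 1
        push_cast
        ring) measurableSet_Iic
    rw [← integrableOn_univ, ← Iic_union_Ioi (a := (0 : ℝ))]
    exact h2.union h1
  have hFi : Integrable (FourierTransform.fourier f) := by
    rw [show FourierTransform.fourier f = fun ξ => ((((2 * Real.pi * ξ) ^ 2 + 1 / 4)⁻¹ : ℝ) : ℂ)
      from funext hF]
    exact (integrable_inv_sq_add_quarter.comp_mul_left' (by positivity : 2 * Real.pi ≠ 0)).ofReal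
  have hinv := congrFun (hfc.fourierInv_fourier_eq hfi hFi) y
  rw [Real.fourierInv_eq'] at hinv
  have hsub := Measure.integral_comp_mul_left
    (fun u : ℝ => Complex.exp (Complex.I * u * y) / ((u : ℂ) ^ 2 + 1 / 4)) (2 * Real.pi)
  have h2π : |(2 * Real.pi)⁻¹| = (2 * Real.pi)⁻¹ := abs_of_pos (by positivity)
  rw [h2π] at hsub
  have hL : ∫ x : ℝ, (fun u : ℝ => Complex.exp (Complex.I * u * y) / ((u : ℂ) ^ 2 + 1 / 4))
      (2 * Real.pi * x) = f y := by
    rw [← hinv]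
    congr 1
    ext ξ
    rw [hF, smul_eq_mul, div_eq_mul_inv]
    push_cast
    congr 2
    simp
    ring
  rw [hL, Complex.real_smul] at hsub
  have hf' : f y = ((Real.exp (-(|y| / 2)) : ℝ) : ℂ) := rfl
  rw [hf'] at hsub
  have hπ' : (Real.pi : ℂ) ≠ 0 := Complex.ofReal_ne_zero.2 hπ.ne'
  push_cast at hsub ⊢
  rw [hsub, ← mul_assoc, mul_inv_cancel₀ (by simp [hπ']), one_mul]

lemma integral_inv_sq_add_quarter : ∫ u : ℝ, (u ^ 2 + 1 / 4)⁻¹ = 2 * Real.pi := by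
  have := integral_cexp_mul_div_sq_add_quarter 0
  rw [← Complex.ofReal_inj, ← integral_complex_ofReal]
  simpa using this

/-! ### The Fourier representation of call prices -/

section Call

variable {Ω : Type*} [MeasurableSpace Ω] {P : Measure Ω} {Y : Ω → ℝ}

/-- This factorisation is what makes the line `Re z = 1/2` appear: the last factor is the Fourier
transform of the kernel `1/(u² + 1/4)`. -/
lemma min_exp_eq (y k : ℝ) :
    min (Real.exp y) (Real.exp k) = Real.exp (k / 2) * Real.exp (y / 2) *
      Real.exp (-(|y - k| / 2)) := by
  rw [← Real.exp_add, ← Real.exp_add]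
  rcases le_total y k with h | h
  · rw [min_eq_left (Real.exp_le_exp.2 h), abs_of_nonpos (by linarith)]
    congr 1; ring
  · rw [min_eq_right (Real.exp_le_exp.2 h), abs_of_nonneg (by linarith)]
    congr 1; ring

/-- The payoff is `e^Y - min(e^Y, e^k)`. The minimum is a Fourier integral in `Y - k`, and Fubini
exchanges it with the expectation since `e^{Y/2}` is integrable. `G` stands for the moment
generating function on the half line. -/
lemma integral_call_eq_fourier [IsProbabilityMeasure P] (hY : Measurable Y)
    (hexp : Integrable (fun ω => Real.exp (Y ω)) P) (hone : ∫ ω, Real.exp (Y ω) ∂P = 1)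
    {G : ℝ → ℂ} (hG : ∀ u : ℝ, ∫ ω, Complex.exp ((Complex.I * u + 1 / 2) * Y ω) ∂P = G u) (k : ℝ) :
    ((∫ ω, max (Real.exp (Y ω) - Real.exp k) 0 ∂P : ℝ) : ℂ) = 1 - 1 / (2 * Real.pi) *
      ∫ u : ℝ, Complex.exp ((1 / 2 - Complex.I * u) * k) * (G u / ((u : ℂ) ^ 2 + 1 / 4)) := by
  have hmin : Integrable (fun ω => min (Real.exp (Y ω)) (Real.exp k)) P := by
    refine hexp.mono (Measurable.aestronglyMeasurable (by fun_prop)) ?_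
    filter_upwards with ω
    rw [Real.norm_of_nonneg (by positivity), Real.norm_of_nonneg (by positivity)]
    exact min_le_left _ _
  have hmax : ∀ ω, max (Real.exp (Y ω) - Real.exp k) 0 =
      Real.exp (Y ω) - min (Real.exp (Y ω)) (Real.exp k) := fun ω => by
    rcases le_total (Real.exp (Y ω)) (Real.exp k) with h | h
    · rw [min_eq_left h, max_eq_right (by linarith), sub_self]
    · rw [min_eq_right h, max_eq_left (by linarith)]
  have h1 : ∫ ω, max (Real.exp (Y ω) - Real.exp k) 0 ∂P =
      1 - ∫ ω, min (Real.exp (Y ω)) (Real.exp k) ∂P := by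
    simp_rw [hmax]
    rw [integral_sub hexp hmin, hone]
  have hhalf : Integrable (fun ω => Real.exp (Y ω / 2)) P := by
    have h0 : (1 / 2 : ℂ).re = 1 / 2 := by simp
    refine (integrable_exp_mul hY hexp (z := 1 / 2) (by rw [h0]; norm_num)
      (by rw [h0]; norm_num)).norm.congr ?_
    filter_upwards with ω
    rw [Complex.norm_exp]
    congr 1
    simp
    ring
  have hprod : Integrable (Function.uncurry fun (ω : Ω) (u : ℝ) =>
      Complex.exp ((1 / 2 - Complex.I * u) * k) *
        (Complex.exp ((Complex.I * u + 1 / 2) * Y ω) / ((u : ℂ) ^ 2 + 1 / 4)))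
      (P.prod volume) := by
    refine ((hhalf.mul_prod integrable_inv_sq_add_quarter).const_mul (Real.exp (k / 2))).mono'
      ?_ ?_
    · refine Measurable.aestronglyMeasurable ?_
      unfold Function.uncurry
      fun_prop
    · filter_upwards with ⟨ω, u⟩
      simp only [Function.uncurry]
      rw [norm_mul, norm_div, norm_sq_add_quarter, Complex.norm_exp, Complex.norm_exp,
        ← div_eq_mul_inv]
      have e1 : ((1 / 2 - Complex.I * u) * (k : ℂ)).re = k / 2 := by simp; ring
      have e2 : ((Complex.I * u + 1 / 2) * (Y ω : ℂ)).re = Y ω / 2 := by simp; ring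
      rw [e1, e2]
  have hswap := integral_integral_swap hprod
  have hinner : ∀ ω, ∫ u : ℝ, Complex.exp ((1 / 2 - Complex.I * u) * k) *
        (Complex.exp ((Complex.I * u + 1 / 2) * Y ω) / ((u : ℂ) ^ 2 + 1 / 4)) =
        ((2 * Real.pi * min (Real.exp (Y ω)) (Real.exp k) : ℝ) : ℂ) := fun ω => by
    have e : ∀ u : ℝ, Complex.exp ((1 / 2 - Complex.I * u) * k) *
        (Complex.exp ((Complex.I * u + 1 / 2) * Y ω) / ((u : ℂ) ^ 2 + 1 / 4)) =
        ((Real.exp (k / 2) * Real.exp (Y ω / 2) : ℝ) : ℂ) *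
        (Complex.exp (Complex.I * u * ((Y ω - k : ℝ) : ℂ)) / ((u : ℂ) ^ 2 + 1 / 4)) := fun u => by
      rw [← mul_div_assoc, ← mul_div_assoc]
      congr 1
      push_cast
      rw [← Complex.exp_add, ← Complex.exp_add, ← Complex.exp_add]
      congr 1
      ring
    simp_rw [e]
    rw [integral_const_mul, integral_cexp_mul_div_sq_add_quarter, min_exp_eq]
    push_cast
    ring
  simp_rw [hinner] at hswap
  rw [integral_complex_ofReal, integral_const_mul] at hswap
  have hR : ∀ u : ℝ, ∫ ω, Complex.exp ((1 / 2 - Complex.I * u) * k) *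
        (Complex.exp ((Complex.I * u + 1 / 2) * Y ω) / ((u : ℂ) ^ 2 + 1 / 4)) ∂P =
        Complex.exp ((1 / 2 - Complex.I * u) * k) * (G u / ((u : ℂ) ^ 2 + 1 / 4)) := fun u => by
    rw [integral_const_mul, integral_div, hG]
  simp_rw [hR] at hswap
  rw [← hswap, h1]
  have hπ' : (Real.pi : ℂ) ≠ 0 := Complex.ofReal_ne_zero.2 Real.pi_pos.ne'
  push_cast
  field_simp

end Call

/-! ### Differentiation in the strike -/

lemma norm_exp_conj_half_line (u k : ℝ) :
    ‖Complex.exp ((1 / 2 - Complex.I * u) * k)‖ = Real.exp (k / 2) := by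
  rw [Complex.norm_exp]
  congr 1
  simp
  ring

lemma continuous_integral_exp_conj_half_line {W : ℝ → ℂ} (hW : Integrable W) :
    Continuous fun k : ℝ => ∫ u : ℝ, Complex.exp ((1 / 2 - Complex.I * u) * k) * W u := by
  refine continuous_iff_continuousAt.2 fun k₀ => ?_
  refine continuousAt_of_dominated (bound := fun u => Real.exp ((|k₀| + 1) / 2) * ‖W u‖)
    (Eventually.of_forall fun k => (Continuous.aestronglyMeasurable (by fun_prop)).mul hW.1) ?_
    (hW.norm.const_mul _) ?_
  · filter_upwards [Metric.ball_mem_nhds k₀ one_pos] with k hk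
    filter_upwards with u
    rw [norm_mul, norm_exp_conj_half_line]
    have : |k - k₀| < 1 := by simpa [Real.dist_eq] using hk
    have h2 : k ≤ |k₀| + 1 := by linarith [(abs_lt.1 this).2, le_abs_self k₀]
    gcongr
  · filter_upwards with u
    exact Continuous.continuousAt (by fun_prop)

lemma hasDerivAt_integral_exp_conj_half_line {W : ℝ → ℂ} (hW : Integrable W)
    (hW' : Integrable fun u : ℝ => (1 / 2 - Complex.I * u) * W u) (k₀ : ℝ) :
    HasDerivAt (fun k : ℝ => ∫ u : ℝ, Complex.exp ((1 / 2 - Complex.I * u) * k) * W u)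
      (∫ u : ℝ, Complex.exp ((1 / 2 - Complex.I * u) * k₀) * ((1 / 2 - Complex.I * u) * W u))
      k₀ := by
  have hm : ∀ k : ℝ, AEStronglyMeasurable
      (fun u : ℝ => Complex.exp ((1 / 2 - Complex.I * u) * k)) volume := fun k =>
    Continuous.aestronglyMeasurable (by fun_prop)
  refine (hasDerivAt_integral_of_dominated_loc_of_deriv_le
    (F' := fun k u => Complex.exp ((1 / 2 - Complex.I * u) * k) * ((1 / 2 - Complex.I * u) * W u))
    (bound := fun u => Real.exp ((|k₀| + 1) / 2) * ‖(1 / 2 - Complex.I * u) * W u‖)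
    (Metric.ball_mem_nhds k₀ one_pos) (Eventually.of_forall fun k => (hm k).mul hW.1) ?_
    ((hm k₀).mul hW'.1) ?_ (hW'.norm.const_mul _) ?_).2
  · refine hW.bdd_mul (c := Real.exp (k₀ / 2)) (hm k₀) ?_
    filter_upwards with u
    exact (norm_exp_conj_half_line u k₀).le
  · filter_upwards with u k hk
    rw [norm_mul, norm_exp_conj_half_line]
    have : |k - k₀| < 1 := by simpa [Real.dist_eq] using hk
    have h2 : k ≤ |k₀| + 1 := by linarith [(abs_lt.1 this).2, le_abs_self k₀]
    gcongr
  · filter_upwards with u k _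
    have h1 : HasDerivAt (fun k : ℝ => (1 / 2 - Complex.I * u) * (k : ℂ))
        (1 / 2 - Complex.I * u) k := by
      simpa using (Complex.ofRealCLM.hasDerivAt (x := k)).const_mul (1 / 2 - Complex.I * u)
    refine ((h1.cexp).mul_const (W u)).congr_deriv ?_
    ring

lemma integrable_mul_of_norm_le {W f : ℝ → ℂ} (hW : Integrable W) (hf : Measurable f) {c : ℝ}
    (h : ∀ u, ‖f u‖ ≤ c) : Integrable fun u => f u * W u :=
  hW.bdd_mul hf.aestronglyMeasurable (Eventually.of_forall h)

/-- A function given by a Fourier integral with an integrable function `G` is twice continuously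
differentiable, with the expected derivatives at the origin. -/
lemma exists_deriv_of_fourier {C : ℝ → ℝ} {G : ℝ → ℂ} (hG : Integrable G)
    (hC : ∀ k, (C k : ℂ) = 1 - 1 / (2 * Real.pi) *
      ∫ u : ℝ, Complex.exp ((1 / 2 - Complex.I * u) * k) * (G u / ((u : ℂ) ^ 2 + 1 / 4))) :
    ∃ C₁ C₂ : ℝ → ℝ, (∀ k, HasDerivAt C (C₁ k) k) ∧ (∀ k, HasDerivAt C₁ (C₂ k) k) ∧
      Continuous C₂ ∧ C₁ 0 = -(1 / (2 * Real.pi) * ∫ u : ℝ, G u / (Complex.I * u + 1 / 2)).re ∧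
      C₂ 0 - C₁ 0 = (1 / (2 * Real.pi) * ∫ u : ℝ, G u).re := by
  set W₀ : ℝ → ℂ := fun u => G u / ((u : ℂ) ^ 2 + 1 / 4) with hW₀
  -- A strike derivative multiplies by `1/2 - iu`, one of the two conjugate factors of `u² + 1/4`. A
  -- second one leaves a ratio of conjugates, of modulus one, so integrability of `G` suffices.
  have hW₁ : ∀ u : ℝ, (1 / 2 - Complex.I * u) * W₀ u = G u / (Complex.I * u + 1 / 2) := fun u => by
    have h1 := half_line_ne_zero u
    have h2 := sq_add_quarter_ne_zero u
    rw [hW₀]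
    simp only
    rw [← mul_div_assoc, div_eq_div_iff h2 h1, ← half_line_mul_conj]
    ring
  have hz : ∀ u : ℝ, ‖(Complex.I * u + 1 / 2)⁻¹‖ ≤ 2 := fun u => by
    rw [norm_inv, inv_le_comm₀ (by linarith [half_le_norm_half_line u]) two_pos]
    linarith [half_le_norm_half_line u]
  have i0 : Integrable W₀ := by
    refine (integrable_mul_of_norm_le hG (f := fun u : ℝ => ((u : ℂ) ^ 2 + 1 / 4)⁻¹) (c := 4)
      (by fun_prop) fun u => ?_).congr (Eventually.of_forall fun u => ?_)
    · rw [norm_inv, norm_sq_add_quarter, inv_le_comm₀ (by positivity) (by norm_num)]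
      nlinarith [sq_nonneg u]
    · exact (div_eq_inv_mul _ _).symm
  have i1 : Integrable fun u : ℝ => (1 / 2 - Complex.I * u) * W₀ u := by
    refine (integrable_mul_of_norm_le hG (f := fun u : ℝ => (Complex.I * u + 1 / 2)⁻¹)
      (by fun_prop) hz).congr (Eventually.of_forall fun u => ?_)
    simp only
    rw [hW₁]
    exact (div_eq_inv_mul _ _).symm
  have i2 : Integrable fun u : ℝ => (1 / 2 - Complex.I * u) * ((1 / 2 - Complex.I * u) * W₀ u) := by
    refine (integrable_mul_of_norm_le hG
      (f := fun u : ℝ => (1 / 2 - Complex.I * u) * (Complex.I * u + 1 / 2)⁻¹) (c := 1)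
      (by fun_prop) fun u => ?_).congr (Eventually.of_forall fun u => ?_)
    · rw [norm_mul, norm_inv, norm_conj_half_line, mul_inv_cancel₀]
      linarith [half_le_norm_half_line u]
    · simp only
      rw [hW₁, div_eq_mul_inv]
      ring
  have hre : ∀ {f : ℝ → ℂ} {f' : ℂ} {k : ℝ}, HasDerivAt f f' k →
      HasDerivAt (fun k => (f k).re) f'.re k := fun h =>
    Complex.reCLM.hasFDerivAt.comp_hasDerivAt _ h
  refine ⟨fun k => (-(1 / (2 * Real.pi) * ∫ u : ℝ, Complex.exp ((1 / 2 - Complex.I * u) * k) *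
      ((1 / 2 - Complex.I * u) * W₀ u))).re, fun k => (-(1 / (2 * Real.pi) * ∫ u : ℝ,
      Complex.exp ((1 / 2 - Complex.I * u) * k) * ((1 / 2 - Complex.I * u) *
      ((1 / 2 - Complex.I * u) * W₀ u)))).re, fun k => ?_, fun k => ?_, ?_, ?_, ?_⟩
  · have : C = fun k => ((C k : ℂ)).re := by ext k; simp
    rw [this]
    simp_rw [hC]
    refine hre ?_
    refine (((hasDerivAt_integral_exp_conj_half_line i0 i1 k).const_mul _).const_sub 1)
  · exact hre (((hasDerivAt_integral_exp_conj_half_line i1 i2 k).const_mul _).neg)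
  · exact Complex.continuous_re.comp
      ((continuous_const.mul (continuous_integral_exp_conj_half_line i2)).neg)
  · simp_rw [hW₁]
    simp
  · simp_rw [hW₁]
    rw [← Complex.sub_re]
    congr 1
    simp only [Complex.ofReal_zero, mul_zero, Complex.exp_zero, one_mul]
    -- Since `1 - (1/2 - iu) = iu + 1/2`, the difference of the second and first derivatives cancels
    -- the remaining denominator and leaves the integral of `G` alone.
    rw [neg_sub_neg, ← mul_sub, ← integral_sub]
    · congr 2
      ext u
      have h1 := half_line_ne_zero u
      rw [← mul_div_assoc, ← sub_div, div_eq_iff h1]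
      ring
    · exact i1.congr (Eventually.of_forall hW₁)
    · refine i2.congr (Eventually.of_forall fun u => ?_)
      simp only
      rw [hW₁]

/-! ### The standard normal distribution function -/

/-- The standard normal density. -/
noncomputable def stdNormalPDF (x : ℝ) : ℝ := (√(2 * Real.pi))⁻¹ * Real.exp (-x ^ 2 / 2)

lemma gaussianPDFReal_zero_one (x : ℝ) : gaussianPDFReal 0 1 x = stdNormalPDF x := by
  simp [gaussianPDFReal, stdNormalPDF]

lemma stdNormalPDF_pos (x : ℝ) : 0 < stdNormalPDF x := by
  unfold stdNormalPDF
  have := Real.pi_pos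
  positivity

lemma contDiff_stdNormalPDF {n : WithTop ℕ∞} : ContDiff ℝ n stdNormalPDF := by
  unfold stdNormalPDF
  fun_prop

lemma stdNormalPDF_neg (x : ℝ) : stdNormalPDF (-x) = stdNormalPDF x := by
  simp [stdNormalPDF]

lemma hasDerivAt_stdNormalPDF (x : ℝ) : HasDerivAt stdNormalPDF (-x * stdNormalPDF x) x := by
  have h1 : HasDerivAt (fun x : ℝ => -x ^ 2 / 2) (-x) x := by
    refine (((hasDerivAt_pow 2 x).neg).div_const 2).congr_deriv ?_
    simp
    ring
  refine ((h1.exp).const_mul (√(2 * Real.pi))⁻¹).congr_deriv ?_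
  rw [stdNormalPDF]
  ring

lemma integrable_stdNormalPDF : Integrable stdNormalPDF := by
  have := integrable_gaussianPDFReal 0 1
  rwa [show gaussianPDFReal 0 1 = stdNormalPDF from funext gaussianPDFReal_zero_one] at this

lemma stdNormalCDF_eq_integral (x : ℝ) : stdNormalCDF x = ∫ t in Iic x, stdNormalPDF t := by
  rw [stdNormalCDF, cdf_eq_real, Measure.real, gaussianReal_apply_eq_integral 0 one_ne_zero,
    ENNReal.toReal_ofReal (integral_nonneg fun t => gaussianPDFReal_nonneg _ _ _)]
  simp_rw [gaussianPDFReal_zero_one]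

lemma hasDerivAt_stdNormalCDF (x : ℝ) : HasDerivAt stdNormalCDF (stdNormalPDF x) x := by
  have hc : Continuous stdNormalPDF := (contDiff_stdNormalPDF (n := 0)).continuous
  have h : ∀ y, stdNormalCDF y = stdNormalCDF 0 + ∫ t in (0 : ℝ)..y, stdNormalPDF t := fun y => by
    rw [stdNormalCDF_eq_integral, stdNormalCDF_eq_integral,
      ← intervalIntegral.integral_Iic_sub_Iic integrable_stdNormalPDF.integrableOn
        integrable_stdNormalPDF.integrableOn]
    ring
  rw [show stdNormalCDF = _ from funext h]
  exact (intervalIntegral.integral_hasDerivAt_right (hc.intervalIntegrable _ _)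
    (hc.stronglyMeasurableAtFilter _ _) hc.continuousAt).const_add _

lemma contDiff_stdNormalCDF : ContDiff ℝ 2 stdNormalCDF := by
  rw [show (2 : WithTop ℕ∞) = 1 + 1 by norm_num, contDiff_succ_iff_deriv]
  refine ⟨fun x => (hasDerivAt_stdNormalCDF x).differentiableAt, by simp, ?_⟩
  rw [show deriv stdNormalCDF = stdNormalPDF from funext fun x => (hasDerivAt_stdNormalCDF x).deriv]
  exact contDiff_stdNormalPDF

lemma stdNormalCDF_neg (x : ℝ) : stdNormalCDF (-x) = 1 - stdNormalCDF x := by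
  have h1 : stdNormalCDF (-x) = ∫ t in Ioi x, stdNormalPDF t := by
    rw [stdNormalCDF_eq_integral, ← integral_comp_neg_Ioi]
    simp_rw [stdNormalPDF_neg]
  have h2 : stdNormalCDF x + ∫ t in Ioi x, stdNormalPDF t = ∫ t, stdNormalPDF t := by
    rw [stdNormalCDF_eq_integral]
    exact intervalIntegral.integral_Iic_add_Ioi integrable_stdNormalPDF.integrableOn
        integrable_stdNormalPDF.integrableOn
  have h3 : ∫ t, stdNormalPDF t = 1 := by
    simp_rw [← gaussianPDFReal_zero_one]
    exact integral_gaussianPDFReal_eq_one 0 one_ne_zero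
  rw [h1]
  linarith

lemma tendsto_stdNormalCDF_atTop : Tendsto stdNormalCDF atTop (𝓝 1) := tendsto_cdf_atTop _

/-- With `d± = -k/s ± s/2` one has `d₊² - d₋² = -2k`. This is the cancellation behind the simple
forms of the Black–Scholes sensitivities. -/
lemma exp_mul_stdNormalPDF (k : ℝ) {s : ℝ} (hs : s ≠ 0) :
    Real.exp k * stdNormalPDF (-k / s - s / 2) = stdNormalPDF (-k / s + s / 2) := by
  unfold stdNormalPDF
  rw [mul_left_comm, ← Real.exp_add]
  congr 2
  field_simp
  ring

/-! ### The Black–Scholes function -/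

/-- The at-the-money Black–Scholes price as a function of the total standard deviation. -/
noncomputable def atmPrice (s : ℝ) : ℝ := 2 * stdNormalCDF (s / 2) - 1

/-- The Black–Scholes price as a function of the total standard deviation. -/
noncomputable def bsPrice (s k : ℝ) : ℝ :=
  stdNormalCDF (-k / s + s / 2) - Real.exp k * stdNormalCDF (-k / s - s / 2)

lemma bsCall_sq {s : ℝ} (hs : 0 < s) (k : ℝ) : bsCall (s ^ 2) k = bsPrice s k := by
  rw [bsCall, bsPrice, Real.sqrt_sq hs.le]
  congr 3 <;> field_simp

lemma bsPrice_zero (s : ℝ) : bsPrice s 0 = atmPrice s := by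
  rw [bsPrice, atmPrice]
  simp only [neg_zero, zero_div, zero_add, zero_sub, Real.exp_zero, one_mul, stdNormalCDF_neg]
  ring

lemma stdNormalCDF_neg_half (s : ℝ) : stdNormalCDF (-s / 2) = (1 - atmPrice s) / 2 := by
  rw [neg_div, stdNormalCDF_neg, atmPrice]
  ring

lemma hasDerivAt_atmPrice (s : ℝ) : HasDerivAt atmPrice (stdNormalPDF (s / 2)) s := by
  have := ((hasDerivAt_stdNormalCDF (s / 2)).comp s ((hasDerivAt_id s).div_const 2)).const_mul 2
  refine (this.sub_const 1).congr_deriv ?_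
  ring

lemma continuous_atmPrice : Continuous atmPrice :=
  continuous_iff_continuousAt.2 fun s => (hasDerivAt_atmPrice s).continuousAt

lemma atmPrice_zero : atmPrice 0 = 0 := by
  have := stdNormalCDF_neg 0
  rw [neg_zero] at this
  rw [atmPrice, zero_div]
  linarith

lemma strictMono_atmPrice : StrictMono atmPrice := by
  refine strictMono_of_deriv_pos fun s => ?_
  rw [(hasDerivAt_atmPrice s).deriv]
  exact stdNormalPDF_pos _

lemma tendsto_atmPrice_atTop : Tendsto atmPrice atTop (𝓝 1) := by
  have h := (tendsto_stdNormalCDF_atTop.comp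
    (tendsto_id.atTop_div_const (two_pos (α := ℝ)))).const_mul 2 |>.sub_const 1
  norm_num at h
  exact h

lemma exists_atmPrice_eq {c : ℝ} (h0 : 0 < c) (h1 : c < 1) : ∃ s, 0 < s ∧ atmPrice s = c := by
  obtain ⟨s₁, hs₁⟩ := (tendsto_atmPrice_atTop.eventually (lt_mem_nhds h1)).exists
  have hs0 : 0 ≤ s₁ := by
    by_contra hneg
    have := strictMono_atmPrice (not_le.1 hneg)
    rw [atmPrice_zero] at this
    linarith
  obtain ⟨s, hs, hsc⟩ := intermediate_value_Icc hs0 continuous_atmPrice.continuousOn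
    (show c ∈ Icc (atmPrice 0) (atmPrice s₁) from ⟨by rw [atmPrice_zero]; exact h0.le, hs₁.le⟩)
  refine ⟨s, hs.1.lt_of_ne ?_, hsc⟩
  rintro rfl
  rw [atmPrice_zero] at hsc
  exact h0.ne hsc

/-- The derivative of the Black–Scholes price along a curve of total standard deviations. -/
lemma hasDerivAt_bsPrice_comp {S : ℝ → ℝ} {S' k : ℝ} (hS : HasDerivAt S S' k) (h0 : S k ≠ 0) :
    HasDerivAt (fun k => bsPrice (S k) k) (stdNormalPDF (-k / S k + S k / 2) * S' -
      Real.exp k * stdNormalCDF (-k / S k - S k / 2)) k := by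
  have hq : HasDerivAt (fun k => -k / S k) ((-1 * S k - -k * S') / S k ^ 2) k :=
    (hasDerivAt_id k).neg.div hS h0
  have hd1 := (hasDerivAt_stdNormalCDF (-k / S k + S k / 2)).comp k (hq.add (hS.div_const 2))
  have hd2 := (hasDerivAt_stdNormalCDF (-k / S k - S k / 2)).comp k (hq.sub (hS.div_const 2))
  refine (hd1.sub ((Real.hasDerivAt_exp k).mul hd2)).congr_deriv ?_
  simp only [Function.comp_apply, Pi.sub_apply]
  rw [← exp_mul_stdNormalPDF k h0]
  ring

lemma hasDerivAt_bsPrice (k : ℝ) {s : ℝ} (h0 : s ≠ 0) :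
    HasDerivAt (fun s => bsPrice s k) (stdNormalPDF (-k / s + s / 2)) s := by
  have hq : HasDerivAt (fun s : ℝ => -k / s) (-k * -(s ^ 2)⁻¹) s :=
    (hasDerivAt_inv h0).const_mul (-k)
  have hd1 := (hasDerivAt_stdNormalCDF (-k / s + s / 2)).comp s
    (hq.add ((hasDerivAt_id s).div_const 2))
  have hd2 := (hasDerivAt_stdNormalCDF (-k / s - s / 2)).comp s
    (hq.sub ((hasDerivAt_id s).div_const 2))
  refine (hd1.sub (hd2.const_mul (Real.exp k))).congr_deriv ?_
  rw [← exp_mul_stdNormalPDF k h0]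
  ring

lemma strictMonoOn_bsPrice (k : ℝ) : StrictMonoOn (fun s => bsPrice s k) (Ioi 0) := by
  refine strictMonoOn_of_deriv_pos (convex_Ioi 0) (fun s hs =>
    (hasDerivAt_bsPrice k (ne_of_gt hs)).continuousAt.continuousWithinAt) fun s hs => ?_
  rw [interior_Ioi] at hs
  rw [(hasDerivAt_bsPrice k (ne_of_gt hs)).deriv]
  exact stdNormalPDF_pos _

lemma contDiffAt_bsPrice {v : ℝ × ℝ} (hv : v.2 ≠ 0) :
    ContDiffAt ℝ 2 (fun v : ℝ × ℝ => bsPrice v.2 v.1) v := by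
  have hq : ContDiffAt ℝ 2 (fun v : ℝ × ℝ => -v.1 / v.2) v :=
    contDiffAt_fst.neg.div contDiffAt_snd hv
  have hh : ContDiffAt ℝ 2 (fun v : ℝ × ℝ => v.2 / 2) v := contDiffAt_snd.div_const 2
  exact (contDiff_stdNormalCDF.contDiffAt.comp v (hq.add hh)).sub
    ((contDiffAt_fst.exp).mul (contDiff_stdNormalCDF.contDiffAt.comp v (hq.sub hh)))

/-! ### Implied volatility near the money -/

/-- Implicit function theorem at `(0, s)`: the partial derivative of the price in the total standard
deviation is a value of the normal density, hence invertible. -/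
lemma exists_implicit_bsPrice {C : ℝ → ℝ} (hC : ContDiff ℝ 2 C) {s : ℝ} (hs : 0 < s)
    (hsC : bsPrice s 0 = C 0) : ∃ S : ℝ → ℝ, S 0 = s ∧ ContDiffAt ℝ 2 S 0 ∧
      ∀ᶠ k in 𝓝 0, 0 < S k ∧ bsPrice (S k) k = C k := by
  set f : ℝ × ℝ → ℝ := fun v => bsPrice v.2 v.1 - C v.1 with hf
  have hfc : ContDiffAt ℝ 2 f (0, s) :=
    (contDiffAt_bsPrice (v := (0, s)) hs.ne').sub (hC.contDiffAt.comp _ contDiffAt_fst)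
  have hf0 : f (0, s) = 0 := by simp [hf, hsC]
  have hinv : (fderiv ℝ f (0, s) ∘L .inr ℝ ℝ ℝ).IsInvertible := by
    have hd : HasDerivAt (fun t => f (0, t)) (stdNormalPDF (-0 / s + s / 2)) s :=
      (hasDerivAt_bsPrice 0 hs.ne').sub_const (C 0)
    have hd' : HasDerivAt (fun t => f (0, t)) (fderiv ℝ f (0, s) (0, 1)) s :=
      (hfc.differentiableAt (by norm_num)).hasFDerivAt.comp_hasDerivAt (f := fun t => ((0 : ℝ), t))
        s ((hasDerivAt_const s (0 : ℝ)).prodMk (hasDerivAt_id s))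
    have he := hd'.unique hd
    refine ⟨ContinuousLinearEquiv.unitsEquivAut ℝ (Units.mk0 _ (stdNormalPDF_pos (-0 / s + s / 2)).ne'),
      ?_⟩
    refine ContinuousLinearMap.ext_ring ?_
    simp only [ContinuousLinearMap.comp_apply, ContinuousLinearMap.inr_apply, he]
    simp
  have hn : (2 : WithTop ℕ∞) ≠ 0 := by norm_num
  have hS0 : hfc.implicitFunction hn hinv 0 = s := hfc.implicitFunction_apply_self hn hinv
  have hSc : ContDiffAt ℝ 2 (hfc.implicitFunction hn hinv) 0 :=
    hfc.contDiffAt_implicitFunction hn hinv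
  refine ⟨hfc.implicitFunction hn hinv, hS0, hSc, ?_⟩
  have hpos : ∀ᶠ k in 𝓝 (0 : ℝ), 0 < hfc.implicitFunction hn hinv k :=
    hSc.continuousAt.eventually (lt_mem_nhds (by rw [hS0]; exact hs))
  filter_upwards [hpos, hfc.eventually_apply_implicitFunction hn hinv] with k h1 h2
  rw [hf0] at h2
  exact ⟨h1, sub_eq_zero.1 h2⟩

/-- The identity `bsPrice (S k) k = C k` is differentiated once on a neighbourhood and once more at
`0`. Taking `C₂ - C₁` removes the distribution function, and at `k = 0` also the terms linear in
`S'`. -/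
lemma implicit_bsPrice_derivs {C C₁ C₂ S : ℝ → ℝ} {s : ℝ} (hC₁ : ∀ k, HasDerivAt C (C₁ k) k)
    (hC₂ : ∀ k, HasDerivAt C₁ (C₂ k) k) (hs : 0 < s) (hS0 : S 0 = s) (hS : ContDiffAt ℝ 2 S 0)
    (heq : ∀ᶠ k in 𝓝 0, 0 < S k ∧ bsPrice (S k) k = C k) :
    deriv S 0 = (stdNormalCDF (-s / 2) + C₁ 0) / stdNormalPDF (s / 2) ∧
      iteratedDeriv 2 S 0 = (C₂ 0 - C₁ 0) / stdNormalPDF (s / 2) - 1 / s +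
        s / 4 * deriv S 0 ^ 2 := by
  have hφ : stdNormalPDF (s / 2) ≠ 0 := (stdNormalPDF_pos _).ne'
  have hev : ∀ᶠ k in 𝓝 (0 : ℝ), HasDerivAt S (deriv S k) k := by
    filter_upwards [hS.eventually (by simp)] with k hk
    exact (hk.differentiableAt (by norm_num)).hasDerivAt
  have hd2 : HasDerivAt (deriv S) (iteratedDeriv 2 S 0) 0 := by
    have h1 : ContDiffAt ℝ 1 (fderiv ℝ S) 0 := hS.fderiv_right (by norm_num)
    have h2 : DifferentiableAt ℝ (deriv S) 0 := by
      rw [show deriv S = fun k => fderiv ℝ S k 1 from funext fun k => rfl]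
      exact (h1.differentiableAt (by norm_num)).clm_apply (differentiableAt_const _)
    rw [iteratedDeriv_succ, iteratedDeriv_one]
    exact h2.hasDerivAt
  have hC1 : ∀ᶠ k in 𝓝 (0 : ℝ), C₁ k = stdNormalPDF (-k / S k + S k / 2) * deriv S k -
      Real.exp k * stdNormalCDF (-k / S k - S k / 2) := by
    filter_upwards [hev, heq.eventually_nhds] with k h1 h2
    have h3 := hasDerivAt_bsPrice_comp h1 h2.self_of_nhds.1.ne'
    exact (hC₁ k).unique (h3.congr_of_eventuallyEq (h2.mono fun k hk => hk.2.symm))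
  have hS1 := hev.self_of_nhds
  have e1 : C₁ 0 = stdNormalPDF (s / 2) * deriv S 0 - stdNormalCDF (-s / 2) := by
    have := hC1.self_of_nhds
    rw [hS0] at this
    simpa [neg_div] using this
  have hq : HasDerivAt (fun k => -k / S k) ((-1 * S 0 - -0 * deriv S 0) / S 0 ^ 2) 0 :=
    (hasDerivAt_id (0 : ℝ)).neg.div hS1 (by rw [hS0]; exact hs.ne')
  have hp := ((hasDerivAt_stdNormalPDF (-0 / S 0 + S 0 / 2)).comp 0
    (hq.add (hS1.div_const 2))).mul hd2
  have hc := (Real.hasDerivAt_exp 0).mul ((hasDerivAt_stdNormalCDF (-0 / S 0 - S 0 / 2)).comp 0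
    (hq.sub (hS1.div_const 2)))
  have e2 := (hC₂ 0).unique ((hp.sub hc).congr_of_eventuallyEq hC1)
  have hn : stdNormalPDF (-(s / 2)) = stdNormalPDF (s / 2) := stdNormalPDF_neg _
  simp only [Function.comp_apply, Pi.add_apply, Pi.sub_apply, Real.exp_zero, hS0, neg_zero, zero_div, zero_add, zero_sub,
    zero_mul, sub_zero, one_mul, hn] at e2
  refine ⟨?_, ?_⟩
  · rw [e1]; field_simp; ring
  · rw [← neg_div] at e2
    rw [e2, e1]
    field_simp
    ring

lemma isImpliedVol_iff {C : ℝ → ℝ → ℝ} {τ k σ : ℝ} (hτ : 0 < τ) :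
    IsImpliedVol C τ k σ ↔ 0 < σ ∧ bsPrice (σ * √τ) k = C τ k := by
  refine and_congr_right fun hσ => ?_
  rw [← bsCall_sq (by positivity), mul_pow, Real.sq_sqrt hτ.le]

lemma impliedVol_unique {C : ℝ → ℝ → ℝ} {τ k σ₁ σ₂ : ℝ} (hτ : 0 < τ)
    (h₁ : IsImpliedVol C τ k σ₁) (h₂ : IsImpliedVol C τ k σ₂) : σ₁ = σ₂ := by
  rw [isImpliedVol_iff hτ] at h₁ h₂
  have hτ' : 0 < √τ := Real.sqrt_pos.2 hτ
  have := (strictMonoOn_bsPrice k).injOn (mul_pos h₁.1 hτ') (mul_pos h₂.1 hτ')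
    (h₁.2.trans h₂.2.symm)
  exact mul_right_cancel₀ hτ'.ne' this

/-- Existence, uniqueness and smoothness of the implied volatility near the money, and its
derivatives at the money. -/
theorem smile_at_money {C : ℝ → ℝ → ℝ} {τ : ℝ} (hτ : 0 < τ) {C₁ C₂ : ℝ → ℝ}
    (hC₁ : ∀ k, HasDerivAt (C τ) (C₁ k) k) (hC₂ : ∀ k, HasDerivAt C₁ (C₂ k) k)
    (hc : Continuous C₂) (h0 : 0 < C τ 0) (h1 : C τ 0 < 1) :
    ((∀ᶠ k in 𝓝 (0 : ℝ), ∃! s, IsImpliedVol C τ k s) ∧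
      ContDiffAt ℝ 2 (fun k => impliedVol C τ k) 0) ∧
    ∃ s χ : ℝ, 0 < s ∧ atmPrice s = C τ 0 ∧ smileCoeff C 0 τ = s / √τ ∧
      χ = (stdNormalCDF (-s / 2) + C₁ 0) / stdNormalPDF (s / 2) ∧
      smileCoeff C 1 τ = χ / √τ ∧
      smileCoeff C 2 τ = ((C₂ 0 - C₁ 0) / stdNormalPDF (s / 2) - 1 / s + s / 4 * χ ^ 2) / √τ := by
  have hτ' : 0 < √τ := Real.sqrt_pos.2 hτ
  obtain ⟨s, hs, hsC⟩ := exists_atmPrice_eq h0 h1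
  have hCc : ContDiff ℝ 2 (C τ) := by
    rw [show (2 : WithTop ℕ∞) = 1 + 1 by norm_num, contDiff_succ_iff_deriv]
    refine ⟨fun x => (hC₁ x).differentiableAt, by simp, ?_⟩
    rw [show deriv (C τ) = C₁ from funext fun x => (hC₁ x).deriv, contDiff_one_iff_deriv]
    refine ⟨fun x => (hC₂ x).differentiableAt, ?_⟩
    rwa [show deriv C₁ = C₂ from funext fun x => (hC₂ x).deriv]
  obtain ⟨S, hS0, hS, heq⟩ := exists_implicit_bsPrice hCc hs (by rw [bsPrice_zero, hsC])
  obtain ⟨hd1, hd2⟩ := implicit_bsPrice_derivs hC₁ hC₂ hs hS0 hS heq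
  have hiv : ∀ᶠ k in 𝓝 (0 : ℝ), IsImpliedVol C τ k (S k / √τ) := by
    filter_upwards [heq] with k hk
    rw [isImpliedVol_iff hτ, div_mul_cancel₀ _ hτ'.ne']
    exact ⟨div_pos hk.1 hτ', hk.2⟩
  -- Uniqueness identifies the chosen implied volatility with the implicit function near `0`, so the
  -- smile coefficients are those of `S` divided by `√τ`.
  have himp : (fun k => impliedVol C τ k) =ᶠ[𝓝 0] fun k => (√τ)⁻¹ * S k := by
    filter_upwards [hiv] with k hk
    have hex : ∃ s, IsImpliedVol C τ k s := ⟨_, hk⟩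
    rw [impliedVol, dif_pos hex, impliedVol_unique hτ hex.choose_spec hk, div_eq_inv_mul]
  have hit : ∀ n : ℕ, smileCoeff C n τ = iteratedDeriv n S 0 / √τ := fun n => by
    rw [smileCoeff, himp.iteratedDeriv_eq, iteratedDeriv_const_mul_field, div_eq_inv_mul]
  refine ⟨⟨?_, ?_⟩, s, deriv S 0, hs, hsC, ?_, hd1, ?_, ?_⟩
  · filter_upwards [hiv] with k hk
    exact ⟨_, hk, fun y hy => impliedVol_unique hτ hy hk⟩
  · exact (contDiffAt_const.mul hS).congr_of_eventuallyEq himp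
  · rw [hit, iteratedDeriv_zero, hS0]
  · rw [hit, iteratedDeriv_one]
  · rw [hit, hd2]

/-! ### Fourier representation of at-the-money Black–Scholes prices -/

lemma integrable_comp_abs {f : ℝ → ℝ} (hf : IntegrableOn f (Ioi 0)) :
    Integrable fun x => f |x| := by
  have h1 : IntegrableOn (fun x => f |x|) (Ioi 0) :=
    hf.congr_fun (fun x hx => by rw [abs_of_pos hx]) measurableSet_Ioi
  have h2 : IntegrableOn (fun x => f |x|) (Iic 0) := by
    rw [integrableOn_Iic_iff_integrableOn_Iio]
    have : IntegrableOn f (Ioi (-0)) := by rwa [neg_zero]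
    exact this.comp_neg_Iio.congr_fun (fun x hx => by rw [abs_of_neg hx]) measurableSet_Iio
  rw [← integrableOn_univ, ← Iic_union_Ioi (a := (0 : ℝ))]
  exact h2.union h1

lemma integrable_abs_rpow_mul_exp_neg_mul_sq {s b : ℝ} (hs : -1 < s) (hb : 0 < b) :
    Integrable fun x : ℝ => |x| ^ s * Real.exp (-b * x ^ 2) := by
  have := integrable_comp_abs (integrableOn_rpow_mul_exp_neg_mul_rpow hs (p := 2) two_pos hb)
  refine this.congr (Eventually.of_forall fun x => ?_)
  simp

lemma integrable_exp_neg_mul_abs_rpow {a b : ℝ} (ha : 0 < a) (hb : 0 < b) :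
    Integrable fun x : ℝ => Real.exp (-b * |x| ^ a) := by
  have := integrable_comp_abs (integrableOn_rpow_mul_exp_neg_mul_rpow (s := 0) (by norm_num)
    (p := a) ha hb)
  refine this.congr (Eventually.of_forall fun x => ?_)
  simp

/-- The Gaussian factor `exp (-s² (u² + 1/4) / 2)`. -/
noncomputable def gaussFactor (s u : ℝ) : ℝ := Real.exp (-(s ^ 2 / 2 * (u ^ 2 + 1 / 4)))

lemma gaussFactor_pos (s u : ℝ) : 0 < gaussFactor s u := Real.exp_pos _

lemma gaussFactor_le_one (s u : ℝ) : gaussFactor s u ≤ 1 := by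
  rw [gaussFactor, Real.exp_le_one_iff]
  have : 0 ≤ s ^ 2 / 2 * (u ^ 2 + 1 / 4) := by positivity
  linarith

@[fun_prop]
lemma continuous_gaussFactor (s : ℝ) : Continuous (gaussFactor s) := by
  unfold gaussFactor; fun_prop

lemma gaussFactor_eq (s u : ℝ) :
    gaussFactor s u = Real.exp (-s ^ 2 / 8) * Real.exp (-(s ^ 2 / 2) * u ^ 2) := by
  rw [gaussFactor, ← Real.exp_add]
  congr 1
  ring

lemma integrable_gaussFactor {s : ℝ} (hs : 0 < s) : Integrable (gaussFactor s) := by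
  rw [show gaussFactor s = _ from funext (gaussFactor_eq s)]
  exact (integrable_exp_neg_mul_sq (by positivity)).const_mul _

lemma integral_gaussFactor {s : ℝ} (hs : 0 < s) :
    ∫ u, gaussFactor s u = 2 * Real.pi * (stdNormalPDF (s / 2) / s) := by
  simp_rw [gaussFactor_eq]
  rw [integral_const_mul, integral_gaussian, stdNormalPDF]
  have hπ := Real.pi_pos
  have h1 : √(Real.pi / (s ^ 2 / 2)) = √(2 * Real.pi) / s := by
    rw [show Real.pi / (s ^ 2 / 2) = 2 * Real.pi / s ^ 2 by field_simp,
      Real.sqrt_div (by positivity), Real.sqrt_sq hs.le]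
  have h2 : 2 * Real.pi * (√(2 * Real.pi))⁻¹ = √(2 * Real.pi) := by
    rw [← div_eq_mul_inv, Real.div_sqrt]
  rw [h1, show -(s / 2) ^ 2 / 2 = -s ^ 2 / 8 by ring]
  linear_combination (-(Real.exp (-s ^ 2 / 8) / s)) * h2

lemma integrable_gaussFactor_div (s : ℝ) :
    Integrable fun u => gaussFactor s u * (u ^ 2 + 1 / 4)⁻¹ := by
  refine integrable_inv_sq_add_quarter.bdd_mul (c := 1)
    (continuous_gaussFactor s).aestronglyMeasurable (Eventually.of_forall fun u => ?_)
  rw [Real.norm_of_nonneg (gaussFactor_pos s u).le]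
  exact gaussFactor_le_one s u

/-- Differentiating in `s` cancels the denominator and leaves the Gaussian integral `-s ∫
gaussFactor s`, which compensates the derivative of `2π atmPrice`. The sum is therefore constant,
and its value at `s = 0` is the mass `2π` of the kernel. -/
lemma integral_gaussFactor_div {s : ℝ} (hs : 0 ≤ s) :
    ∫ u, gaussFactor s u * (u ^ 2 + 1 / 4)⁻¹ = 2 * Real.pi * (1 - atmPrice s) := by
  set D : ℝ → ℝ := fun s => (∫ u, gaussFactor s u * (u ^ 2 + 1 / 4)⁻¹) + 2 * Real.pi * atmPrice s
    with hD
  have hD0 : D 0 = 2 * Real.pi := by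
    simp [hD, atmPrice_zero, gaussFactor]
    simpa using integral_inv_sq_add_quarter
  rcases hs.eq_or_lt with rfl | hs
  · simp only [hD] at hD0
    linarith
  have hc : Continuous D := by
    refine Continuous.add ?_ (continuous_const.mul continuous_atmPrice)
    refine continuous_of_dominated (bound := fun u => (u ^ 2 + 1 / 4)⁻¹)
      (fun s => (integrable_gaussFactor_div s).1) (fun s => Eventually.of_forall fun u => ?_)
      integrable_inv_sq_add_quarter (Eventually.of_forall fun u => ?_)
    · rw [norm_mul, Real.norm_of_nonneg (gaussFactor_pos s u).le,
        Real.norm_of_nonneg (by positivity)]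
      exact mul_le_of_le_one_left (by positivity) (gaussFactor_le_one s u)
    · unfold gaussFactor
      fun_prop
  have hd : ∀ s, 0 < s → HasDerivAt D 0 s := by
    intro s hs
    have key := (hasDerivAt_integral_of_dominated_loc_of_deriv_le (μ := volume)
      (F := fun s u => gaussFactor s u * (u ^ 2 + 1 / 4)⁻¹)
      -- On the ball of radius `s/2` the parameter stays between `s/2` and `2s`.
      (F' := fun s u => -s * gaussFactor s u) (bound := fun u => 2 * s * gaussFactor (s / 2) u)
      (Metric.ball_mem_nhds s (half_pos hs))
      (Eventually.of_forall fun s => (integrable_gaussFactor_div s).1)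
      (integrable_gaussFactor_div s) (Continuous.aestronglyMeasurable (by fun_prop)) ?_
      ((integrable_gaussFactor (half_pos hs)).const_mul _) ?_).2
    · refine (key.add ((hasDerivAt_atmPrice s).const_mul (2 * Real.pi))).congr_deriv ?_
      rw [integral_const_mul, integral_gaussFactor hs]
      field_simp
      ring
    · refine Eventually.of_forall fun u t ht => ?_
      have ht' : |t - s| < s / 2 := by simpa [Real.dist_eq] using ht
      rw [abs_lt] at ht'
      rw [norm_mul, norm_neg, Real.norm_of_nonneg (by linarith : 0 ≤ t),
        Real.norm_of_nonneg (gaussFactor_pos t u).le]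
      have h1 : gaussFactor t u ≤ gaussFactor (s / 2) u := by
        unfold gaussFactor
        have : s / 2 ≤ t := by linarith
        gcongr
      have := gaussFactor_pos t u
      have h2 : t ≤ 2 * s := by linarith
      gcongr
    · refine Eventually.of_forall fun u t _ => ?_
      have h1 : HasDerivAt (fun t : ℝ => -(t ^ 2 / 2 * (u ^ 2 + 1 / 4)))
          (-(t * (u ^ 2 + 1 / 4))) t := by
        refine ((((hasDerivAt_pow 2 t).div_const 2).mul_const (u ^ 2 + 1 / 4)).neg).congr_deriv ?_
        simp
      refine (h1.exp.mul_const _).congr_deriv ?_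
      have : u ^ 2 + 1 / 4 ≠ 0 := by positivity
      rw [gaussFactor]
      field_simp
  obtain ⟨c, hc', he⟩ := exists_hasDerivAt_eq_slope D (fun _ => 0) hs hc.continuousOn
    fun x hx => hd x hx.1
  have h1 : D s = D 0 := by
    have : s - 0 ≠ 0 := by simpa using hs.ne'
    field_simp at he
    linarith
  rw [hD0] at h1
  simp only [hD] at h1
  linarith

lemma re_inv_half_line (u : ℝ) : ((Complex.I * u + 1 / 2)⁻¹).re = 1 / 2 * (u ^ 2 + 1 / 4)⁻¹ := by
  rw [Complex.inv_re, Complex.normSq_eq_norm_sq, normSq_half_line]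
  simp
  ring

/-! ### Bounds for the cumulant function -/

lemma ofReal_rpow_mul_cpow {h : ℝ} (hh : 0 < h) {w : ℂ} (hw : w ≠ 0) (a : ℝ) :
    ((h ^ a : ℝ) : ℂ) * w ^ (a : ℂ) = ((h : ℂ) * w) ^ (a : ℂ) := by
  have hh0 : (h : ℂ) ≠ 0 := Complex.ofReal_ne_zero.2 hh.ne'
  rw [Complex.ofReal_cpow hh.le, Complex.cpow_def_of_ne_zero hh0, Complex.cpow_def_of_ne_zero hw,
    Complex.cpow_def_of_ne_zero (mul_ne_zero hh0 hw), Complex.log_ofReal_mul hh hw,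
    ← Complex.exp_add, Complex.ofReal_log hh.le]
  ring_nf

/-- On the line `Re z = 1/2` the modulus is at least `1/2`, so lower powers are absorbed by higher
ones at the cost of a power of `2`. -/
lemma rpow_le_of_half_le {x a b : ℝ} (hx : 1 / 2 ≤ x) (hab : a ≤ b) :
    x ^ a ≤ 2 ^ (b - a) * x ^ b := by
  have h0 : 0 < x := by linarith
  have h1 := Real.rpow_le_rpow_of_exponent_le (by linarith : 1 ≤ 2 * x) hab
  rw [Real.mul_rpow two_pos.le h0.le, Real.mul_rpow two_pos.le h0.le] at h1
  rw [Real.rpow_sub two_pos, div_mul_eq_mul_div, le_div_iff₀ (by positivity)]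
  linarith

namespace TSParams

variable {θ : TSParams}

lemma exists_norm_upsilonTilde_le (hθ : θ.Admissible) : ∃ C, 0 ≤ C ∧ ∀ u : ℝ,
    ‖θ.upsilonTilde u‖ ≤ C * ‖Complex.I * u + 1 / 2‖ ^ θ.α := by
  have hκ : 0 ≤ θ.κPos := zero_le_one.trans hθ.one_le_κPos
  have hκ' := hθ.κNeg_nonneg
  refine ⟨|θ.aPos| * (2 * θ.κPos + 1) ^ θ.α + |θ.aNeg| * (2 * θ.κNeg + 1) ^ θ.α, by positivity,
    fun u => ?_⟩
  have hz := half_le_norm_half_line u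
  have hw : ∀ (k : ℝ) (w : ℂ), 0 ≤ k → ‖w‖ ≤ k + ‖Complex.I * u + 1 / 2‖ → ‖w ^ (θ.α : ℂ)‖ ≤
      (2 * k + 1) ^ θ.α * ‖Complex.I * u + 1 / 2‖ ^ θ.α := fun k w hk h => by
    rw [Complex.norm_cpow_real, ← Real.mul_rpow (by positivity) (norm_nonneg _)]
    have := hθ.α_pos.le
    gcongr
    nlinarith
  rw [upsilonTilde]
  refine (norm_add_le _ _).trans ?_
  rw [norm_mul, norm_mul, Complex.norm_real, Complex.norm_real, Real.norm_eq_abs,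
    Real.norm_eq_abs, add_mul, mul_assoc, mul_assoc]
  gcongr
  · refine hw _ _ hκ ((norm_sub_le _ _).trans ?_)
    simp [abs_of_nonneg hκ]
  · refine hw _ _ hκ' ((norm_add_le _ _).trans ?_)
    simp [abs_of_nonneg hκ']

lemma re_sub_half_line_pos (hθ : θ.Admissible) (u : ℝ) :
    0 < ((θ.κPos : ℂ) - (Complex.I * u + 1 / 2)).re := by
  have := hθ.one_le_κPos
  simp
  norm_num
  linarith

lemma re_add_half_line_pos (hθ : θ.Admissible) (u : ℝ) :
    0 < ((θ.κNeg : ℂ) + (Complex.I * u + 1 / 2)).re := by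
  have := hθ.κNeg_nonneg
  simp
  positivity

lemma continuous_upsilonTilde (hθ : θ.Admissible) : Continuous θ.upsilonTilde := by
  unfold upsilonTilde
  refine (continuous_const.mul (Continuous.cpow (by fun_prop) continuous_const fun u => ?_)).add
    (continuous_const.mul (Continuous.cpow (by fun_prop) continuous_const fun u => ?_))
  · exact Or.inl (re_sub_half_line_pos hθ u)
  · exact Or.inl (re_add_half_line_pos hθ u)

lemma continuous_jumpCumulant (hθ : θ.Admissible) : Continuous θ.jumpCumulant := by
  have := continuous_upsilonTilde hθ
  unfold jumpCumulant
  fun_prop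

lemma continuous_cumulant (hθ : θ.Admissible) : Continuous θ.cumulant := by
  have := continuous_jumpCumulant hθ
  unfold cumulant
  fun_prop

/-- The exponent `β` is the growth order: `α` when the drift is absent or dominated, and `1` when `α
< 1` and the drift dominates. -/
lemma exists_norm_jumpCumulant_le (hθ : θ.Admissible) {β : ℝ} (hβ : θ.α ≤ β)
    (hγ : θ.γ = 0 ∨ 1 ≤ β) : ∃ C, 0 ≤ C ∧ ∀ u : ℝ,
    ‖θ.jumpCumulant u‖ ≤ C * ‖Complex.I * u + 1 / 2‖ ^ β := by
  obtain ⟨C, hC, h⟩ := exists_norm_upsilonTilde_le hθ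
  refine ⟨|θ.γ| * 2 ^ (β - 1) + |θ.δ| * 2 ^ (β - 0) + C * 2 ^ (β - θ.α), by positivity,
    fun u => ?_⟩
  have hz := half_le_norm_half_line u
  have h1 : ‖(θ.γ : ℂ) * (Complex.I * u + 1 / 2)‖ ≤
      |θ.γ| * 2 ^ (β - 1) * ‖Complex.I * u + 1 / 2‖ ^ β := by
    rw [norm_mul, Complex.norm_real, Real.norm_eq_abs, mul_assoc]
    rcases hγ with hγ | hγ
    · simp [hγ]
    · have := rpow_le_of_half_le hz hγ
      rw [Real.rpow_one] at this
      gcongr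
  have h2 : ‖(θ.δ : ℂ)‖ ≤ |θ.δ| * 2 ^ (β - 0) * ‖Complex.I * u + 1 / 2‖ ^ β := by
    have := rpow_le_of_half_le hz (hθ.α_pos.le.trans hβ)
    rw [Real.rpow_zero] at this
    rw [Complex.norm_real, Real.norm_eq_abs, mul_assoc]
    exact le_mul_of_one_le_right (abs_nonneg _) this
  have h3 : ‖θ.upsilonTilde u‖ ≤ C * 2 ^ (β - θ.α) * ‖Complex.I * u + 1 / 2‖ ^ β := by
    refine (h u).trans ?_
    rw [mul_assoc]
    have := rpow_le_of_half_le hz hβ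
    gcongr
  rw [jumpCumulant, add_mul, add_mul]
  exact norm_add₃_le.trans (add_le_add (add_le_add h1 h2) h3)

/-- The characteristic exponent of the limiting stable law. -/
noncomputable def stableExponent (θ : TSParams) (v : ℝ) : ℂ :=
  θ.aPos * (-(Complex.I * v)) ^ (θ.α : ℂ) + θ.aNeg * (Complex.I * v) ^ (θ.α : ℂ)

lemma stableExponent_of_pos {v : ℝ} (hv : 0 < v) :
    θ.stableExponent v = ((v ^ θ.α : ℝ) : ℂ) * (θ.p + Complex.I * θ.q) := by
  have hI := Complex.I_ne_zero
  have e1 : (-(Complex.I * v)) ^ (θ.α : ℂ) = ((v ^ θ.α : ℝ) : ℂ) * (-Complex.I) ^ (θ.α : ℂ) := by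
    rw [ofReal_rpow_mul_cpow hv (neg_ne_zero.2 hI)]; ring_nf
  have e2 : (Complex.I * v) ^ (θ.α : ℂ) = ((v ^ θ.α : ℝ) : ℂ) * Complex.I ^ (θ.α : ℂ) := by
    rw [ofReal_rpow_mul_cpow hv hI]; ring_nf
  rw [stableExponent, e1, e2, Complex.cpow_def_of_ne_zero hI,
    Complex.cpow_def_of_ne_zero (neg_ne_zero.2 hI), Complex.log_I, Complex.log_neg_I,
    show -(Real.pi / 2 : ℂ) * Complex.I * θ.α = ((-(Real.pi * θ.α / 2) : ℝ) : ℂ) * Complex.I by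
      push_cast; ring,
    show (Real.pi / 2 : ℂ) * Complex.I * θ.α = ((Real.pi * θ.α / 2 : ℝ) : ℂ) * Complex.I by
      push_cast; ring,
    Complex.exp_mul_I, Complex.exp_mul_I, p, q, ← Complex.ofReal_cos, ← Complex.ofReal_cos,
    ← Complex.ofReal_sin, ← Complex.ofReal_sin, Real.cos_neg, Real.sin_neg]
  push_cast
  ring

lemma stableExponent_of_neg {v : ℝ} (hv : v < 0) :
    θ.stableExponent v = ((|v| ^ θ.α : ℝ) : ℂ) * (θ.p - Complex.I * θ.q) := by
  -- Exchanging the two jump intensities reflects the stable exponent; it keeps `p` and changes the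
  -- sign of `q`.
  set θ' : TSParams := { θ with cPos := θ.cNeg, cNeg := θ.cPos } with hθ'
  have hp : θ'.p = θ.p := by simp [p, aPos, aNeg, hθ']; left; ring
  have hq : θ'.q = -θ.q := by simp [q, aPos, aNeg, hθ']; ring
  have := stableExponent_of_pos (θ := θ') (neg_pos.2 hv)
  rw [abs_of_neg hv]
  have e : θ'.stableExponent (-v) = θ.stableExponent v := by
    simp only [stableExponent, hθ', aPos, aNeg]
    push_cast
    rw [mul_neg, neg_neg, add_comm]
  rw [← e, this, hp, hq]
  push_cast
  ring

lemma re_stableExponent {v : ℝ} (hv : v ≠ 0) : (θ.stableExponent v).re = θ.p * |v| ^ θ.α := by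
  rcases hv.lt_or_gt with h | h
  · rw [stableExponent_of_neg h, Complex.re_ofReal_mul]
    simp [mul_comm]
  · rw [stableExponent_of_pos h, Complex.re_ofReal_mul, abs_of_pos h]
    simp [mul_comm]

/-- By homogeneity `h^α` enters the powers and erases the tempering. For `v ≠ 0` the limiting bases
have nonzero imaginary part, so the principal power is continuous there. -/
lemma tendsto_upsilonTilde (hθ : θ.Admissible) {v : ℝ} (hv : v ≠ 0) :
    Tendsto (fun h : ℝ => ((h ^ θ.α : ℝ) : ℂ) * θ.upsilonTilde (v / h)) (𝓝[>] 0)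
      (𝓝 (θ.stableExponent v)) := by
  have hvI : (Complex.I * v : ℂ).im ≠ 0 := by simpa using hv
  have hvI' : (-(Complex.I * v) : ℂ).im ≠ 0 := by simpa using hv
  have hP : Tendsto (fun h : ℝ => (h : ℂ) * ((θ.κPos : ℂ) - 1 / 2) - Complex.I * v) (𝓝[>] 0)
      (𝓝 (-(Complex.I * v))) := by
    refine tendsto_nhdsWithin_of_tendsto_nhds ?_
    have : Continuous fun h : ℝ => (h : ℂ) * ((θ.κPos : ℂ) - 1 / 2) - Complex.I * v := by fun_prop
    simpa using this.tendsto 0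
  have hN : Tendsto (fun h : ℝ => (h : ℂ) * ((θ.κNeg : ℂ) + 1 / 2) + Complex.I * v) (𝓝[>] 0)
      (𝓝 (Complex.I * v)) := by
    refine tendsto_nhdsWithin_of_tendsto_nhds ?_
    have : Continuous fun h : ℝ => (h : ℂ) * ((θ.κNeg : ℂ) + 1 / 2) + Complex.I * v := by fun_prop
    simpa using this.tendsto 0
  have hP' := ((continuousAt_cpow_const (b := (θ.α : ℂ)) (Or.inr hvI')).tendsto.comp hP).const_mul
    (θ.aPos : ℂ)
  have hN' := ((continuousAt_cpow_const (b := (θ.α : ℂ)) (Or.inr hvI)).tendsto.comp hN).const_mul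
    (θ.aNeg : ℂ)
  refine (hP'.add hN').congr' ?_
  filter_upwards [self_mem_nhdsWithin] with h hh
  have hh0 : (0 : ℝ) < h := hh
  have hh1 : (h : ℂ) ≠ 0 := Complex.ofReal_ne_zero.2 hh0.ne'
  have n1 : (θ.κPos : ℂ) - (Complex.I * (v / h : ℝ) + 1 / 2) ≠ 0 := fun h0 => by
    have := re_sub_half_line_pos hθ (v / h)
    rw [h0] at this
    simp at this
  have n2 : (θ.κNeg : ℂ) + (Complex.I * (v / h : ℝ) + 1 / 2) ≠ 0 := fun h0 => by
    have := re_add_half_line_pos hθ (v / h)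
    rw [h0] at this
    simp at this
  rw [upsilonTilde, mul_add, mul_left_comm, mul_left_comm _ (θ.aNeg : ℂ),
    ofReal_rpow_mul_cpow hh0 n1, ofReal_rpow_mul_cpow hh0 n2]
  simp only [Function.comp]
  congr 3
  · push_cast
    field_simp
    ring
  · push_cast
    field_simp
    ring

/-- `Γ(-α)` and `cos(πα/2)` both change sign at `α = 1`, so their product keeps one sign. This makes
`p` negative, and hence the characteristic function decay. -/
lemma Gamma_neg_mul_cos_neg (hθ : θ.Admissible) :
    Real.Gamma (-θ.α) * Real.cos (Real.pi * θ.α / 2) < 0 := by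
  have hα := hθ.α_pos
  have hα2 := hθ.α_lt_two
  have hπ := Real.pi_pos
  have hG := Gamma_two_sub hα.ne' hθ.α_ne_one
  have hG2 : 0 < Real.Gamma (2 - θ.α) := Real.Gamma_pos_of_pos (by linarith)
  rcases hθ.α_ne_one.lt_or_gt with h1 | h1
  · have hc : 0 < Real.cos (Real.pi * θ.α / 2) :=
      Real.cos_pos_of_mem_Ioo ⟨by nlinarith, by nlinarith⟩
    have : Real.Gamma (-θ.α) < 0 := by
      by_contra hneg
      push Not at hneg
      nlinarith [mul_nonneg (mul_nonneg hα.le (by linarith : 0 ≤ 1 - θ.α)) hneg]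
    exact mul_neg_of_neg_of_pos this hc
  · have hc : Real.cos (Real.pi * θ.α / 2) < 0 :=
      Real.cos_neg_of_pi_div_two_lt_of_lt (by nlinarith) (by nlinarith)
    have : 0 < Real.Gamma (-θ.α) := by
      by_contra hneg
      push Not at hneg
      nlinarith [mul_nonneg (mul_nonneg hα.le (by linarith : 0 ≤ θ.α - 1)) (neg_nonneg.2 hneg)]
    exact mul_neg_of_pos_of_neg this hc

lemma p_eq : θ.p = (θ.cPos + θ.cNeg) * (Real.Gamma (-θ.α) * Real.cos (Real.pi * θ.α / 2)) := by
  rw [p, aPos, aNeg]; ring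

lemma p_neg (hθ : θ.Admissible) (h : 0 < θ.cPos + θ.cNeg) : θ.p < 0 := by
  rw [p_eq]
  exact mul_neg_of_pos_of_neg h (Gamma_neg_mul_cos_neg hθ)

/-- The real part is asymptotic to `p |u|^α`. Keeping only half of it leaves room for an exact
inequality at large `|u|`, and compactness covers the rest. -/
lemma exists_re_upsilonTilde_le (hθ : θ.Admissible) : ∃ C, ∀ u : ℝ,
    (θ.upsilonTilde u).re ≤ C + θ.p / 2 * |u| ^ θ.α := by
  have h0 : 0 ≤ θ.cPos + θ.cNeg := add_nonneg hθ.cPos_nonneg hθ.cNeg_nonneg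
  rcases h0.eq_or_lt with h0 | h0
  · have hP : θ.cPos = 0 := by linarith [hθ.cPos_nonneg, hθ.cNeg_nonneg]
    have hN : θ.cNeg = 0 := by linarith [hθ.cPos_nonneg, hθ.cNeg_nonneg]
    refine ⟨0, fun u => ?_⟩
    simp [upsilonTilde, aPos, aNeg, p, hP, hN]
  have hp := p_neg hθ h0
  -- The two directions `v = ±1` suffice, since any `u ≠ 0` is `±1 / h` with `h = 1/|u|`.
  have hev : ∀ v : ℝ, |v| = 1 → ∀ᶠ h : ℝ in 𝓝[>] 0, h ^ θ.α * (θ.upsilonTilde (v / h)).re < θ.p / 2 :=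
    fun v hv => by
    have hv0 : v ≠ 0 := by
      rintro rfl
      simp at hv
    have h1 := (Complex.continuous_re.tendsto _).comp (tendsto_upsilonTilde hθ hv0)
    rw [re_stableExponent hv0, hv, Real.one_rpow, mul_one] at h1
    refine (h1.eventually (gt_mem_nhds (by linarith : θ.p < θ.p / 2))).mono fun h hh => ?_
    simpa [Function.comp, Complex.re_ofReal_mul] using hh
  obtain ⟨h₀, hh₀, hb⟩ := mem_nhdsGT_iff_exists_Ioo_subset.1 ((hev 1 (by simp)).and (hev (-1) (by simp)))
  have hh₀' : (0 : ℝ) < h₀ := hh₀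
  have hlarge : ∀ u : ℝ, 1 / h₀ < |u| → (θ.upsilonTilde u).re ≤ θ.p / 2 * |u| ^ θ.α := by
    intro u hu
    have hu0 : 0 < |u| := lt_trans (by positivity) hu
    have hm : 1 / |u| ∈ Ioo 0 h₀ := ⟨by positivity, by rw [one_div_lt hu0 hh₀']; exact hu⟩
    obtain ⟨b1, b2⟩ := hb hm
    have e : ∀ v : ℝ, v / (1 / |u|) = v * |u| := fun v => by field_simp
    rw [e] at b1 b2
    have hpw : (1 / |u|) ^ θ.α = (|u| ^ θ.α)⁻¹ := by
      rw [one_div, Real.inv_rpow hu0.le]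
    have hpos : 0 < |u| ^ θ.α := Real.rpow_pos_of_pos hu0 _
    have key : (|u| ^ θ.α)⁻¹ * (θ.upsilonTilde u).re < θ.p / 2 := by
      rw [← hpw]
      rcases abs_choice u with h | h
      · rw [one_mul] at b1
        have : θ.upsilonTilde |u| = θ.upsilonTilde u := by rw [h]
        rwa [this] at b1
      · have : -1 * |u| = u := by rw [h]; ring
        rwa [this] at b2
    rw [inv_mul_lt_iff₀ hpos] at key
    linarith
  have hcont : Continuous fun u : ℝ => (θ.upsilonTilde u).re - θ.p / 2 * |u| ^ θ.α :=
    (Complex.continuous_re.comp (continuous_upsilonTilde hθ)).sub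
      (continuous_const.mul (continuous_abs.rpow_const fun u => Or.inr hθ.α_pos.le))
  obtain ⟨C, hC⟩ := (isCompact_Icc (a := -(1 / h₀)) (b := 1 / h₀)).bddAbove_image hcont.continuousOn
  refine ⟨max C 0, fun u => ?_⟩
  by_cases hu : 1 / h₀ < |u|
  · have := hlarge u hu
    have := le_max_right C 0
    linarith
  · push Not at hu
    have := hC ⟨u, abs_le.1 hu, rfl⟩
    simp only at this
    have := le_max_left C 0
    linarith

lemma exists_re_jumpCumulant_le (hθ : θ.Admissible) : ∃ C, 0 ≤ C ∧ ∀ u : ℝ,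
    (θ.jumpCumulant u).re ≤ C + θ.p / 2 * |u| ^ θ.α := by
  obtain ⟨C, hC⟩ := exists_re_upsilonTilde_le hθ
  refine ⟨|θ.γ / 2 + θ.δ + C|, abs_nonneg _, fun u => ?_⟩
  have e : (θ.jumpCumulant u).re = θ.γ / 2 + θ.δ + (θ.upsilonTilde u).re := by
    simp [jumpCumulant]
    ring
  rw [e]
  linarith [hC u, le_abs_self (θ.γ / 2 + θ.δ + C)]

lemma p_nonpos (hθ : θ.Admissible) : θ.p ≤ 0 := by
  rw [p_eq]
  exact mul_nonpos_of_nonneg_of_nonpos (add_nonneg hθ.cPos_nonneg hθ.cNeg_nonneg)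
    (Gamma_neg_mul_cos_neg hθ).le

lemma exp_cumulant_eq {τ : ℝ} (hτ : 0 ≤ τ) (u : ℝ) : Complex.exp (τ * θ.cumulant u) =
    (gaussFactor (θ.σ * √τ) u : ℂ) * Complex.exp (τ * θ.jumpCumulant u) := by
  rw [gaussFactor, mul_pow, Real.sq_sqrt hτ, Complex.ofReal_exp, ← Complex.exp_add, cumulant]
  push_cast
  congr 1
  ring

lemma integrable_exp_cumulant (hθ : θ.Admissible) {τ : ℝ} (hτ : 0 < τ) :
    Integrable fun u : ℝ => Complex.exp (τ * θ.cumulant u) := by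
  obtain ⟨C, hC, hb⟩ := exists_re_jumpCumulant_le hθ
  have hcont : Continuous fun u : ℝ => Complex.exp (τ * θ.cumulant u) := by
    have := continuous_cumulant hθ
    fun_prop
  have hp := p_nonpos hθ
  have hre : ∀ u : ℝ, ((τ : ℂ) * θ.cumulant u).re =
      τ * ((θ.jumpCumulant u).re - θ.σ ^ 2 / 2 * (u ^ 2 + 1 / 4)) := fun u => by
    rw [Complex.re_ofReal_mul, cumulant, Complex.sub_re]
    congr 2
    rw [ofReal_sq_add_quarter, ← Complex.ofReal_pow, show ((2 : ℂ)) = ((2 : ℝ) : ℂ) by simp,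
      ← Complex.ofReal_div, ← Complex.ofReal_mul, Complex.ofReal_re]
  rcases hθ.nondegenerate with hn | hn
  · have hp := p_neg hθ hn
    refine ((integrable_exp_neg_mul_abs_rpow hθ.α_pos
      (b := τ * (-θ.p / 2)) (by nlinarith)).const_mul (Real.exp (τ * C))).mono'
      hcont.aestronglyMeasurable (Eventually.of_forall fun u => ?_)
    rw [Complex.norm_exp, hre, ← Real.exp_add, Real.exp_le_exp]
    have h1 : 0 ≤ θ.σ ^ 2 / 2 * (u ^ 2 + 1 / 4) := by positivity
    nlinarith [hb u, mul_nonneg hτ.le h1]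
  · refine ((integrable_exp_neg_mul_sq (b := τ * (θ.σ ^ 2 / 2)) (by positivity)).const_mul
      (Real.exp (τ * C))).mono' hcont.aestronglyMeasurable (Eventually.of_forall fun u => ?_)
    rw [Complex.norm_exp, hre, ← Real.exp_add, Real.exp_le_exp]
    have h1 : 0 ≤ θ.σ ^ 2 := sq_nonneg _
    have h2 : θ.p / 2 * |u| ^ θ.α ≤ 0 :=
      mul_nonpos_of_nonpos_of_nonneg (by linarith) (Real.rpow_nonneg (abs_nonneg u) _)
    nlinarith [hb u, mul_nonneg hτ.le h1]

end TSParams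

/-! ### Scaling limits -/

/-- Taylor for `‖w‖ ≤ 1`, the triangle inequality otherwise. Being linear in `‖w‖` and uniform on a
half-plane, it yields the dominating functions of the limits below. -/
lemma norm_exp_sub_one_le_of_re_le {w : ℂ} {M : ℝ} (h : w.re ≤ M) :
    ‖Complex.exp w - 1‖ ≤ (2 + Real.exp M) * ‖w‖ := by
  have hM := Real.exp_pos M
  rcases le_total ‖w‖ 1 with h1 | h1
  · refine (Complex.norm_exp_sub_one_le h1).trans ?_
    nlinarith [norm_nonneg w]
  · have h2 : ‖Complex.exp w‖ ≤ Real.exp M := by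
      rw [Complex.norm_exp]; gcongr
    have h3 := norm_sub_le (Complex.exp w) 1
    rw [norm_one] at h3
    nlinarith

/-- The rescaled line `h (1 / 2 + i v / h)`. -/
noncomputable def scaledLine (h v : ℝ) : ℂ := Complex.I * v + h / 2

lemma scaledLine_eq {h : ℝ} (hh : h ≠ 0) (v : ℝ) :
    scaledLine h v = h * (Complex.I * (v / h : ℝ) + 1 / 2) := by
  have : (h : ℂ) ≠ 0 := Complex.ofReal_ne_zero.2 hh
  rw [scaledLine]
  push_cast
  field_simp

lemma abs_le_norm_scaledLine (h v : ℝ) : |v| ≤ ‖scaledLine h v‖ := by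
  have := Complex.abs_im_le_norm (scaledLine h v)
  simpa [scaledLine] using this

lemma norm_scaledLine_le {h : ℝ} (h0 : 0 < h) (h1 : h ≤ 1) (v : ℝ) :
    ‖scaledLine h v‖ ≤ |v| + 1 := by
  refine (norm_add_le _ _).trans ?_
  have e : ‖((h : ℂ) / 2)‖ = h / 2 := by
    rw [norm_div, Complex.norm_real, Real.norm_of_nonneg h0.le]; simp
  rw [e, norm_mul, Complex.norm_I, one_mul, Complex.norm_real, Real.norm_eq_abs]
  linarith

lemma normSq_scaledLine (h v : ℝ) : ‖scaledLine h v‖ ^ 2 = v ^ 2 + h ^ 2 / 4 := by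
  rw [← Complex.normSq_eq_norm_sq, Complex.normSq_apply]
  simp [scaledLine]
  ring

lemma rpow_mul_norm_half_line {h : ℝ} (hh : 0 < h) (β v : ℝ) :
    h ^ β * ‖Complex.I * (v / h : ℝ) + 1 / 2‖ ^ β = ‖scaledLine h v‖ ^ β := by
  rw [scaledLine_eq hh.ne', norm_mul, Complex.norm_real, Real.norm_of_nonneg hh.le,
    Real.mul_rpow hh.le (norm_nonneg _)]

lemma norm_scaledLine_rpow_le {h : ℝ} (h0 : 0 < h) (h1 : h ≤ 1) {s v : ℝ} (hs : s ≤ 2)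
    (hv : v ≠ 0) : ‖scaledLine h v‖ ^ s ≤ |v| ^ s + (|v| + 1) ^ 2 := by
  have hv' : 0 < |v| := abs_pos.2 hv
  have ha := abs_le_norm_scaledLine h v
  have hb := norm_scaledLine_le h0 h1 v
  rcases le_total s 0 with hs0 | hs0
  · have := Real.rpow_le_rpow_of_nonpos hv' ha hs0
    nlinarith [sq_nonneg (|v| + 1)]
  · have h2 := Real.rpow_le_rpow (norm_nonneg _) hb hs0
    have h3 := Real.rpow_le_rpow_of_exponent_le (by linarith : 1 ≤ |v| + 1) hs
    rw [Real.rpow_two] at h3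
    have := Real.rpow_nonneg hv'.le s
    linarith

lemma integral_eq_inv_smul_comp_div {h : ℝ} (hh : 0 < h) (f : ℝ → ℂ) :
    ∫ u, f u = (h : ℂ)⁻¹ * ∫ v, f (v / h) := by
  rw [Measure.integral_comp_div, abs_of_pos hh, Complex.real_smul, ← mul_assoc,
    inv_mul_cancel₀ (Complex.ofReal_ne_zero.2 hh.ne'), one_mul]

lemma ae_ne_zero : ∀ᵐ v : ℝ, v ≠ 0 := by
  rw [ae_iff]
  simp

lemma eventually_pos_le_one : ∀ᶠ h : ℝ in 𝓝[>] 0, 0 < h ∧ h ≤ 1 := by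
  filter_upwards [Ioc_mem_nhdsGT (zero_lt_one (α := ℝ))] with h hh using hh

lemma tendsto_rpow_zero_of_pos {s : ℝ} (hs : 0 < s) :
    Tendsto (fun h : ℝ => h ^ s) (𝓝[>] 0) (𝓝 0) := by
  have := (Real.continuousAt_rpow_const 0 s (Or.inr hs.le)).tendsto
  rw [Real.zero_rpow hs.ne'] at this
  exact tendsto_nhdsWithin_of_tendsto_nhds this

lemma tendsto_scaledLine (v : ℝ) :
    Tendsto (fun h : ℝ => scaledLine h v) (𝓝[>] 0) (𝓝 (Complex.I * v)) := by
  refine tendsto_nhdsWithin_of_tendsto_nhds ?_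
  have : Continuous fun h : ℝ => scaledLine h v := by unfold scaledLine; fun_prop
  simpa [scaledLine] using this.tendsto 0

lemma gaussFactor_scaled {h : ℝ} (hh : h ≠ 0) (σ v : ℝ) :
    gaussFactor (σ * h) (v / h) = Real.exp (-(σ ^ 2 / 2) * (v ^ 2 + h ^ 2 / 4)) := by
  rw [gaussFactor]
  congr 1
  field_simp

lemma gaussFactor_scaled_le {h : ℝ} (hh : h ≠ 0) (σ v : ℝ) :
    gaussFactor (σ * h) (v / h) ≤ Real.exp (-(σ ^ 2 / 2) * v ^ 2) := by
  rw [gaussFactor_scaled hh, Real.exp_le_exp]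
  nlinarith [mul_nonneg (sq_nonneg σ) (sq_nonneg h)]

lemma tendsto_gaussFactor_scaled (σ v : ℝ) :
    Tendsto (fun h : ℝ => gaussFactor (σ * h) (v / h)) (𝓝[>] 0)
      (𝓝 (Real.exp (-(σ ^ 2 / 2) * v ^ 2))) := by
  have hc : Continuous fun h : ℝ => Real.exp (-(σ ^ 2 / 2) * (v ^ 2 + h ^ 2 / 4)) := by fun_prop
  have := tendsto_nhdsWithin_of_tendsto_nhds (s := Ioi 0) (hc.tendsto 0)
  simp only [ne_eq, OfNat.ofNat_ne_zero, not_false_eq_true, zero_pow, zero_div, add_zero] at this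
  refine this.congr' ?_
  filter_upwards [self_mem_nhdsWithin] with h hh
  rw [gaussFactor_scaled (ne_of_gt hh)]

namespace TSParams

variable {θ : TSParams}

section Stable

/-! #### The stable regime -/

/-- `D` is the limit of the rescaled drift: `0` at a scale finer than the drift's or when `γ = 0`,
and `γ` at `β = 1`. The constant `δ` always disappears. -/
lemma tendsto_scaled_jumpCumulant {β : ℝ} (hβ : 0 < β) {D Λ : ℂ} {v : ℝ}
    (hυ : Tendsto (fun h : ℝ => ((h ^ β : ℝ) : ℂ) * θ.upsilonTilde (v / h)) (𝓝[>] 0) (𝓝 Λ))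
    (hγ : Tendsto (fun h : ℝ => ((h ^ (β - 1) : ℝ) : ℂ) * θ.γ) (𝓝[>] 0) (𝓝 D)) :
    Tendsto (fun h : ℝ => ((h ^ β : ℝ) : ℂ) * θ.jumpCumulant (v / h)) (𝓝[>] 0)
      (𝓝 (D * (Complex.I * v) + Λ)) := by
  have h0 : Tendsto (fun h : ℝ => ((h ^ β : ℝ) : ℂ)) (𝓝[>] 0) (𝓝 0) :=
    (Complex.continuous_ofReal.tendsto 0).comp (tendsto_rpow_zero_of_pos hβ)
  have h1 := ((hγ.mul (tendsto_scaledLine v)).add (h0.mul_const (θ.δ : ℂ))).add hυ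
  rw [zero_mul, add_zero] at h1
  refine h1.congr' ?_
  filter_upwards [self_mem_nhdsWithin] with h hh
  have hh0 : (0 : ℝ) < h := hh
  rw [jumpCumulant, scaledLine_eq hh0.ne', Real.rpow_sub_one hh0.ne']
  have : (h : ℂ) ≠ 0 := Complex.ofReal_ne_zero.2 hh0.ne'
  push_cast
  field_simp

lemma tendsto_scaled_jumpCumulant_stable (hθ : θ.Admissible) (hγ : θ.γ = 0 ∨ 1 < θ.α) {v : ℝ}
    (hv : v ≠ 0) :
    Tendsto (fun h : ℝ => ((h ^ θ.α : ℝ) : ℂ) * θ.jumpCumulant (v / h)) (𝓝[>] 0)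
      (𝓝 (θ.stableExponent v)) := by
  have := tendsto_scaled_jumpCumulant hθ.α_pos (D := 0) (tendsto_upsilonTilde hθ hv) (by
    rcases hγ with hγ | hγ
    · simp [hγ]
    · have := ((Complex.continuous_ofReal.tendsto 0).comp
        (tendsto_rpow_zero_of_pos (sub_pos.2 hγ))).mul_const (θ.γ : ℂ)
      simpa using this)
  simpa using this

lemma norm_scaled_jumpCumulant_le {C β : ℝ}
    (hC : ∀ u : ℝ, ‖θ.jumpCumulant u‖ ≤ C * ‖Complex.I * u + 1 / 2‖ ^ β) {h : ℝ} (hh : 0 < h)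
    (v : ℝ) : h ^ β * ‖θ.jumpCumulant (v / h)‖ ≤ C * ‖scaledLine h v‖ ^ β := by
  rw [← rpow_mul_norm_half_line hh, mul_left_comm]
  exact mul_le_mul_of_nonneg_left (hC _) (Real.rpow_nonneg hh.le _)

lemma re_scaled_jumpCumulant_le (hθ : θ.Admissible) {C : ℝ} (hC0 : 0 ≤ C)
    (hC : ∀ u : ℝ, (θ.jumpCumulant u).re ≤ C + θ.p / 2 * |u| ^ θ.α) {h : ℝ} (hh : 0 < h)
    (hh1 : h ≤ 1) (v : ℝ) : (((h ^ θ.α : ℝ) : ℂ) * θ.jumpCumulant (v / h)).re ≤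
      C + θ.p / 2 * |v| ^ θ.α := by
  rw [Complex.re_ofReal_mul]
  have h1 : 0 < h ^ θ.α := Real.rpow_pos_of_pos hh _
  have h2 : h ^ θ.α ≤ 1 := Real.rpow_le_one hh.le hh1 hθ.α_pos.le
  have h3 : |v / h| ^ θ.α = |v| ^ θ.α / h ^ θ.α := by
    rw [abs_div, abs_of_pos hh, Real.div_rpow (abs_nonneg v) hh.le]
  calc _ ≤ h ^ θ.α * (C + θ.p / 2 * |v / h| ^ θ.α) := mul_le_mul_of_nonneg_left (hC _) h1.le
    _ = h ^ θ.α * C + θ.p / 2 * |v| ^ θ.α := by rw [h3]; field_simp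
    _ ≤ _ := by nlinarith

lemma aestronglyMeasurable_scaled (hθ : θ.Admissible) (c : ℂ) (h : ℝ) :
    Measurable fun v : ℝ => Complex.exp (c * θ.jumpCumulant (v / h)) := by
  have := (continuous_jumpCumulant hθ).measurable
  exact Complex.measurable_exp.comp
    ((this.comp (measurable_id.div_const h)).const_mul c)

/-- The parameter `h` stands for `τ^{1/α}`. Substituting `u = v/h`, the decay `e^{p|v|^α / 2}` is
uniform in `h ≤ 1` and dominates. -/
theorem tendsto_stable_density (hθ : θ.Admissible) (hp : θ.p < 0) (hγ : θ.γ = 0 ∨ 1 < θ.α) :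
    Tendsto (fun h : ℝ => (h : ℂ) * ∫ u : ℝ, Complex.exp (((h ^ θ.α : ℝ) : ℂ) * θ.jumpCumulant u))
      (𝓝[>] 0) (𝓝 (∫ v : ℝ, Complex.exp (θ.stableExponent v))) := by
  obtain ⟨C, hC0, hC⟩ := exists_re_jumpCumulant_le hθ
  have key : Tendsto (fun h : ℝ => ∫ v : ℝ,
      Complex.exp (((h ^ θ.α : ℝ) : ℂ) * θ.jumpCumulant (v / h)))
      (𝓝[>] 0) (𝓝 (∫ v : ℝ, Complex.exp (θ.stableExponent v))) := by
    refine tendsto_integral_filter_of_dominated_convergence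
      (fun v => Real.exp C * Real.exp (-(-θ.p / 2) * |v| ^ θ.α)) ?_ ?_
      ((integrable_exp_neg_mul_abs_rpow hθ.α_pos (by linarith)).const_mul _) ?_
    · exact Eventually.of_forall fun h => (aestronglyMeasurable_scaled hθ _ h).aestronglyMeasurable
    · filter_upwards [eventually_pos_le_one] with h hh
      refine Eventually.of_forall fun v => ?_
      rw [Complex.norm_exp, ← Real.exp_add, Real.exp_le_exp]
      have := re_scaled_jumpCumulant_le hθ hC0 hC hh.1 hh.2 v
      linarith
    · filter_upwards [ae_ne_zero] with v hv
      exact (Complex.continuous_exp.tendsto _).comp (tendsto_scaled_jumpCumulant_stable hθ hγ hv)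
  refine key.congr' ?_
  filter_upwards [self_mem_nhdsWithin] with h hh
  have hh0 : (0 : ℝ) < h := hh
  symm
  rw [integral_eq_inv_smul_comp_div hh0, ← mul_assoc,
    mul_inv_cancel₀ (Complex.ofReal_ne_zero.2 hh0.ne'), one_mul]

/-- The rescaled integrand is of order `|v|^{α-2}` near zero and `|v|^{-2}` at infinity.
Integrability at zero is where `α > 1` enters. -/
theorem tendsto_stable_price (hθ : θ.Admissible) (hα : 1 < θ.α) :
    Tendsto (fun h : ℝ => (h : ℂ)⁻¹ * ∫ u : ℝ,
      (Complex.exp (((h ^ θ.α : ℝ) : ℂ) * θ.jumpCumulant u) - 1) / ((u : ℂ) ^ 2 + 1 / 4))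
      (𝓝[>] 0) (𝓝 (∫ v : ℝ, (Complex.exp (θ.stableExponent v) - 1) / (v : ℂ) ^ 2)) := by
  obtain ⟨C, hC0, hC⟩ := exists_re_jumpCumulant_le hθ
  obtain ⟨K, hK0, hK⟩ := exists_norm_jumpCumulant_le hθ le_rfl (Or.inr hα.le)
  have hp := p_nonpos hθ
  have hα2 := hθ.α_lt_two
  have key : Tendsto (fun h : ℝ => ∫ v : ℝ,
      (Complex.exp (((h ^ θ.α : ℝ) : ℂ) * θ.jumpCumulant (v / h)) - 1) /
        ((v ^ 2 + h ^ 2 / 4 : ℝ) : ℂ))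
      (𝓝[>] 0) (𝓝 (∫ v : ℝ, (Complex.exp (θ.stableExponent v) - 1) / (v : ℂ) ^ 2)) := by
    refine tendsto_integral_filter_of_dominated_convergence
      (fun v => ((2 + Real.exp C) * K + Real.exp C + 1) * powMajorant (θ.α - 2) (-2) |v|) ?_ ?_
      ((integrable_comp_abs (integrableOn_powMajorant (by linarith) (by norm_num))).const_mul _) ?_
    · exact Eventually.of_forall fun h => (((aestronglyMeasurable_scaled hθ _ h).sub_const 1).div
        (by fun_prop)).aestronglyMeasurable
    · filter_upwards [eventually_pos_le_one] with h hh
      filter_upwards [ae_ne_zero] with v hv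
      have hv' : 0 < |v| := abs_pos.2 hv
      have hz := abs_le_norm_scaledLine h v
      have hz0 : 0 < ‖scaledLine h v‖ := hv'.trans_le hz
      have hre := re_scaled_jumpCumulant_le hθ hC0 hC hh.1 hh.2 v
      have hre' : (((h ^ θ.α : ℝ) : ℂ) * θ.jumpCumulant (v / h)).re ≤ C :=
        hre.trans (by nlinarith [Real.rpow_nonneg hv'.le θ.α])
      rw [norm_div, Complex.norm_real, Real.norm_of_nonneg (by positivity), ← normSq_scaledLine,
        powMajorant]
      split_ifs with h1
      · have h2 := norm_exp_sub_one_le_of_re_le hre'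
        rw [norm_mul, Complex.norm_real, Real.norm_of_nonneg (Real.rpow_nonneg hh.1.le _)] at h2
        have h3 := norm_scaled_jumpCumulant_le hK hh.1 v
        have h4 : ‖scaledLine h v‖ ^ (θ.α - 2) ≤ |v| ^ (θ.α - 2) :=
          Real.rpow_le_rpow_of_nonpos hv' hz (by linarith)
        rw [Real.rpow_sub hz0, Real.rpow_two] at h4
        have hE := Real.exp_pos C
        calc _ ≤ (2 + Real.exp C) * (K * ‖scaledLine h v‖ ^ θ.α) / ‖scaledLine h v‖ ^ 2 := by
              gcongr
              exact h2.trans (by gcongr)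
          _ = (2 + Real.exp C) * K * (‖scaledLine h v‖ ^ θ.α / ‖scaledLine h v‖ ^ 2) := by ring
          _ ≤ (2 + Real.exp C) * K * |v| ^ (θ.α - 2) := by gcongr
          _ ≤ _ := by
              have := Real.rpow_nonneg hv'.le (θ.α - 2)
              nlinarith
      · have h2 : ‖Complex.exp (((h ^ θ.α : ℝ) : ℂ) * θ.jumpCumulant (v / h)) - 1‖ ≤
            Real.exp C + 1 := by
          refine (norm_sub_le _ _).trans ?_
          rw [norm_one, Complex.norm_exp]
          gcongr
        have h5 : |v| ^ (-2 : ℝ) = (|v| ^ 2)⁻¹ := by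
          rw [Real.rpow_neg hv'.le, Real.rpow_two]
        have hE := Real.exp_pos C
        rw [h5, ← div_eq_mul_inv]
        have : 0 ≤ (2 + Real.exp C) * K := by positivity
        gcongr
        linarith
    · filter_upwards [ae_ne_zero] with v hv
      refine (((Complex.continuous_exp.tendsto _).comp (tendsto_scaled_jumpCumulant_stable hθ
        (Or.inr hα) hv)).sub_const 1).div ?_ (by simpa using hv)
      refine tendsto_nhdsWithin_of_tendsto_nhds ?_
      have : Continuous fun h : ℝ => ((v ^ 2 + h ^ 2 / 4 : ℝ) : ℂ) := by fun_prop
      simpa using this.tendsto 0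
  refine key.congr' ?_
  filter_upwards [self_mem_nhdsWithin] with h hh
  have hh0 : (0 : ℝ) < h := hh
  have hh1 : (h : ℂ) ≠ 0 := Complex.ofReal_ne_zero.2 hh0.ne'
  symm
  rw [integral_eq_inv_smul_comp_div hh0, ← mul_assoc, ← integral_const_mul]
  congr 1
  ext v
  have e : (((v / h : ℝ) : ℂ) ^ 2 + 1 / 4) = ((v ^ 2 + h ^ 2 / 4 : ℝ) : ℂ) / h ^ 2 := by
    push_cast
    field_simp
  rw [e]
  field_simp

/-- The kernel `1/(iu + 1/2)` rescales to `1/(iv)`, which is not integrable at zero. Subtracting a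
Gaussian of the same scale `h`, whose own contribution is explicit, removes the singularity. -/
theorem tendsto_stable_prob (hθ : θ.Admissible) (hp : θ.p < 0) (hγ : θ.γ = 0 ∨ 1 < θ.α) :
    Tendsto (fun h : ℝ => ∫ u : ℝ,
      (Complex.exp (((h ^ θ.α : ℝ) : ℂ) * θ.jumpCumulant u) - gaussFactor h u) /
        (Complex.I * u + 1 / 2))
      (𝓝[>] 0) (𝓝 (∫ v : ℝ, (Complex.exp (θ.stableExponent v) -
        Real.exp (-(1 / 2) * v ^ 2)) / (Complex.I * v))) := by
  obtain ⟨C, hC0, hC⟩ := exists_re_jumpCumulant_le hθ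
  obtain ⟨K, hK0, hK⟩ := exists_norm_jumpCumulant_le hθ le_rfl (hγ.imp id le_of_lt)
  have hα0 := hθ.α_pos
  have hα2 := hθ.α_lt_two
  set E : ℝ → ℝ := fun v => Real.exp (-(-θ.p / 2) * |v| ^ θ.α) + Real.exp (-(1 / 2) * v ^ 2) with hE
  have hEi : Integrable fun v : ℝ => (|v| ^ (θ.α - 1) + 2) * E v := by
    have i1 := integrable_comp_abs (integrableOn_rpow_mul_exp_neg_mul_rpow (s := θ.α - 1)
      (by linarith) hα0 (b := -θ.p / 2) (by linarith))
    have i2 := integrable_abs_rpow_mul_exp_neg_mul_sq (s := θ.α - 1) (b := 1 / 2)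
      (by linarith) (by norm_num)
    have i3 := (integrable_exp_neg_mul_abs_rpow hα0 (b := -θ.p / 2) (by linarith)).const_mul 2
    have i4 := (integrable_exp_neg_mul_sq (b := 1 / 2) (by norm_num)).const_mul 2
    refine (((i1.add i2).add i3).add i4).congr (Eventually.of_forall fun v => ?_)
    simp only [hE, Pi.add_apply]
    ring
  have key : Tendsto (fun h : ℝ => ∫ v : ℝ,
      (Complex.exp (((h ^ θ.α : ℝ) : ℂ) * θ.jumpCumulant (v / h)) -
        (gaussFactor (1 * h) (v / h) : ℝ)) / scaledLine h v)
      (𝓝[>] 0) (𝓝 (∫ v : ℝ, (Complex.exp (θ.stableExponent v) -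
        Real.exp (-(1 / 2) * v ^ 2)) / (Complex.I * v))) := by
    refine tendsto_integral_filter_of_dominated_convergence
      -- The first constant covers `|v| ≤ 1`, where `E v ≥ e^{-1/2}` and the numerator is small;
      -- `e^C + 1` covers `|v| > 1`, where only the decay matters.
      (fun v => (((2 + Real.exp C) * K + 1) * Real.exp (1 / 2) + Real.exp C + 1) *
        ((|v| ^ (θ.α - 1) + 2) * E v)) ?_ ?_ (hEi.const_mul _) ?_
    · refine Eventually.of_forall fun h => (((aestronglyMeasurable_scaled hθ _ h).sub ?_).div
        ?_).aestronglyMeasurable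
      · unfold gaussFactor; fun_prop
      · unfold scaledLine; fun_prop
    · filter_upwards [eventually_pos_le_one] with h hh
      filter_upwards [ae_ne_zero] with v hv
      have hv' : 0 < |v| := abs_pos.2 hv
      have hz := abs_le_norm_scaledLine h v
      have hz0 : 0 < ‖scaledLine h v‖ := hv'.trans_le hz
      have hre := re_scaled_jumpCumulant_le hθ hC0 hC hh.1 hh.2 v
      have hre' : (((h ^ θ.α : ℝ) : ℂ) * θ.jumpCumulant (v / h)).re ≤ C :=
        hre.trans (by nlinarith [Real.rpow_nonneg hv'.le θ.α])
      have hg := gaussFactor_scaled_le hh.1.ne' 1 v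
      have hg0 := gaussFactor_pos (1 * h) (v / h)
      have hr0 := Real.rpow_nonneg hv'.le (θ.α - 1)
      have hE1 := Real.exp_pos C
      have hE0 : 0 < E v := by simp only [hE]; positivity
      rw [norm_div]
      rcases le_or_gt |v| 1 with h1 | h1
      · have h2 := norm_exp_sub_one_le_of_re_le hre'
        rw [norm_mul, Complex.norm_real, Real.norm_of_nonneg (Real.rpow_nonneg hh.1.le _)] at h2
        have h3 := norm_scaled_jumpCumulant_le hK hh.1 v
        have h4 : ‖(1 : ℂ) - (gaussFactor (1 * h) (v / h) : ℝ)‖ ≤ ‖scaledLine h v‖ ^ 2 / 2 := by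
          rw [← Complex.ofReal_one, ← Complex.ofReal_sub, Complex.norm_real,
            Real.norm_of_nonneg (sub_nonneg.2 (gaussFactor_le_one _ _)), gaussFactor_scaled hh.1.ne',
            ← normSq_scaledLine]
          have := Real.add_one_le_exp (-(1 ^ 2 / 2) * ‖scaledLine h v‖ ^ 2)
          linarith
        have h5 : ‖Complex.exp (((h ^ θ.α : ℝ) : ℂ) * θ.jumpCumulant (v / h)) -
            (gaussFactor (1 * h) (v / h) : ℝ)‖ ≤
            (2 + Real.exp C) * (K * ‖scaledLine h v‖ ^ θ.α) + ‖scaledLine h v‖ ^ 2 / 2 := by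
          have := (norm_add_le _ _).trans (add_le_add (h2.trans
            (mul_le_mul_of_nonneg_left h3 (by positivity))) h4)
          rwa [sub_add_sub_cancel] at this
        have h6 : ‖scaledLine h v‖ ≤ 2 := (norm_scaledLine_le hh.1 hh.2 v).trans (by linarith)
        have h7 : ‖scaledLine h v‖ ^ (θ.α - 1) ≤ |v| ^ (θ.α - 1) + 2 := by
          rcases le_total θ.α 1 with hα | hα
          · have := Real.rpow_le_rpow_of_nonpos hv' hz (by linarith : θ.α - 1 ≤ 0)
            linarith
          · have h8 := Real.rpow_le_rpow hz0.le h6 (by linarith : 0 ≤ θ.α - 1)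
            have h9 := Real.rpow_le_rpow_of_exponent_le one_le_two (by linarith : θ.α - 1 ≤ 1)
            rw [Real.rpow_one] at h9
            linarith
        have h8 : 1 ≤ Real.exp (1 / 2) * E v := by
          have : Real.exp (-(1 / 2)) ≤ E v := by
            have h9 : Real.exp (-(1 / 2)) ≤ Real.exp (-(1 / 2) * v ^ 2) := by
              gcongr
              have := (sq_le_one_iff_abs_le_one v).2 h1
              linarith
            have := Real.exp_pos (-(-θ.p / 2) * |v| ^ θ.α)
            simp only [hE]
            linarith
          calc (1 : ℝ) = Real.exp (1 / 2) * Real.exp (-(1 / 2)) := by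
                rw [← Real.exp_add]; norm_num
            _ ≤ _ := by gcongr
        calc _ ≤ ((2 + Real.exp C) * (K * ‖scaledLine h v‖ ^ θ.α) + ‖scaledLine h v‖ ^ 2 / 2) /
              ‖scaledLine h v‖ := by gcongr
          _ = (2 + Real.exp C) * K * ‖scaledLine h v‖ ^ (θ.α - 1) + ‖scaledLine h v‖ / 2 := by
              rw [Real.rpow_sub_one hz0.ne']
              field_simp
          _ ≤ (2 + Real.exp C) * K * (|v| ^ (θ.α - 1) + 2) + 1 * (|v| ^ (θ.α - 1) + 2) := by
              gcongr
              linarith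
          _ = ((2 + Real.exp C) * K + 1) * (|v| ^ (θ.α - 1) + 2) * 1 := by ring
          _ ≤ ((2 + Real.exp C) * K + 1) * (|v| ^ (θ.α - 1) + 2) * (Real.exp (1 / 2) * E v) := by
              gcongr
          _ = (((2 + Real.exp C) * K + 1) * Real.exp (1 / 2)) * ((|v| ^ (θ.α - 1) + 2) * E v) := by
              ring
          _ ≤ _ := by
              gcongr
              linarith
      · have h2 : ‖Complex.exp (((h ^ θ.α : ℝ) : ℂ) * θ.jumpCumulant (v / h)) -
            (gaussFactor (1 * h) (v / h) : ℝ)‖ ≤ (Real.exp C + 1) * E v := by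
          refine (norm_sub_le _ _).trans ?_
          rw [Complex.norm_real, Real.norm_of_nonneg hg0.le, Complex.norm_exp]
          have h3 := Real.exp_le_exp.2 hre
          rw [Real.exp_add] at h3
          have h4 : θ.p / 2 * |v| ^ θ.α = -(-θ.p / 2) * |v| ^ θ.α := by ring
          rw [h4] at h3
          have := Real.exp_pos (-(-θ.p / 2) * |v| ^ θ.α)
          have := Real.exp_pos (-(1 / 2) * v ^ 2)
          rw [one_pow] at hg
          simp only [hE]
          nlinarith
        calc _ ≤ (Real.exp C + 1) * E v / 1 := by gcongr; linarith
          _ = (Real.exp C + 1) * (1 * E v) := by ring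
          _ ≤ (((2 + Real.exp C) * K + 1) * Real.exp (1 / 2) + Real.exp C + 1) *
              ((|v| ^ (θ.α - 1) + 2) * E v) := by
            have : 0 ≤ ((2 + Real.exp C) * K + 1) * Real.exp (1 / 2) := by positivity
            gcongr <;> linarith
    · filter_upwards [ae_ne_zero] with v hv
      have hg := (Complex.continuous_ofReal.tendsto _).comp (tendsto_gaussFactor_scaled 1 v)
      rw [one_pow] at hg
      exact (((Complex.continuous_exp.tendsto _).comp (tendsto_scaled_jumpCumulant_stable hθ
        hγ hv)).sub hg).div (tendsto_scaledLine v) (by simpa using hv)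
  refine key.congr' ?_
  filter_upwards [self_mem_nhdsWithin] with h hh
  have hh0 : (0 : ℝ) < h := hh
  have hh1 : (h : ℂ) ≠ 0 := Complex.ofReal_ne_zero.2 hh0.ne'
  symm
  rw [integral_eq_inv_smul_comp_div hh0, ← integral_const_mul]
  congr 1
  ext v
  rw [scaledLine_eq hh0.ne', one_mul, inv_mul_eq_div, div_div, mul_comm (h : ℂ)]

end Stable

end TSParams

lemma tendsto_exp_mul_sub_one_div {ι : Type*} {l : Filter ι} {ε : ι → ℝ} {y : ι → ℂ} {Λ : ℂ}
    (hε : Tendsto ε l (𝓝 0)) (hε0 : ∀ᶠ i in l, 0 < ε i) (hy : Tendsto y l (𝓝 Λ)) :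
    Tendsto (fun i => (Complex.exp (ε i * y i) - 1) / (ε i : ℂ)) l (𝓝 Λ) := by
  have h1 : Tendsto (fun i => ε i * (‖y i‖ ^ 2 * Real.exp (ε i * ‖y i‖))) l (𝓝 0) := by
    have := hε.mul ((hy.norm.pow 2).mul
      ((Real.continuous_exp.tendsto _).comp (hε.mul hy.norm)))
    simpa using this
  have h2 : Tendsto (fun i => (Complex.exp (ε i * y i) - 1) / (ε i : ℂ) - y i) l (𝓝 0) := by
    refine squeeze_zero_norm' ?_ h1
    filter_upwards [hε0] with i hi
    have hi' : (ε i : ℂ) ≠ 0 := Complex.ofReal_ne_zero.2 hi.ne'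
    have e : (Complex.exp (ε i * y i) - 1) / (ε i : ℂ) - y i =
        (Complex.exp (ε i * y i) - 1 - ε i * y i) / (ε i : ℂ) := by field_simp
    rw [e, norm_div, Complex.norm_real, Real.norm_of_nonneg hi.le, div_le_iff₀ hi]
    refine (norm_exp_sub_one_sub_le _).trans ?_
    rw [norm_mul, Complex.norm_real, Real.norm_of_nonneg hi.le]
    apply le_of_eq
    ring
  simpa using h2.add hy

namespace TSParams

variable {θ : TSParams}

/-! #### The Gaussian regime -/

/-- Here `h = √τ`. The Gaussian factor survives the scaling, while `h² jumpCumulant (v/h)` is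
`h^{2-β}` times a convergent quantity, so the exponential linearises. The weight `ω` is the rescaled
kernel, of order `-m` with `m = 0, 1, 2` for density, digital and call; `β - m > -1` is
integrability at zero. -/
theorem tendsto_gauss_integral (hθ : θ.Admissible) {σ β m : ℝ} (hσ : 0 < σ) (hβ2 : β < 2)
    (hm1 : -1 < β - m) (hm2 : 0 ≤ m) {K : ℝ} (hK0 : 0 ≤ K)
    (hK : ∀ u : ℝ, ‖θ.jumpCumulant u‖ ≤ K * ‖Complex.I * u + 1 / 2‖ ^ β) {Λ : ℝ → ℂ}
    (hΛ : ∀ v : ℝ, v ≠ 0 → Tendsto (fun h : ℝ => ((h ^ β : ℝ) : ℂ) * θ.jumpCumulant (v / h))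
      (𝓝[>] 0) (𝓝 (Λ v))) {ω : ℝ → ℝ → ℂ} {ω₀ : ℝ → ℂ} (hωm : ∀ h, Measurable (ω h))
    (hω : ∀ h v, v ≠ 0 → ‖ω h v‖ ≤ ‖scaledLine h v‖ ^ (-m))
    (hω₀ : ∀ v, v ≠ 0 → Tendsto (fun h => ω h v) (𝓝[>] 0) (𝓝 (ω₀ v))) :
    Tendsto (fun h : ℝ => ∫ v : ℝ, (gaussFactor (σ * h) (v / h) : ℂ) *
        ((Complex.exp (((h ^ 2 : ℝ) : ℂ) * θ.jumpCumulant (v / h)) - 1) / ((h ^ (2 - β) : ℝ) : ℂ) *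
          ω h v)) (𝓝[>] 0)
      (𝓝 (∫ v : ℝ, (Real.exp (-(σ ^ 2 / 2) * v ^ 2) : ℂ) * (Λ v * ω₀ v))) := by
  obtain ⟨C, hC0, hC⟩ := exists_re_jumpCumulant_le hθ
  have hp := p_nonpos hθ
  have hE := Real.exp_pos C
  refine tendsto_integral_filter_of_dominated_convergence
    (fun v => ((2 + Real.exp C) * K) * ((|v| ^ (β - m) + (|v| + 1) ^ 2) *
      Real.exp (-(σ ^ 2 / 2) * v ^ 2))) ?_ ?_ ?_ ?_
  · refine Eventually.of_forall fun h => Measurable.aestronglyMeasurable ?_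
    refine Measurable.mul ?_ (((aestronglyMeasurable_scaled hθ _ h).sub_const 1).div_const _ |>.mul
      (hωm h))
    unfold gaussFactor
    fun_prop
  · filter_upwards [eventually_pos_le_one] with h hh
    filter_upwards [ae_ne_zero] with v hv
    have hv' : 0 < |v| := abs_pos.2 hv
    have hz0 : 0 < ‖scaledLine h v‖ := hv'.trans_le (abs_le_norm_scaledLine h v)
    have hhp : 0 < h ^ (2 - β) := Real.rpow_pos_of_pos hh.1 _
    have hhp' : 0 < h ^ β := Real.rpow_pos_of_pos hh.1 _
    have hsq : h ^ 2 = h ^ (2 - β) * h ^ β := by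
      rw [← Real.rpow_add hh.1, sub_add_cancel, Real.rpow_two]
    have hre : (((h ^ 2 : ℝ) : ℂ) * θ.jumpCumulant (v / h)).re ≤ C := by
      rw [Complex.re_ofReal_mul]
      have h1 : (θ.jumpCumulant (v / h)).re ≤ C := (hC _).trans (by
        nlinarith [Real.rpow_nonneg (abs_nonneg (v / h)) θ.α])
      have h2 : h ^ 2 ≤ 1 := pow_le_one₀ hh.1.le hh.2
      nlinarith [sq_nonneg h]
    have h1 := norm_exp_sub_one_le_of_re_le hre
    rw [norm_mul, Complex.norm_real, Real.norm_of_nonneg (by positivity), hsq, mul_assoc] at h1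
    have h2 := norm_scaled_jumpCumulant_le hK hh.1 v
    have h3 : ‖(Complex.exp (((h ^ 2 : ℝ) : ℂ) * θ.jumpCumulant (v / h)) - 1) /
        ((h ^ (2 - β) : ℝ) : ℂ)‖ ≤ (2 + Real.exp C) * (K * ‖scaledLine h v‖ ^ β) := by
      rw [norm_div, Complex.norm_real, Real.norm_of_nonneg hhp.le, div_le_iff₀ hhp, hsq]
      refine h1.trans ?_
      have := mul_le_mul_of_nonneg_left h2 (by positivity : 0 ≤ (2 + Real.exp C) * h ^ (2 - β))
      nlinarith
    have h4 : ‖scaledLine h v‖ ^ β * ‖scaledLine h v‖ ^ (-m) ≤ |v| ^ (β - m) + (|v| + 1) ^ 2 := by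
      rw [← Real.rpow_add hz0, ← sub_eq_add_neg]
      exact norm_scaledLine_rpow_le hh.1 hh.2 (by linarith) hv
    rw [norm_mul, norm_mul, Complex.norm_real, Real.norm_of_nonneg (gaussFactor_pos _ _).le]
    calc _ ≤ Real.exp (-(σ ^ 2 / 2) * v ^ 2) * (((2 + Real.exp C) * (K * ‖scaledLine h v‖ ^ β)) *
          ‖scaledLine h v‖ ^ (-m)) := by
          have := gaussFactor_scaled_le hh.1.ne' σ v
          have := hω h v hv
          gcongr
      _ = ((2 + Real.exp C) * K) * ((‖scaledLine h v‖ ^ β * ‖scaledLine h v‖ ^ (-m)) *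
          Real.exp (-(σ ^ 2 / 2) * v ^ 2)) := by ring
      _ ≤ _ := by gcongr
  · have hσ2 : 0 < σ ^ 2 / 2 := by positivity
    have i1 := integrable_abs_rpow_mul_exp_neg_mul_sq hm1 hσ2
    have i2 := (integrable_abs_rpow_mul_exp_neg_mul_sq (s := 2) (by norm_num) hσ2)
    have i3 := (integrable_abs_rpow_mul_exp_neg_mul_sq (s := 1) (by norm_num) hσ2).const_mul 2
    have i4 := integrable_exp_neg_mul_sq hσ2
    refine ((((i1.add i2).add i3).add i4).congr (Eventually.of_forall fun v => ?_)).const_mul _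
    simp only [Pi.add_apply, Real.rpow_one, Real.rpow_two]
    ring
  · filter_upwards [ae_ne_zero] with v hv
    have hε : Tendsto (fun h : ℝ => h ^ (2 - β)) (𝓝[>] 0) (𝓝 0) :=
      tendsto_rpow_zero_of_pos (by linarith)
    have h1 := tendsto_exp_mul_sub_one_div hε (by
      filter_upwards [self_mem_nhdsWithin] with h hh using Real.rpow_pos_of_pos hh _) (hΛ v hv)
    have hg := (Complex.continuous_ofReal.tendsto _).comp (tendsto_gaussFactor_scaled σ v)
    refine (hg.mul (h1.mul (hω₀ v hv))).congr' ?_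
    filter_upwards [self_mem_nhdsWithin] with h hh
    have hsq : h ^ 2 = h ^ (2 - β) * h ^ β := by
      rw [← Real.rpow_add hh, sub_add_cancel, Real.rpow_two]
    rw [hsq]
    push_cast
    rw [mul_assoc]
    rfl

section Gauss

variable {σ β K : ℝ} {Λ : ℝ → ℂ}

theorem tendsto_gauss_density (hθ : θ.Admissible) (hσ : 0 < σ) (hβ2 : β < 2) (hβ0 : 0 < β)
    (hK0 : 0 ≤ K) (hK : ∀ u : ℝ, ‖θ.jumpCumulant u‖ ≤ K * ‖Complex.I * u + 1 / 2‖ ^ β)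
    (hΛ : ∀ v : ℝ, v ≠ 0 → Tendsto (fun h : ℝ => ((h ^ β : ℝ) : ℂ) * θ.jumpCumulant (v / h))
      (𝓝[>] 0) (𝓝 (Λ v))) :
    Tendsto (fun h : ℝ => ((h ^ (β - 1) : ℝ) : ℂ) * ∫ u : ℝ, (gaussFactor (σ * h) u : ℂ) *
        (Complex.exp (((h ^ 2 : ℝ) : ℂ) * θ.jumpCumulant u) - 1)) (𝓝[>] 0)
      (𝓝 (∫ v : ℝ, (Real.exp (-(σ ^ 2 / 2) * v ^ 2) : ℂ) * Λ v)) := by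
  have key := tendsto_gauss_integral hθ hσ hβ2 (m := 0) (by linarith) le_rfl hK0 hK hΛ
    (ω := fun _ _ => 1) (ω₀ := fun _ => 1) (fun _ => measurable_const) (by simp)
    (fun v _ => tendsto_const_nhds)
  simp only [mul_one] at key
  refine key.congr' ?_
  filter_upwards [self_mem_nhdsWithin] with h hh
  have hh0 : (0 : ℝ) < h := hh
  have hh1 : (h : ℂ) ≠ 0 := Complex.ofReal_ne_zero.2 hh0.ne'
  symm
  rw [integral_eq_inv_smul_comp_div hh0, ← mul_assoc, ← integral_const_mul]
  congr 1
  ext v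
  have e : h ^ (2 - β) * h ^ (β - 1) = h := by
    rw [← Real.rpow_add hh0]; norm_num
  have e' : ((h ^ (2 - β) : ℝ) : ℂ) * ((h ^ (β - 1) : ℝ) : ℂ) = h := by exact_mod_cast e
  have e2 : ((h ^ (β - 1) : ℝ) : ℂ) * (h : ℂ)⁻¹ = ((h ^ (2 - β) : ℝ) : ℂ)⁻¹ := by
    refine eq_inv_of_mul_eq_one_left ?_
    rw [mul_right_comm, mul_comm ((h ^ (β - 1) : ℝ) : ℂ), e', mul_inv_cancel₀ hh1]
  rw [e2]
  ring

theorem tendsto_gauss_prob (hθ : θ.Admissible) (hσ : 0 < σ) (hβ2 : β < 2) (hβ0 : 0 < β)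
    (hK0 : 0 ≤ K) (hK : ∀ u : ℝ, ‖θ.jumpCumulant u‖ ≤ K * ‖Complex.I * u + 1 / 2‖ ^ β)
    (hΛ : ∀ v : ℝ, v ≠ 0 → Tendsto (fun h : ℝ => ((h ^ β : ℝ) : ℂ) * θ.jumpCumulant (v / h))
      (𝓝[>] 0) (𝓝 (Λ v))) :
    Tendsto (fun h : ℝ => ((h ^ (β - 2) : ℝ) : ℂ) * ∫ u : ℝ, (gaussFactor (σ * h) u : ℂ) *
        (Complex.exp (((h ^ 2 : ℝ) : ℂ) * θ.jumpCumulant u) - 1) / (Complex.I * u + 1 / 2))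
      (𝓝[>] 0)
      (𝓝 (∫ v : ℝ, (Real.exp (-(σ ^ 2 / 2) * v ^ 2) : ℂ) * (Λ v * (Complex.I * v)⁻¹))) := by
  have key := tendsto_gauss_integral hθ hσ hβ2 (m := 1) (by linarith) zero_le_one hK0 hK hΛ
    (ω := fun h v => (scaledLine h v)⁻¹) (ω₀ := fun v => (Complex.I * v)⁻¹)
    (fun h => by unfold scaledLine; fun_prop)
    (fun h v hv => by rw [norm_inv, Real.rpow_neg_one])
    (fun v hv => (tendsto_scaledLine v).inv₀ (by simpa using hv))
  refine key.congr' ?_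
  filter_upwards [self_mem_nhdsWithin] with h hh
  have hh0 : (0 : ℝ) < h := hh
  have hh1 : (h : ℂ) ≠ 0 := Complex.ofReal_ne_zero.2 hh0.ne'
  symm
  rw [integral_eq_inv_smul_comp_div hh0, ← mul_assoc, ← integral_const_mul]
  congr 1
  ext v
  have e2 : ((h ^ (β - 2) : ℝ) : ℂ) = ((h ^ (2 - β) : ℝ) : ℂ)⁻¹ := by
    rw [← Complex.ofReal_inv, ← Real.rpow_neg hh0.le, neg_sub]
  rw [e2, scaledLine_eq hh0.ne', mul_inv]
  ring

theorem tendsto_gauss_price (hθ : θ.Admissible) (hσ : 0 < σ) (hβ2 : β < 2) (hβ1 : 1 < β)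
    (hK0 : 0 ≤ K) (hK : ∀ u : ℝ, ‖θ.jumpCumulant u‖ ≤ K * ‖Complex.I * u + 1 / 2‖ ^ β)
    (hΛ : ∀ v : ℝ, v ≠ 0 → Tendsto (fun h : ℝ => ((h ^ β : ℝ) : ℂ) * θ.jumpCumulant (v / h))
      (𝓝[>] 0) (𝓝 (Λ v))) :
    Tendsto (fun h : ℝ => ((h ^ (β - 3) : ℝ) : ℂ) * ∫ u : ℝ, (gaussFactor (σ * h) u : ℂ) *
        (Complex.exp (((h ^ 2 : ℝ) : ℂ) * θ.jumpCumulant u) - 1) / ((u : ℂ) ^ 2 + 1 / 4))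
      (𝓝[>] 0)
      (𝓝 (∫ v : ℝ, (Real.exp (-(σ ^ 2 / 2) * v ^ 2) : ℂ) * (Λ v * ((v : ℂ) ^ 2)⁻¹))) := by
  have key := tendsto_gauss_integral hθ hσ hβ2 (m := 2) (by linarith) two_pos.le hK0 hK hΛ
    (ω := fun h v => (((v ^ 2 + h ^ 2 / 4 : ℝ) : ℂ))⁻¹) (ω₀ := fun v => ((v : ℂ) ^ 2)⁻¹)
    (fun h => by fun_prop)
    (fun h v hv => by
      rw [norm_inv, Complex.norm_real, Real.norm_of_nonneg (by positivity), ← normSq_scaledLine,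
        Real.rpow_neg (norm_nonneg _), Real.rpow_two])
    (fun v hv => by
      refine Tendsto.inv₀ ?_ (by simpa using hv)
      refine tendsto_nhdsWithin_of_tendsto_nhds ?_
      have : Continuous fun h : ℝ => ((v ^ 2 + h ^ 2 / 4 : ℝ) : ℂ) := by fun_prop
      simpa using this.tendsto 0)
  refine key.congr' ?_
  filter_upwards [self_mem_nhdsWithin] with h hh
  have hh0 : (0 : ℝ) < h := hh
  have hh1 : (h : ℂ) ≠ 0 := Complex.ofReal_ne_zero.2 hh0.ne'
  symm
  rw [integral_eq_inv_smul_comp_div hh0, ← mul_assoc, ← integral_const_mul]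
  congr 1
  ext v
  have hne : ((h ^ (2 - β) : ℝ) : ℂ) ≠ 0 :=
    Complex.ofReal_ne_zero.2 (Real.rpow_pos_of_pos hh0 _).ne'
  have e2 : ((h ^ (β - 3) : ℝ) : ℂ) = ((h ^ (2 - β) : ℝ) : ℂ)⁻¹ * (h : ℂ)⁻¹ := by
    rw [← Complex.ofReal_inv, ← Complex.ofReal_inv, ← Complex.ofReal_mul, ← Real.rpow_neg hh0.le,
      ← Real.rpow_neg_one, ← Real.rpow_add hh0]
    ring_nf
  have e : (((v / h : ℝ) : ℂ) ^ 2 + 1 / 4) = ((v ^ 2 + h ^ 2 / 4 : ℝ) : ℂ) / h ^ 2 := by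
    push_cast
    field_simp
  rw [e2, e]
  field_simp

end Gauss

/-! #### At-the-money prices in the finite variation case -/

/-- The cumulant function of the jumps without the oscillating part of the drift. -/
noncomputable def residualCumulant (θ : TSParams) (u : ℝ) : ℂ :=
  θ.γ / 2 + θ.δ + θ.upsilonTilde u

lemma jumpCumulant_eq_residual (u : ℝ) :
    θ.jumpCumulant u = Complex.I * (θ.γ * u : ℝ) + θ.residualCumulant u := by
  rw [jumpCumulant, residualCumulant]
  push_cast
  ring

lemma exists_norm_residualCumulant_le (hθ : θ.Admissible) : ∃ C, 0 ≤ C ∧ ∀ u : ℝ,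
    ‖θ.residualCumulant u‖ ≤ C * ‖Complex.I * u + 1 / 2‖ ^ θ.α := by
  obtain ⟨C, hC, h⟩ := exists_norm_upsilonTilde_le hθ
  refine ⟨‖(θ.γ / 2 + θ.δ : ℂ)‖ * 2 ^ (θ.α - 0) + C, by positivity, fun u => ?_⟩
  have := rpow_le_of_half_le (half_le_norm_half_line u) hθ.α_pos.le
  rw [Real.rpow_zero] at this
  rw [residualCumulant, add_mul, mul_assoc]
  exact (norm_add_le _ _).trans (add_le_add (le_mul_of_one_le_right (norm_nonneg _) this) (h u))

lemma norm_half_line_rpow_le {s : ℝ} (hs : s ≤ 0) (hs2 : -2 ≤ s) (u : ℝ) :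
    ‖Complex.I * u + 1 / 2‖ ^ s ≤ 4 * powMajorant 0 s |u| := by
  have hz := half_le_norm_half_line u
  rw [powMajorant]
  split_ifs with h
  · have h1 := Real.rpow_le_rpow_of_nonpos (by norm_num) hz hs
    have h2 : (1 / 2 : ℝ) ^ s ≤ (1 / 2 : ℝ) ^ (-2 : ℝ) :=
      Real.rpow_le_rpow_of_exponent_ge (by norm_num) (by norm_num) hs2
    have h3 : (1 / 2 : ℝ) ^ (-2 : ℝ) = 4 := by
      rw [Real.rpow_neg (by norm_num), Real.rpow_two]; norm_num
    rw [Real.rpow_zero]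
    linarith
  · push Not at h
    have h1 : |u| ≤ ‖Complex.I * u + 1 / 2‖ := by
      have := Complex.abs_im_le_norm (Complex.I * u + 1 / 2)
      simpa using this
    have h2 := Real.rpow_le_rpow_of_nonpos (by linarith) h1 hs
    have := Real.rpow_nonneg (abs_nonneg u) s
    linarith

lemma integrable_norm_half_line_rpow {s : ℝ} (hs : s < -1) (hs2 : -2 ≤ s) :
    Integrable fun u : ℝ => ‖Complex.I * u + 1 / 2‖ ^ s := by
  refine ((integrable_comp_abs (integrableOn_powMajorant (a := 0) (by norm_num) hs)).const_mul
    4).mono' ?_ (Eventually.of_forall fun u => ?_)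
  · exact Measurable.aestronglyMeasurable (by fun_prop)
  · rw [Real.norm_of_nonneg (by positivity)]
    exact norm_half_line_rpow_le (by linarith) hs2 u

/-- For `α < 1` the residual divided by `u² + 1/4` is integrable, so the limit is taken without
rescaling. The Gaussian and drift factors have modulus at most one and tend to `1`. -/
theorem tendsto_residual_price (hθ : θ.Admissible) (hα : θ.α < 1) (σ : ℝ) :
    Tendsto (fun τ : ℝ => ∫ u : ℝ, (gaussFactor (σ * √τ) u : ℂ) *
      (Complex.exp (Complex.I * (τ * (θ.γ * u) : ℝ)) *
        ((Complex.exp (τ * θ.residualCumulant u) - 1) / (τ : ℂ))) / ((u : ℂ) ^ 2 + 1 / 4))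
      (𝓝[>] 0) (𝓝 (∫ u : ℝ, θ.residualCumulant u / ((u : ℂ) ^ 2 + 1 / 4))) := by
  obtain ⟨K, hK0, hK⟩ := exists_norm_residualCumulant_le hθ
  obtain ⟨C, hC0, hC⟩ := exists_re_jumpCumulant_le hθ
  have hp := p_nonpos hθ
  have hα0 := hθ.α_pos
  have hRm : Measurable θ.residualCumulant := by
    have := (continuous_upsilonTilde hθ).measurable
    unfold residualCumulant
    exact this.const_add _
  refine tendsto_integral_filter_of_dominated_convergence
    (fun u => (2 + Real.exp C) * K * ‖Complex.I * u + 1 / 2‖ ^ (θ.α - 2)) ?_ ?_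
    ((integrable_norm_half_line_rpow (by linarith) (by linarith)).const_mul _) ?_
  · refine Eventually.of_forall fun τ => Measurable.aestronglyMeasurable ?_
    unfold gaussFactor
    fun_prop
  · filter_upwards [eventually_pos_le_one] with τ hτ
    refine Eventually.of_forall fun u => ?_
    have hz : 0 < ‖Complex.I * u + 1 / 2‖ := by linarith [half_le_norm_half_line u]
    have hre : ((τ : ℂ) * θ.residualCumulant u).re ≤ C := by
      rw [Complex.re_ofReal_mul]
      have h1 : (θ.residualCumulant u).re ≤ C := by
        have := hC u
        rw [jumpCumulant_eq_residual] at this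
        simp only [Complex.add_re, Complex.mul_re, Complex.I_re, Complex.ofReal_re, zero_mul,
          Complex.I_im, Complex.ofReal_im, mul_zero, sub_zero, zero_add] at this
        nlinarith [Real.rpow_nonneg (abs_nonneg u) θ.α]
      nlinarith [hτ.1, hτ.2]
    have h1 := norm_exp_sub_one_le_of_re_le hre
    rw [norm_mul, Complex.norm_real, Real.norm_of_nonneg hτ.1.le] at h1
    have h2 : ‖(Complex.exp (τ * θ.residualCumulant u) - 1) / (τ : ℂ)‖ ≤
        (2 + Real.exp C) * (K * ‖Complex.I * u + 1 / 2‖ ^ θ.α) := by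
      rw [norm_div, Complex.norm_real, Real.norm_of_nonneg hτ.1.le, div_le_iff₀ hτ.1]
      refine h1.trans ?_
      have := mul_le_mul_of_nonneg_left (hK u)
        (by have := hτ.1.le; positivity : 0 ≤ (2 + Real.exp C) * τ)
      nlinarith
    have h3 : ‖Complex.exp (Complex.I * (τ * (θ.γ * u) : ℝ))‖ = 1 := by
      rw [mul_comm]; exact Complex.norm_exp_ofReal_mul_I _
    rw [norm_div, norm_mul, norm_mul, h3, one_mul, norm_sq_add_quarter, Complex.norm_real,
      Real.norm_of_nonneg (gaussFactor_pos _ _).le, ← normSq_half_line, Real.rpow_sub hz,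
      Real.rpow_two, ← mul_div_assoc]
    have h4 := gaussFactor_le_one (σ * √τ) u
    refine div_le_div_of_nonneg_right ?_ (by positivity)
    calc _ ≤ 1 * ((2 + Real.exp C) * (K * ‖Complex.I * u + 1 / 2‖ ^ θ.α)) := by gcongr
      _ = _ := by ring
  · refine Eventually.of_forall fun u => ?_
    have hid : Tendsto (fun τ : ℝ => τ) (𝓝[>] 0) (𝓝 0) :=
      tendsto_nhdsWithin_of_tendsto_nhds tendsto_id
    have h1 := tendsto_exp_mul_sub_one_div hid self_mem_nhdsWithin
      (tendsto_const_nhds (x := θ.residualCumulant u))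
    have h2 : Tendsto (fun τ : ℝ => (gaussFactor (σ * √τ) u : ℂ)) (𝓝[>] 0) (𝓝 1) := by
      have hc : Continuous fun τ : ℝ => (gaussFactor (σ * √τ) u : ℂ) := by
        unfold gaussFactor; fun_prop
      have := tendsto_nhdsWithin_of_tendsto_nhds (s := Ioi 0) (hc.tendsto 0)
      simpa [gaussFactor] using this
    have h3 : Tendsto (fun τ : ℝ => Complex.exp (Complex.I * (τ * (θ.γ * u) : ℝ))) (𝓝[>] 0)
        (𝓝 1) := by
      have hc : Continuous fun τ : ℝ => Complex.exp (Complex.I * (τ * (θ.γ * u) : ℝ)) := by fun_prop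
      have := tendsto_nhdsWithin_of_tendsto_nhds (s := Ioi 0) (hc.tendsto 0)
      simpa using this
    have := (h2.mul (h3.mul h1)).div_const ((u : ℂ) ^ 2 + 1 / 4)
    simpa using this

lemma tendsto_sqrt_zero : Tendsto (fun τ : ℝ => √τ) (𝓝[>] 0) (𝓝 0) := by
  have := tendsto_nhdsWithin_of_tendsto_nhds (s := Ioi 0) (Real.continuous_sqrt.tendsto 0)
  rwa [Real.sqrt_zero] at this

/-- The integral equals `2π (e^{-τ|γ|/2} - 1)` by the Fourier transform of the kernel. The absolute
value is what turns `γ/2` into `min γ 0` in case (A). -/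
theorem tendsto_drift_price_of_eq_zero (γ : ℝ) :
    Tendsto (fun τ : ℝ => (∫ u : ℝ, (Complex.exp (Complex.I * (τ * (γ * u) : ℝ)) - 1) /
      ((u : ℂ) ^ 2 + 1 / 4)).re / τ) (𝓝[>] 0) (𝓝 (-Real.pi * |γ|)) := by
  have h1 : Tendsto (fun τ : ℝ => 2 * Real.pi * ((Real.exp (τ * (-(|γ| / 2))) - 1) / τ)) (𝓝[>] 0)
      (𝓝 (-Real.pi * |γ|)) := by
    have hd : HasDerivAt (fun τ : ℝ => Real.exp (τ * (-(|γ| / 2)))) (-(|γ| / 2)) 0 := by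
      have := ((hasDerivAt_id (0 : ℝ)).mul_const (-(|γ| / 2))).exp
      simpa using this
    have := (hd.tendsto_slope_zero_right).const_mul (2 * Real.pi)
    rw [show 2 * Real.pi * -(|γ| / 2) = -Real.pi * |γ| by ring] at this
    refine this.congr fun τ => ?_
    simp [div_eq_inv_mul]
  refine h1.congr' ?_
  filter_upwards [self_mem_nhdsWithin] with τ hτ
  have hτ0 : (0 : ℝ) < τ := hτ
  have hi : ∀ y : ℝ, Integrable fun u : ℝ =>
      Complex.exp (Complex.I * u * y) / ((u : ℂ) ^ 2 + 1 / 4) := fun y => by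
    refine integrable_inv_sq_add_quarter.mono' (Measurable.aestronglyMeasurable (by fun_prop))
      (Eventually.of_forall fun u => ?_)
    rw [norm_div, norm_sq_add_quarter, Complex.norm_exp]
    simp
  have e : ∀ u : ℝ, (Complex.exp (Complex.I * (τ * (γ * u) : ℝ)) - 1) / ((u : ℂ) ^ 2 + 1 / 4) =
      Complex.exp (Complex.I * u * (τ * γ : ℝ)) / ((u : ℂ) ^ 2 + 1 / 4) -
      Complex.exp (Complex.I * u * (0 : ℝ)) / ((u : ℂ) ^ 2 + 1 / 4) := fun u => by
    rw [← sub_div]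
    congr 2
    · congr 1
      push_cast
      ring
    · simp
  simp_rw [e]
  rw [integral_sub (hi _) (hi _), integral_cexp_mul_div_sq_add_quarter,
    integral_cexp_mul_div_sq_add_quarter, ← Complex.ofReal_sub, Complex.ofReal_re, abs_mul,
    abs_of_pos hτ0]
  simp
  ring_nf

/-- The real part involves `cos - 1`, at most `(τγu)²/2` in modulus; `u²` cancels against the
kernel, and the Gaussian mass is of order `1/(σ√τ)`. The whole is `O(τ^{3/2})`. -/
theorem tendsto_drift_price_of_pos (γ : ℝ) {σ : ℝ} (hσ : 0 < σ) :
    Tendsto (fun τ : ℝ => (∫ u : ℝ, (gaussFactor (σ * √τ) u : ℂ) *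
      (Complex.exp (Complex.I * (τ * (γ * u) : ℝ)) - 1) /
      ((u : ℂ) ^ 2 + 1 / 4)).re / τ) (𝓝[>] 0) (𝓝 0) := by
  have hlim : Tendsto (fun τ : ℝ => √τ * (γ ^ 2 / 2 * (2 * Real.pi / σ))) (𝓝[>] 0) (𝓝 0) := by
    simpa using tendsto_sqrt_zero.mul_const (γ ^ 2 / 2 * (2 * Real.pi / σ))
  refine squeeze_zero_norm' ?_ hlim
  filter_upwards [self_mem_nhdsWithin] with τ hτ
  have hτ0 : (0 : ℝ) < τ := hτ
  have hsτ : 0 < √τ := Real.sqrt_pos.2 hτ0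
  have hs : 0 < σ * √τ := by positivity
  set f : ℝ → ℂ := fun u => (gaussFactor (σ * √τ) u : ℂ) *
      (Complex.exp (Complex.I * (τ * (γ * u) : ℝ)) - 1) / ((u : ℂ) ^ 2 + 1 / 4) with hf
  have hfre : ∀ u, (f u).re = gaussFactor (σ * √τ) u * (Real.cos (τ * (γ * u)) - 1) /
      (u ^ 2 + 1 / 4) := fun u => by
    rw [hf]
    simp only
    rw [ofReal_sq_add_quarter, Complex.div_ofReal_re, Complex.re_ofReal_mul, Complex.sub_re,
      mul_comm Complex.I, Complex.exp_ofReal_mul_I_re, Complex.one_re]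
  have hfi : Integrable f := by
    refine ((integrable_gaussFactor_div (σ * √τ)).const_mul 2).mono'
      (Measurable.aestronglyMeasurable (by simp only [hf]; unfold gaussFactor; fun_prop))
      (Eventually.of_forall fun u => ?_)
    have h2 : ‖Complex.exp (Complex.I * (τ * (γ * u) : ℝ)) - 1‖ ≤ 2 := by
      refine (norm_sub_le _ _).trans ?_
      rw [mul_comm Complex.I, Complex.norm_exp_ofReal_mul_I]
      norm_num
    simp only [hf]
    rw [norm_div, norm_mul, norm_sq_add_quarter, Complex.norm_real,
      Real.norm_of_nonneg (gaussFactor_pos _ _).le, div_eq_mul_inv]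
    have := gaussFactor_pos (σ * √τ) u
    calc _ ≤ gaussFactor (σ * √τ) u * 2 * (u ^ 2 + 1 / 4)⁻¹ := by gcongr
      _ = _ := by ring
  have hre : (∫ u, f u).re = ∫ u, (f u).re := by
    have := Complex.reCLM.integral_comp_comm hfi
    simpa using this.symm
  have hb : ∀ u, ‖(f u).re‖ ≤ τ ^ 2 * γ ^ 2 / 2 * gaussFactor (σ * √τ) u := fun u => by
    have hg := gaussFactor_pos (σ * √τ) u
    have h1 := Real.one_sub_sq_div_two_le_cos (x := τ * (γ * u))
    have h2 := Real.cos_le_one (τ * (γ * u))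
    have hd : 0 < u ^ 2 + 1 / 4 := by positivity
    rw [hfre, norm_div, norm_mul, Real.norm_of_nonneg hg.le, Real.norm_of_nonneg hd.le,
      Real.norm_of_nonpos (by linarith), div_le_iff₀ hd]
    calc _ ≤ gaussFactor (σ * √τ) u * ((τ * (γ * u)) ^ 2 / 2) := by gcongr; linarith
      _ = τ ^ 2 * γ ^ 2 / 2 * gaussFactor (σ * √τ) u * u ^ 2 := by ring
      _ ≤ _ := by gcongr; linarith
  have hint : ‖∫ u, (f u).re‖ ≤ τ ^ 2 * γ ^ 2 / 2 * (2 * Real.pi *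
      (stdNormalPDF (σ * √τ / 2) / (σ * √τ))) := by
    refine (norm_integral_le_of_norm_le ((integrable_gaussFactor hs).const_mul _)
      (Eventually.of_forall hb)).trans ?_
    rw [integral_const_mul, integral_gaussFactor hs]
  have hφ : stdNormalPDF (σ * √τ / 2) ≤ 1 := by
    rw [stdNormalPDF]
    have h1 : Real.exp (-(σ * √τ / 2) ^ 2 / 2) ≤ 1 := by
      rw [Real.exp_le_one_iff]
      nlinarith [sq_nonneg (σ * √τ / 2)]
    have h2 : 1 ≤ √(2 * Real.pi) := by
      rw [Real.one_le_sqrt]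
      nlinarith [Real.pi_gt_three]
    have h3 : (√(2 * Real.pi))⁻¹ ≤ 1 := inv_le_one_of_one_le₀ h2
    have := Real.exp_pos (-(σ * √τ / 2) ^ 2 / 2)
    have : 0 ≤ (√(2 * Real.pi))⁻¹ := by positivity
    nlinarith
  rw [norm_div, Real.norm_of_nonneg hτ0.le, hre, div_le_iff₀ hτ0]
  refine hint.trans ?_
  have hπ := Real.pi_pos
  have hq : √τ * √τ = τ := Real.mul_self_sqrt hτ0.le
  calc _ ≤ τ ^ 2 * γ ^ 2 / 2 * (2 * Real.pi * (1 / (σ * √τ))) := by gcongr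
    _ = √τ * (γ ^ 2 / 2 * (2 * Real.pi / σ)) * τ := by
      rw [show τ ^ 2 = √τ * √τ * τ by rw [hq]; ring]
      field_simp

end TSParams

/-! ### Closed forms of Laplace-type and Gaussian integrals -/

lemma arg_eq_arctan_of_re_pos {w : ℂ} (hw : 0 < w.re) : w.arg = Real.arctan (w.im / w.re) := by
  have h : |w.arg| < Real.pi / 2 := Complex.abs_arg_lt_pi_div_two_iff.2 (Or.inl hw)
  rw [← Complex.tan_arg, Real.arctan_tan (abs_lt.1 h).1 (abs_lt.1 h).2]

lemma norm_exp_neg_mul_sub_one_le_two {w : ℂ} (hw : 0 < w.re) {x : ℝ} (hx : 0 < x) :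
    ‖Complex.exp (-(w * x)) - 1‖ ≤ 2 := by
  refine (norm_sub_le _ _).trans ?_
  rw [norm_exp_neg_mul_ofReal, norm_one]
  have : Real.exp (-(w.re * x)) ≤ 1 := Real.exp_le_one_iff.2 (by nlinarith)
  linarith

lemma norm_exp_neg_mul_sub_one_le {w : ℂ} (hw : 0 < w.re) {x : ℝ} (hx : 0 < x) :
    ‖Complex.exp (-(w * x)) - 1‖ ≤ 3 * ‖w‖ * x := by
  have h : (-(w * x)).re ≤ 0 := by
    rw [Complex.neg_re, Complex.re_mul_ofReal]
    nlinarith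
  have := norm_exp_sub_one_le_of_re_le h
  rw [Real.exp_zero, norm_neg, norm_mul, Complex.norm_real, Real.norm_of_nonneg hx.le] at this
  linarith

/-- Integration by parts: `x^{-β} (e^{-wx} - 1)` vanishes at both ends, which reduces the integral
to a Gamma integral with exponent `1 - β`. -/
theorem integral_cexp_sub_one_mul_rpow {β : ℝ} (h0 : 0 < β) (h1 : β < 1) {w : ℂ}
    (hw : 0 < w.re) :
    ∫ x in Ioi (0 : ℝ), ((x ^ (-β - 1) : ℝ) : ℂ) * (Complex.exp (-(w * x)) - 1) =
      Real.Gamma (-β) * w ^ (β : ℂ) := by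
  have hw0 : w ≠ 0 := fun h => by simp [h] at hw
  set F : ℝ → ℂ := fun x => ((x ^ (-β) : ℝ) : ℂ) * (Complex.exp (-(w * x)) - 1) with hF
  set A : ℝ → ℂ := fun x => ((x ^ (-β - 1) : ℝ) : ℂ) * (Complex.exp (-(w * x)) - 1) with hA
  set B : ℝ → ℂ := fun x => ((x ^ ((1 - β) - 1) : ℝ) : ℂ) * Complex.exp (-(w * x)) with hB
  have hAi : IntegrableOn A (Ioi 0) := by
    refine ((integrableOn_powMajorant (a := -β) (b := -β - 1) (by linarith)
      (by linarith)).const_mul (3 * ‖w‖ + 2)).mono'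
      (Measurable.aestronglyMeasurable (by simp only [hA]; fun_prop)) ?_
    filter_upwards [ae_restrict_mem measurableSet_Ioi] with x hx
    have hx0 : 0 < x := hx
    have hp := Real.rpow_nonneg hx0.le (-β - 1)
    have hp' := Real.rpow_nonneg hx0.le (-β)
    simp only [hA]
    rw [norm_mul, Complex.norm_real, Real.norm_of_nonneg hp, powMajorant]
    split_ifs with h
    · have h2 := norm_exp_neg_mul_sub_one_le hw hx0
      calc _ ≤ x ^ (-β - 1) * (3 * ‖w‖ * x) := by gcongr
        _ = 3 * ‖w‖ * x ^ (-β) := by rw [Real.rpow_sub_one hx0.ne']; field_simp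
        _ ≤ _ := by gcongr; linarith
    · have h2 := norm_exp_neg_mul_sub_one_le_two hw hx0
      have := norm_nonneg w
      nlinarith
  have hBi : IntegrableOn B (Ioi 0) := integrableOn_rpow_mul_cexp (by linarith) hw
  have hBv : ∫ x in Ioi (0 : ℝ), B x = Real.Gamma (1 - β) * w ^ (-((1 - β : ℝ) : ℂ)) :=
    integral_rpow_mul_cexp (by linarith) hw
  have hd : ∀ x ∈ Ioi (0 : ℝ), HasDerivAt F (-(β : ℂ) * A x - w * B x) x := fun x hx => by
    have hx0 : 0 < x := hx
    have d1 := (Real.hasDerivAt_rpow_const (p := -β) (Or.inl hx0.ne')).ofReal_comp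
    have d2 : HasDerivAt (fun x : ℝ => Complex.exp (-(w * x)) - 1)
        (Complex.exp (-(w * x)) * -w) x := by
      have := ((Complex.ofRealCLM.hasDerivAt (x := x)).const_mul w).neg.cexp.sub_const 1
      simpa using this
    refine (d1.mul d2).congr_deriv ?_
    simp only [hA, hB]
    rw [show (1 - β) - 1 = -β by ring]
    push_cast
    ring
  have hc : ContinuousWithinAt F (Ici 0) 0 := by
    have hF0 : F 0 = 0 := by simp [hF]
    rw [← continuousWithinAt_Ioi_iff_Ici, ContinuousWithinAt, hF0]
    have hl : Tendsto (fun x : ℝ => 3 * ‖w‖ * x ^ (1 - β)) (𝓝[>] 0) (𝓝 0) := by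
      simpa using (tendsto_rpow_zero_of_pos (s := 1 - β) (by linarith)).const_mul (3 * ‖w‖)
    refine squeeze_zero_norm' ?_ hl
    filter_upwards [self_mem_nhdsWithin] with x hx
    have hx0 : 0 < x := hx
    have hp' := Real.rpow_nonneg hx0.le (-β)
    simp only [hF]
    rw [norm_mul, Complex.norm_real, Real.norm_of_nonneg hp']
    have h2 := norm_exp_neg_mul_sub_one_le hw hx0
    calc _ ≤ x ^ (-β) * (3 * ‖w‖ * x) := by gcongr
      _ = 3 * ‖w‖ * (x ^ (-β) * x ^ (1 : ℝ)) := by rw [Real.rpow_one]; ring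
      _ = _ := by rw [← Real.rpow_add hx0]; ring_nf
  have hinf : Tendsto F atTop (𝓝 0) := by
    have hl : Tendsto (fun x : ℝ => x ^ (-β) * 2) atTop (𝓝 0) := by
      simpa using (tendsto_rpow_neg_atTop h0).mul_const 2
    refine squeeze_zero_norm' ?_ hl
    filter_upwards [eventually_gt_atTop 0] with x hx
    have hp' := Real.rpow_nonneg hx.le (-β)
    simp only [hF]
    rw [norm_mul, Complex.norm_real, Real.norm_of_nonneg hp']
    have h2 := norm_exp_neg_mul_sub_one_le_two hw hx
    gcongr
  have key := integral_Ioi_of_hasDerivAt_of_tendsto hc hd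
    ((hAi.const_mul (-(β : ℂ))).sub (hBi.const_mul w)) hinf
  rw [integral_sub (hAi.const_mul _) (hBi.const_mul _), integral_const_mul, integral_const_mul,
    hBv] at key
  have hF0 : F 0 = 0 := by simp [hF]
  have hβ : (β : ℂ) ≠ 0 := Complex.ofReal_ne_zero.2 h0.ne'
  have hG : Real.Gamma (1 - β) = -β * Real.Gamma (-β) := by
    rw [← Real.Gamma_add_one (by linarith : -β ≠ 0)]; ring_nf
  have hpow : w * w ^ (-((1 - β : ℝ) : ℂ)) = w ^ (β : ℂ) := by
    have := (Complex.cpow_add 1 (-((1 - β : ℝ) : ℂ)) hw0).symm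
    rw [Complex.cpow_one] at this
    rw [this]
    push_cast
    ring_nf
  rw [hF0, sub_zero, hG, mul_left_comm, hpow] at key
  push_cast at key
  refine mul_left_cancel₀ hβ ?_
  linear_combination -key

/-- Both sides vanish at `b = 0` and have the derivative `a / (a² + b²)`; differentiation in `b`
cancels the factor `1/x`. -/
theorem integral_exp_neg_mul_sin_div {a : ℝ} (ha : 0 < a) (b : ℝ) :
    ∫ x in Ioi (0 : ℝ), Real.exp (-(a * x)) * Real.sin (b * x) / x = Real.arctan (b / a) := by
  have hei : IntegrableOn (fun x : ℝ => Real.exp (-(a * x))) (Ioi 0) := by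
    simpa using integrableOn_rpow_mul_exp_neg (s := 0) (by norm_num) ha
  have hw : ∀ b : ℝ, 0 < ((a : ℂ) + Complex.I * b).re := fun b => by simpa using ha
  have hcos : ∀ b : ℝ, ∫ x in Ioi (0 : ℝ), Real.exp (-(a * x)) * Real.cos (b * x) =
      a / (a ^ 2 + b ^ 2) := fun b => by
    have hi := integrableOn_rpow_mul_cexp (s := (1 : ℝ) - 1) (by norm_num) (hw b)
    have h1 := integral_rpow_mul_cexp one_pos (hw b)
    have h2 := Complex.reCLM.integral_comp_comm hi
    rw [h1] at h2
    have e : ∀ x : ℝ, Complex.reCLM (((x ^ ((1 : ℝ) - 1) : ℝ) : ℂ) *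
        Complex.exp (-((a + Complex.I * b) * x))) = Real.exp (-(a * x)) * Real.cos (b * x) :=
      fun x => by
        simp [Complex.exp_re]
    simp_rw [e] at h2
    rw [h2]
    simp [Complex.cpow_neg_one, Complex.inv_re, Complex.normSq_apply]
    ring
  have hder : ∀ b : ℝ, HasDerivAt
      (fun b => ∫ x in Ioi (0 : ℝ), Real.exp (-(a * x)) * Real.sin (b * x) / x)
      (a / (a ^ 2 + b ^ 2)) b := fun b => by
    rw [← hcos b]
    refine (hasDerivAt_integral_of_dominated_loc_of_deriv_le (s := univ)
      (bound := fun x => Real.exp (-(a * x)))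
      (F' := fun b x => Real.exp (-(a * x)) * Real.cos (b * x)) univ_mem
      (Eventually.of_forall fun b => Measurable.aestronglyMeasurable (by fun_prop)) ?_
      (Measurable.aestronglyMeasurable (by fun_prop)) ?_ hei ?_).2
    · refine (hei.const_mul |b|).mono' (Measurable.aestronglyMeasurable (by fun_prop)) ?_
      filter_upwards [ae_restrict_mem measurableSet_Ioi] with x hx
      have hx0 : 0 < x := hx
      rw [norm_div, norm_mul, Real.norm_of_nonneg hx0.le, Real.norm_of_nonneg (Real.exp_pos _).le,
        div_le_iff₀ hx0, Real.norm_eq_abs]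
      have := Real.abs_sin_le_abs (x := b * x)
      rw [abs_mul, abs_of_pos hx0] at this
      have hE := Real.exp_pos (-(a * x))
      nlinarith
    · refine Eventually.of_forall fun x b _ => ?_
      rw [norm_mul, Real.norm_of_nonneg (Real.exp_pos _).le]
      exact mul_le_of_le_one_right (Real.exp_pos _).le (Real.abs_cos_le_one _)
    · filter_upwards [ae_restrict_mem measurableSet_Ioi] with x hx b _
      have hx0 : x ≠ 0 := (mem_Ioi.1 hx).ne'
      have := (((hasDerivAt_id b).mul_const x).sin.const_mul (Real.exp (-(a * x)))).div_const x
      refine this.congr_deriv ?_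
      simp
      field_simp
  have hder2 : ∀ b : ℝ, HasDerivAt (fun b => Real.arctan (b / a)) (a / (a ^ 2 + b ^ 2)) b :=
    fun b => by
      refine (((hasDerivAt_id b).div_const a).arctan).congr_deriv ?_
      simp
      field_simp
  have hD : ∀ b, HasDerivAt (fun b => (∫ x in Ioi (0 : ℝ),
      Real.exp (-(a * x)) * Real.sin (b * x) / x) - Real.arctan (b / a)) 0 b := fun b => by
    have := (hder b).fun_sub (hder2 b)
    rwa [sub_self] at this
  have := is_const_of_deriv_eq_zero (fun b => (hD b).differentiableAt) (fun b => (hD b).deriv) b 0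
  simp only [zero_mul, Real.sin_zero, mul_zero, zero_div, integral_zero, Real.arctan_zero,
    sub_zero] at this
  linarith

/-- Only the half-line matters for the real part of the integral of a Hermitian function. -/
lemma re_integral_of_hermitian {f : ℝ → ℂ} (hf : ∀ v, 0 < v → f (-v) = starRingEnd ℂ (f v)) :
    (∫ v, f v).re = 2 * (∫ v in Ioi (0 : ℝ), f v).re := by
  by_cases hi : IntegrableOn f (Ioi 0)
  · have hc : IntegrableOn (fun v => starRingEnd ℂ (f v)) (Ioi 0) :=
      (Complex.conjCLE : ℂ →L[ℝ] ℂ).integrable_comp hi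
    rw [integral_eq_integral_Ioi_add_neg hi hc (fun _ _ => rfl) hf, integral_conj, Complex.add_re,
      Complex.conj_re]
    ring
  -- Without integrability on the half-line both integrals take the default value `0`.
  · have hi' : ¬ Integrable f := fun h => hi h.integrableOn
    rw [integral_undef hi', integral_undef hi]
    simp

lemma re_integral_Ioi {f : ℝ → ℂ} (hf : IntegrableOn f (Ioi 0)) :
    (∫ v in Ioi (0 : ℝ), f v).re = ∫ v in Ioi (0 : ℝ), (f v).re :=
  (Complex.reCLM.integral_comp_comm hf).symm

section PowerSubstitution

variable {α : ℝ} {w : ℂ}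

theorem integral_cexp_neg_mul_rpow (hα : 0 < α) (hw : 0 < w.re) :
    ∫ v in Ioi (0 : ℝ), Complex.exp (-(w * (v ^ α : ℝ))) =
      Real.Gamma (1 + 1 / α) * w ^ ((-(1 / α) : ℝ) : ℂ) := by
  have ha : 0 < 1 / α := by positivity
  rw [← integral_comp_rpow_Ioi _ ha.ne', abs_of_pos ha]
  have h1 := integral_rpow_mul_cexp ha hw
  rw [add_comm, Real.Gamma_add_one ha.ne', Complex.ofReal_mul, mul_assoc, Complex.ofReal_neg, ← h1,
    ← integral_const_mul]
  refine setIntegral_congr_fun measurableSet_Ioi fun x hx => ?_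
  have hx0 : 0 < x := hx
  rw [← Real.rpow_mul hx0.le, one_div_mul_cancel hα.ne', Real.rpow_one, Complex.real_smul]
  push_cast
  ring

/-- The substitution `v = x^{1/α}` turns this into `integral_cexp_sub_one_mul_rpow` with `β = 1/α`,
which lies below `1` exactly when `α > 1`. -/
theorem integral_cexp_neg_mul_rpow_sub_one_div_sq (hα : 1 < α) (hw : 0 < w.re) :
    ∫ v in Ioi (0 : ℝ), (Complex.exp (-(w * (v ^ α : ℝ))) - 1) / (v : ℂ) ^ 2 =
      -(Real.Gamma (1 - 1 / α) * w ^ ((1 / α : ℝ) : ℂ)) := by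
  have hα0 : 0 < α := by linarith
  have ha : 0 < 1 / α := by positivity
  have ha1 : 1 / α < 1 := by rw [div_lt_one hα0]; exact hα
  rw [← integral_comp_rpow_Ioi _ ha.ne', abs_of_pos ha]
  have h1 := integral_cexp_sub_one_mul_rpow ha ha1 hw
  have hG : Real.Gamma (1 - 1 / α) = -(1 / α) * Real.Gamma (-(1 / α)) := by
    rw [← Real.Gamma_add_one (by linarith : -(1 / α) ≠ 0)]; ring_nf
  rw [hG, Complex.ofReal_mul, mul_assoc, ← h1, ← integral_const_mul, ← integral_neg]
  refine setIntegral_congr_fun measurableSet_Ioi fun x hx => ?_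
  have hx0 : 0 < x := hx
  have hxa := (Real.rpow_pos_of_pos hx0 (1 / α)).ne'
  have hxc : ((x ^ (1 / α) : ℝ) : ℂ) ≠ 0 := Complex.ofReal_ne_zero.2 hxa
  have hxx : (x : ℂ) ≠ 0 := Complex.ofReal_ne_zero.2 hx0.ne'
  rw [← Real.rpow_mul hx0.le, one_div_mul_cancel hα0.ne', Real.rpow_one, Complex.real_smul,
    Real.rpow_sub_one hx0.ne', Real.rpow_sub_one hx0.ne', Real.rpow_neg hx0.le]
  push_cast
  rw [← Complex.ofReal_one, ← Complex.ofReal_div]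
  field_simp

/-- The measure `dv/v` only acquires the factor `1/α` under `v = x^{1/α}`, leaving the arctangent
integral. -/
theorem integral_im_cexp_neg_mul_rpow_div (hα : 0 < α) (hw : 0 < w.re) :
    ∫ v in Ioi (0 : ℝ), (Complex.exp (-(w * (v ^ α : ℝ)))).im / v =
      -(1 / α) * Real.arctan (w.im / w.re) := by
  have ha : 0 < 1 / α := by positivity
  rw [← integral_comp_rpow_Ioi _ ha.ne', abs_of_pos ha, ← integral_exp_neg_mul_sin_div hw,
    ← integral_const_mul]
  refine setIntegral_congr_fun measurableSet_Ioi fun x hx => ?_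
  have hx0 : 0 < x := hx
  have hxa := (Real.rpow_pos_of_pos hx0 (1 / α)).ne'
  rw [← Real.rpow_mul hx0.le, one_div_mul_cancel hα.ne', Real.rpow_one, Complex.exp_im,
    Complex.neg_re, Complex.neg_im, Complex.re_mul_ofReal, Complex.im_mul_ofReal, Real.sin_neg,
    Real.rpow_sub_one hx0.ne', smul_eq_mul]
  field_simp

end PowerSubstitution

lemma two_mul_integral_rpow_mul_gaussian {s σ : ℝ} (hs : -1 < s) (hσ : 0 < σ) :
    2 * ∫ v in Ioi (0 : ℝ), v ^ s * Real.exp (-(σ ^ 2 / 2) * v ^ 2) =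
      2 ^ ((s + 1) / 2) * σ ^ (-(s + 1)) * Real.Gamma ((s + 1) / 2) := by
  have h := integral_rpow_mul_exp_neg_mul_rpow (p := 2) (q := s) (b := σ ^ 2 / 2) two_pos hs
    (by positivity)
  simp_rw [Real.rpow_two] at h
  rw [h, Real.div_rpow (by positivity) two_pos.le, ← Real.rpow_two, ← Real.rpow_mul hσ.le,
    show (2 : ℝ) * (-(s + 1) / 2) = -(s + 1) by ring, show -(s + 1) / 2 = -((s + 1) / 2) by ring,
    Real.rpow_neg two_pos.le]
  have := (Real.rpow_pos_of_pos two_pos ((s + 1) / 2)).ne'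
  field_simp

lemma re_integral_gaussian_of_hermitian {s σ : ℝ} (hs : -1 < s) (hσ : 0 < σ) {f : ℝ → ℂ} {c : ℂ}
    (hf : ∀ v, 0 < v → f (-v) = starRingEnd ℂ (f v))
    (hc : ∀ v, 0 < v → f v = ((v ^ s : ℝ) : ℂ) * c) :
    (∫ v : ℝ, (Real.exp (-(σ ^ 2 / 2) * v ^ 2) : ℂ) * f v).re =
      2 ^ ((s + 1) / 2) * σ ^ (-(s + 1)) * Real.Gamma ((s + 1) / 2) * c.re := by
  rw [re_integral_of_hermitian fun v hv => by
      rw [hf v hv, map_mul, Complex.conj_ofReal, neg_sq],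
    ← two_mul_integral_rpow_mul_gaussian hs hσ, mul_assoc]
  congr 1
  rw [← Complex.re_ofReal_mul, ← integral_complex_ofReal, ← integral_mul_const]
  congr 1
  refine setIntegral_congr_fun measurableSet_Ioi fun v hv => ?_
  rw [hc v hv]
  push_cast
  ring

namespace TSParams

variable {θ : TSParams}

/-! #### Explicit limits -/

lemma stableExponent_neg {v : ℝ} (hv : 0 < v) :
    θ.stableExponent (-v) = starRingEnd ℂ (θ.stableExponent v) := by
  rw [stableExponent_of_neg (neg_lt_zero.2 hv), stableExponent_of_pos hv, abs_neg, abs_of_pos hv]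
  simp
  ring_nf
  simp

lemma stableExponent_eq_neg_mul {v : ℝ} (hv : 0 < v) :
    θ.stableExponent v = -(((-θ.p : ℝ) - Complex.I * θ.q) * (v ^ θ.α : ℝ)) := by
  rw [stableExponent_of_pos hv]
  push_cast
  ring

/-- The number `-p - iq` lies in the right half-plane, with modulus `r` and argument the negative of
`angle`; the cosine is even. -/
lemma re_stable_cpow (hp : θ.p < 0) (a : ℝ) :
    (((-θ.p : ℝ) - Complex.I * θ.q : ℂ) ^ (a : ℂ)).re = θ.r ^ a * Real.cos (a * θ.angle) := by
  rw [Complex.cpow_ofReal_re, arg_eq_arctan_of_re_pos (by simpa using hp)]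
  congr 1
  · congr 1
    rw [Complex.norm_def, Complex.normSq_apply, r]
    congr 1
    simp
    ring
  · rw [angle, mul_comm a, ← Real.cos_neg, ← neg_mul, ← Real.arctan_neg]
    congr 2
    simp [neg_div, div_neg]

theorem re_integral_stable_density (hθ : θ.Admissible) (hp : θ.p < 0) :
    (∫ v : ℝ, Complex.exp (θ.stableExponent v)).re = 2 * Real.pi * θ.CN_B := by
  have hw : 0 < ((-θ.p : ℝ) - Complex.I * θ.q : ℂ).re := by simpa using hp
  rw [re_integral_of_hermitian fun v hv => by rw [stableExponent_neg hv, Complex.exp_conj],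
    setIntegral_congr_fun measurableSet_Ioi fun v hv => by rw [stableExponent_eq_neg_mul hv],
    integral_cexp_neg_mul_rpow hθ.α_pos hw, Complex.re_ofReal_mul, re_stable_cpow hp, CN_B, α',
    neg_mul, Real.cos_neg]
  field_simp

theorem re_integral_stable_price (hα : 1 < θ.α) (hp : θ.p < 0) :
    (∫ v : ℝ, (Complex.exp (θ.stableExponent v) - 1) / (v : ℂ) ^ 2).re =
      -(2 * Real.pi * θ.CL_B) := by
  have hw : 0 < ((-θ.p : ℝ) - Complex.I * θ.q : ℂ).re := by simpa using hp
  rw [re_integral_of_hermitian fun v hv => by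
      rw [stableExponent_neg hv, Complex.exp_conj]; simp,
    setIntegral_congr_fun measurableSet_Ioi fun v hv => by rw [stableExponent_eq_neg_mul hv],
    integral_cexp_neg_mul_rpow_sub_one_div_sq hα hw, Complex.neg_re, Complex.re_ofReal_mul,
    re_stable_cpow hp, CL_B, α']
  field_simp

lemma integrableOn_stable_prob (hθ : θ.Admissible) (hp : θ.p < 0) :
    IntegrableOn (fun v : ℝ => (Complex.exp (θ.stableExponent v) -
      Real.exp (-(1 / 2) * v ^ 2)) / (Complex.I * v)) (Ioi 0) := by
  have hα := hθ.α_pos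
  have hw : 0 < ((-θ.p : ℝ) - Complex.I * θ.q : ℂ).re := by simpa using hp
  set w : ℂ := (-θ.p : ℝ) - Complex.I * θ.q with hwd
  have hm := integrableOn_powMajorant (a := θ.α - 1) (b := -2) (by linarith) (by norm_num)
  have hm1 := integrableOn_powMajorant (a := 1) (b := -2) (by norm_num) (by norm_num)
  have hE := (integrable_exp_neg_mul_abs_rpow hα (b := -θ.p) (by linarith)).integrableOn
    (s := Ioi (0 : ℝ))
  have hG := (integrable_exp_neg_mul_sq (b := 1 / 2) (by norm_num)).integrableOn
    (s := Ioi (0 : ℝ))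
  refine IntegrableOn.congr_fun (f := fun v : ℝ => (Complex.exp (-(w * (v ^ θ.α : ℝ))) -
    Real.exp (-(1 / 2) * v ^ 2)) / (Complex.I * v)) ?_
    (fun v hv => by rw [stableExponent_eq_neg_mul hv]) measurableSet_Ioi
  refine (((hm.const_mul (3 * ‖w‖)).add hm1).add (hE.add hG)).mono'
    (Measurable.aestronglyMeasurable (by fun_prop)) ?_
  filter_upwards [ae_restrict_mem measurableSet_Ioi] with v hv
  have hv0 : 0 < v := hv
  have hva := Real.rpow_pos_of_pos hv0 θ.α
  have e1 := Real.exp_pos (-(-θ.p) * |v| ^ θ.α)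
  have e2 := Real.exp_pos (-(1 / 2) * v ^ 2)
  simp only [Pi.add_apply, powMajorant]
  rw [norm_div, norm_mul, Complex.norm_I, one_mul, Complex.norm_real, Real.norm_of_nonneg hv0.le,
    div_le_iff₀ hv0]
  split_ifs with h1
  · have h2 := norm_exp_neg_mul_sub_one_le hw hva
    have h3 : ‖(1 : ℂ) - (Real.exp (-(1 / 2) * v ^ 2) : ℝ)‖ ≤ v ^ 2 := by
      rw [← Complex.ofReal_one, ← Complex.ofReal_sub, Complex.norm_real, Real.norm_of_nonneg
        (sub_nonneg.2 (Real.exp_le_one_iff.2 (by nlinarith [sq_nonneg v])))]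
      nlinarith [Real.add_one_le_exp (-(1 / 2) * v ^ 2), sq_nonneg v]
    have h4 := (norm_add_le _ _).trans (add_le_add h2 h3)
    rw [sub_add_sub_cancel] at h4
    refine h4.trans ?_
    rw [Real.rpow_sub_one hv0.ne', Real.rpow_one]
    have : (3 * ‖w‖ * (v ^ θ.α / v) + v) * v = 3 * ‖w‖ * v ^ θ.α + v ^ 2 := by field_simp
    nlinarith
  · have h2 : ‖Complex.exp (-(w * (v ^ θ.α : ℝ))) - (Real.exp (-(1 / 2) * v ^ 2) : ℝ)‖ ≤
        Real.exp (-(-θ.p) * |v| ^ θ.α) + Real.exp (-(1 / 2) * v ^ 2) := by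
      refine (norm_sub_le _ _).trans ?_
      rw [norm_exp_neg_mul_ofReal, Complex.norm_real, Real.norm_of_nonneg e2.le, abs_of_pos hv0]
      have : w.re = -θ.p := by simp [hwd]
      rw [this]
      simp
    have h3 := Real.rpow_nonneg hv0.le (-2)
    have h4 : 0 ≤ 3 * ‖w‖ * v ^ (-2 : ℝ) + v ^ (-2 : ℝ) := by positivity
    push Not at h1
    nlinarith [mul_nonneg h4 hv0.le]

/-- Dividing by `iv` selects the imaginary part of the numerator, so the auxiliary real Gaussian
drops out and an arctangent integral remains. -/
theorem re_integral_stable_prob (hθ : θ.Admissible) (hp : θ.p < 0) :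
    (∫ v : ℝ, (Complex.exp (θ.stableExponent v) -
      Real.exp (-(1 / 2) * v ^ 2)) / (Complex.I * v)).re = -(2 * Real.pi * θ.CM_B) := by
  have hw : 0 < ((-θ.p : ℝ) - Complex.I * θ.q : ℂ).re := by simpa using hp
  have e : ∀ v ∈ Ioi (0 : ℝ), ((Complex.exp (θ.stableExponent v) -
      Real.exp (-(1 / 2) * v ^ 2)) / (Complex.I * v)).re =
      (Complex.exp (-(((-θ.p : ℝ) - Complex.I * θ.q) * (v ^ θ.α : ℝ)))).im / v := fun v hv => by
    rw [stableExponent_eq_neg_mul hv, mul_comm, ← div_div, Complex.div_I, mul_comm,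
      Complex.div_ofReal_re]
    simp [-Complex.ofReal_exp]
  rw [re_integral_of_hermitian fun v hv => by
      rw [stableExponent_neg hv, Complex.exp_conj, map_div₀, map_sub, map_mul, Complex.conj_I,
        Complex.conj_ofReal, Complex.conj_ofReal, neg_sq, Complex.ofReal_neg, neg_mul, mul_neg]
      ring_nf,
    re_integral_Ioi (integrableOn_stable_prob hθ hp),
    setIntegral_congr_fun measurableSet_Ioi e, integral_im_cexp_neg_mul_rpow_div hθ.α_pos hw,
    CM_B, α', angle]
  have h2 : ((-θ.p : ℝ) - Complex.I * θ.q : ℂ).im / ((-θ.p : ℝ) - Complex.I * θ.q : ℂ).re =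
      -(-θ.q / θ.p) := by simp [neg_div, div_neg]
  rw [h2, Real.arctan_neg]
  field_simp

theorem re_integral_gauss_density (hθ : θ.Admissible) (hσ : 0 < θ.σ) :
    (∫ v : ℝ, (Real.exp (-(θ.σ ^ 2 / 2) * v ^ 2) : ℂ) * θ.stableExponent v).re =
      2 * Real.pi * θ.CN_D := by
  rw [re_integral_gaussian_of_hermitian (s := θ.α) (by linarith [hθ.α_pos]) hσ
    (fun v hv => stableExponent_neg hv) (fun v hv => stableExponent_of_pos hv), CN_D]
  have h : (2 : ℝ) ^ ((θ.α + 1) / 2) = 2 * 2 ^ ((θ.α - 1) / 2) := by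
    rw [← Real.rpow_one_add' two_pos.le (by linarith [hθ.α_pos])]; ring_nf
  rw [h]
  simp
  field_simp

theorem re_integral_gauss_prob (hθ : θ.Admissible) (hσ : 0 < θ.σ) :
    (∫ v : ℝ, (Real.exp (-(θ.σ ^ 2 / 2) * v ^ 2) : ℂ) *
      (θ.stableExponent v * (Complex.I * v)⁻¹)).re = -(2 * Real.pi * θ.CM_D) := by
  have hα := hθ.α_pos
  rw [re_integral_gaussian_of_hermitian (s := θ.α - 1) (c := (θ.p + Complex.I * θ.q) / Complex.I)
    (by linarith) hσ (fun v hv => by rw [stableExponent_neg hv]; simp)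
    (fun v hv => by
      rw [stableExponent_of_pos hv, Real.rpow_sub_one hv.ne']
      push_cast
      have : (v : ℂ) ≠ 0 := Complex.ofReal_ne_zero.2 hv.ne'
      field_simp), CM_D, sub_add_cancel]
  have h : (2 : ℝ) ^ (θ.α / 2) = 2 * 2 ^ ((θ.α - 2) / 2) := by
    rw [← Real.rpow_one_add' two_pos.le (by linarith)]; ring_nf
  rw [h]
  simp [Complex.div_I]
  field_simp

theorem re_integral_gauss_price (hα : 1 < θ.α) (hσ : 0 < θ.σ) :
    (∫ v : ℝ, (Real.exp (-(θ.σ ^ 2 / 2) * v ^ 2) : ℂ) *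
      (θ.stableExponent v * ((v : ℂ) ^ 2)⁻¹)).re = -(2 * Real.pi * θ.CL_D) := by
  rw [re_integral_gaussian_of_hermitian (s := θ.α - 2) (c := θ.p + Complex.I * θ.q)
    (by linarith) hσ (fun v hv => by rw [stableExponent_neg hv]; simp)
    (fun v hv => by
      rw [stableExponent_of_pos hv, Real.rpow_sub hv, Real.rpow_two]
      push_cast
      ring), CL_D, show θ.α - 2 + 1 = θ.α - 1 by ring]
  have h : (2 : ℝ) ^ ((θ.α - 1) / 2) = 2 * 2 ^ ((θ.α - 3) / 2) := by
    rw [← Real.rpow_one_add' two_pos.le (by linarith)]; ring_nf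
  rw [h]
  simp
  field_simp

theorem re_integral_drift_density (γ : ℝ) {σ : ℝ} (hσ : 0 < σ) :
    (∫ v : ℝ, (Real.exp (-(σ ^ 2 / 2) * v ^ 2) : ℂ) * (γ * (Complex.I * v))).re = 0 := by
  rw [re_integral_gaussian_of_hermitian (s := 1) (c := γ * Complex.I)
    (by norm_num) hσ (fun v hv => by simp) (fun v hv => by rw [Real.rpow_one]; ring)]
  simp

theorem re_integral_drift_prob (γ : ℝ) {σ : ℝ} (hσ : 0 < σ) :
    (∫ v : ℝ, (Real.exp (-(σ ^ 2 / 2) * v ^ 2) : ℂ) *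
      (γ * (Complex.I * v) * (Complex.I * v)⁻¹)).re = √(2 * Real.pi) * γ / σ := by
  rw [re_integral_gaussian_of_hermitian (s := 0) (c := γ)
    (by norm_num) hσ (fun v hv => by simp) (fun v hv => by
      have : (v : ℂ) ≠ 0 := Complex.ofReal_ne_zero.2 hv.ne'
      rw [mul_inv_cancel_right₀ (mul_ne_zero Complex.I_ne_zero this)]
      simp)]
  rw [zero_add, Real.Gamma_one_half_eq, ← Real.sqrt_eq_rpow, Real.rpow_neg_one,
    Real.sqrt_mul two_pos.le, Complex.ofReal_re]
  ring

lemma upsilonTilde_neg (hθ : θ.Admissible) (u : ℝ) :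
    θ.upsilonTilde (-u) = starRingEnd ℂ (θ.upsilonTilde u) := by
  have h1 : ((θ.κPos : ℂ) - (Complex.I * u + 1 / 2)).arg ≠ Real.pi := fun h =>
    (Complex.arg_eq_pi_iff.1 h).1.not_gt (re_sub_half_line_pos hθ u)
  have h2 : ((θ.κNeg : ℂ) + (Complex.I * u + 1 / 2)).arg ≠ Real.pi := fun h =>
    (Complex.arg_eq_pi_iff.1 h).1.not_gt (re_add_half_line_pos hθ u)
  rw [upsilonTilde, upsilonTilde, map_add, map_mul, map_mul, Complex.conj_ofReal,
    Complex.conj_ofReal, ← Complex.conj_ofReal θ.α, Complex.cpow_conj _ _ h1,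
    Complex.cpow_conj _ _ h2]
  simp [Complex.conj_ofNat]

lemma re_integral_upsilonTilde (hθ : θ.Admissible) :
    (∫ u : ℝ, θ.upsilonTilde u / ((u : ℂ) ^ 2 + 1 / 4)).re = 2 * Real.pi * θ.ϱ := by
  rw [re_integral_of_hermitian fun u _ => by
      rw [upsilonTilde_neg hθ, ofReal_sq_add_quarter, ofReal_sq_add_quarter, map_div₀,
        Complex.conj_ofReal, neg_sq], ϱ]
  have := Real.pi_ne_zero
  rw [mul_assoc, ← mul_assoc Real.pi, mul_one_div_cancel this, one_mul]

theorem re_integral_residual (hθ : θ.Admissible) (hα : θ.α < 1) :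
    (∫ u : ℝ, θ.residualCumulant u / ((u : ℂ) ^ 2 + 1 / 4)).re =
      2 * Real.pi * (θ.γ / 2 + θ.δ + θ.ϱ) := by
  obtain ⟨C, hC0, hC⟩ := exists_norm_upsilonTilde_le hθ
  have h1 : Integrable fun u : ℝ => θ.upsilonTilde u / ((u : ℂ) ^ 2 + 1 / 4) := by
    have hm := (continuous_upsilonTilde hθ).measurable
    refine ((integrable_norm_half_line_rpow (s := θ.α - 2) (by linarith)
      (by linarith [hθ.α_pos])).const_mul C).mono'
      (Measurable.aestronglyMeasurable (by fun_prop)) (Eventually.of_forall fun u => ?_)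
    have hz : 0 < ‖Complex.I * u + 1 / 2‖ := by linarith [half_le_norm_half_line u]
    rw [norm_div, norm_sq_add_quarter, ← normSq_half_line, Real.rpow_sub hz, Real.rpow_two,
      ← mul_div_assoc]
    gcongr
    exact hC u
  have h2 : Integrable fun u : ℝ => (((θ.γ / 2 + θ.δ) * (u ^ 2 + 1 / 4)⁻¹ : ℝ) : ℂ) :=
    (integrable_inv_sq_add_quarter.const_mul _).ofReal
  have e : ∀ u : ℝ, θ.residualCumulant u / ((u : ℂ) ^ 2 + 1 / 4) =
      (((θ.γ / 2 + θ.δ) * (u ^ 2 + 1 / 4)⁻¹ : ℝ) : ℂ) +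
      θ.upsilonTilde u / ((u : ℂ) ^ 2 + 1 / 4) := fun u => by
    rw [residualCumulant]
    push_cast
    ring
  simp_rw [e]
  rw [integral_add h2 h1, Complex.add_re, re_integral_upsilonTilde hθ, integral_complex_ofReal,
    Complex.ofReal_re, integral_const_mul, integral_inv_sq_add_quarter]
  ring

end TSParams

/-! ### From at-the-money prices to the smile -/

lemma hasLeadingTerm_of_tendsto {f : ℝ → ℝ} {c e : ℝ}
    (h : Tendsto (fun τ => f τ / τ ^ e) (𝓝[>] 0) (𝓝 c)) : HasLeadingTerm f c e := by
  have hpos : ∀ᶠ τ : ℝ in 𝓝[>] 0, τ ^ e ≠ 0 := by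
    filter_upwards [self_mem_nhdsWithin] with τ hτ using (Real.rpow_pos_of_pos hτ e).ne'
  refine isLittleO_of_tendsto' (hpos.mono fun τ hτ h => absurd h hτ) ?_
  have := h.sub_const c
  rw [sub_self] at this
  refine this.congr' ?_
  filter_upwards [hpos] with τ hτ
  field_simp

/-- The relations between the at-the-money price `C`, digital price `A` and density `D`, the total
implied standard deviation `s` and its strike derivative `χ`, and the smile coefficients. -/
structure SmileRelations (C A D s χ χ₀ χ₁ χ₂ : ℝ → ℝ) : Prop where
  pos : ∀ τ, 0 < τ → 0 < s τ
  price : ∀ τ, 0 < τ → atmPrice (s τ) = C τ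
  slope : ∀ τ, 0 < τ → χ τ = ((1 - C τ) / 2 - A τ) / stdNormalPDF (s τ / 2)
  coeff_zero : ∀ τ, 0 < τ → χ₀ τ = s τ / √τ
  coeff_one : ∀ τ, 0 < τ → χ₁ τ = χ τ / √τ
  coeff_two : ∀ τ, 0 < τ →
    χ₂ τ = (D τ / stdNormalPDF (s τ / 2) - 1 / s τ + s τ / 4 * χ τ ^ 2) / √τ

lemma stdNormalPDF_zero : stdNormalPDF 0 = (√(2 * Real.pi))⁻¹ := by
  simp [stdNormalPDF]

lemma hasStrictDerivAt_atmPrice_zero : HasStrictDerivAt atmPrice (stdNormalPDF 0) 0 := by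
  have h : ContinuousAt (fun s => stdNormalPDF (s / 2)) 0 := by
    have : Continuous stdNormalPDF := contDiff_stdNormalPDF (n := 0).continuous
    fun_prop
  have := hasStrictDerivAt_of_hasDerivAt_of_continuousAt
    (Eventually.of_forall hasDerivAt_atmPrice) h
  rwa [zero_div] at this

namespace SmileRelations

variable {C A D s χ χ₀ χ₁ χ₂ : ℝ → ℝ} {σ e m L M N : ℝ}

lemma eventually_pos : ∀ᶠ τ : ℝ in 𝓝[>] 0, 0 < τ := self_mem_nhdsWithin

lemma tendsto_of_div_rpow {f : ℝ → ℝ} (he : 0 < e)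
    (h : Tendsto (fun τ => f τ / τ ^ e) (𝓝[>] 0) (𝓝 L)) : Tendsto f (𝓝[>] 0) (𝓝 0) := by
  have := h.mul (tendsto_rpow_zero_of_pos he)
  rw [mul_zero] at this
  refine this.congr' ?_
  filter_upwards [eventually_pos] with τ hτ
  exact div_mul_cancel₀ _ (Real.rpow_pos_of_pos hτ e).ne'

lemma tendsto_div_rpow_of_lt {f : ℝ → ℝ} {e' : ℝ} (he : e' < e)
    (h : Tendsto (fun τ => f τ / τ ^ e) (𝓝[>] 0) (𝓝 L)) :
    Tendsto (fun τ => f τ / τ ^ e') (𝓝[>] 0) (𝓝 0) := by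
  refine tendsto_of_div_rpow (sub_pos.2 he) (h.congr' ?_)
  filter_upwards [eventually_pos] with τ hτ
  rw [div_div, ← Real.rpow_add hτ]
  ring_nf

variable (S : SmileRelations C A D s χ χ₀ χ₁ χ₂)
include S

section Price

variable (he : 0 < e)
  (hC : Tendsto (fun τ => (C τ - atmPrice (σ * √τ)) / τ ^ e) (𝓝[>] 0) (𝓝 L))
include he hC

lemma tendsto_totalVol_zero : Tendsto s (𝓝[>] 0) (𝓝 0) := by
  have h0 : Tendsto (fun τ : ℝ => atmPrice (σ * √τ)) (𝓝[>] 0) (𝓝 0) := by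
    have := (continuous_atmPrice.tendsto _).comp (TSParams.tendsto_sqrt_zero.const_mul σ)
    rwa [mul_zero, atmPrice_zero] at this
  have hC0 : Tendsto C (𝓝[>] 0) (𝓝 0) := by
    simpa using (tendsto_of_div_rpow he hC).add h0
  refine tendsto_order.2 ⟨fun a ha => ?_, fun a ha => ?_⟩
  · filter_upwards [eventually_pos] with τ hτ using ha.trans (S.pos τ hτ)
  · have := strictMono_atmPrice ha
    rw [atmPrice_zero] at this
    filter_upwards [eventually_pos, hC0.eventually (gt_mem_nhds this)] with τ hτ h
    rw [← S.price τ hτ] at h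
    exact strictMono_atmPrice.lt_iff_lt.1 h

/-- Both `s` and `σ√τ` tend to `0`, and `atmPrice` is strictly differentiable there with slope
`1/√(2π)`. Hence a difference of prices is equivalent to that multiple of the difference of total
volatilities. -/
lemma tendsto_totalVol_sub :
    Tendsto (fun τ => (s τ - σ * √τ) / τ ^ e) (𝓝[>] 0) (𝓝 (√(2 * Real.pi) * L)) := by
  have hs0 := S.tendsto_totalVol_zero he hC
  have hσ0 : Tendsto (fun τ : ℝ => σ * √τ) (𝓝[>] 0) (𝓝 0) := by
    simpa using TSParams.tendsto_sqrt_zero.const_mul σ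
  have hφ : stdNormalPDF 0 ≠ 0 := (stdNormalPDF_pos 0).ne'
  have h1 : (fun τ => atmPrice (s τ) - atmPrice (σ * √τ) - (s τ - σ * √τ) • stdNormalPDF 0)
      =o[𝓝[>] 0] fun τ => s τ - σ * √τ :=
    (hasStrictDerivAt_atmPrice_zero.isLittleO).comp_tendsto
      (hs0.prodMk_nhds hσ0)
  have h2 : IsEquivalent (𝓝[>] 0) (fun τ => atmPrice (s τ) - atmPrice (σ * √τ))
      (fun τ => (s τ - σ * √τ) * stdNormalPDF 0) :=
    h1.trans_isBigO ((isBigO_refl _ _).const_mul_right (c := stdNormalPDF 0) hφ |>.congr_right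
      fun τ => mul_comm _ _)
  have h3 : Tendsto (fun τ => (s τ - σ * √τ) * stdNormalPDF 0 / τ ^ e) (𝓝[>] 0) (𝓝 L) := by
    refine (h2.symm.div IsEquivalent.refl).symm.tendsto_nhds (hC.congr' ?_)
    filter_upwards [eventually_pos] with τ hτ
    simp [S.price τ hτ]
  have h4 := h3.mul_const (√(2 * Real.pi))
  rw [mul_comm L] at h4
  refine h4.congr fun τ => ?_
  have : √(2 * Real.pi) ≠ 0 := by positivity
  rw [stdNormalPDF_zero]
  field_simp

theorem hasLeadingTerm_coeff_zero :
    HasLeadingTerm (fun τ => χ₀ τ - σ) (√(2 * Real.pi) * L) (e - 1 / 2) := by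
  refine hasLeadingTerm_of_tendsto ((S.tendsto_totalVol_sub he hC).congr' ?_)
  filter_upwards [eventually_pos] with τ hτ
  have hq : 0 < √τ := Real.sqrt_pos.2 hτ
  rw [S.coeff_zero τ hτ, Real.rpow_sub hτ, ← Real.sqrt_eq_rpow]
  have := Real.rpow_pos_of_pos hτ e
  field_simp

lemma tendsto_stdNormalPDF :
    Tendsto (fun τ => stdNormalPDF (s τ / 2)) (𝓝[>] 0) (𝓝 (√(2 * Real.pi))⁻¹) := by
  have : Continuous stdNormalPDF := contDiff_stdNormalPDF (n := 0).continuous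
  have h := (this.tendsto _).comp ((S.tendsto_totalVol_zero he hC).div_const 2)
  rwa [zero_div, stdNormalPDF_zero] at h

section Slope

variable (hme : m < e)
  (hA : Tendsto (fun τ => ((1 - atmPrice (σ * √τ)) / 2 - A τ) / τ ^ m) (𝓝[>] 0) (𝓝 M))
include hme hA

/-- The price enters the slope only through `C - atmPrice (σ√τ)`, of order `τ^e`, which is
negligible against `τ^m` since `m < e`. -/
lemma tendsto_slope : Tendsto (fun τ => χ τ / τ ^ m) (𝓝[>] 0) (𝓝 (√(2 * Real.pi) * M)) := by
  have h1 := (hA.sub ((tendsto_div_rpow_of_lt hme hC).div_const 2)).div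
    (S.tendsto_stdNormalPDF he hC) (by positivity)
  rw [zero_div, sub_zero, div_inv_eq_mul, mul_comm] at h1
  refine h1.congr' ?_
  filter_upwards [eventually_pos] with τ hτ
  have := (Real.rpow_pos_of_pos hτ m).ne'
  have := (stdNormalPDF_pos (s τ / 2)).ne'
  rw [S.slope τ hτ]
  simp only [Pi.div_apply]
  field_simp
  ring

theorem hasLeadingTerm_coeff_one :
    HasLeadingTerm χ₁ (√(2 * Real.pi) * M) (m - 1 / 2) := by
  refine hasLeadingTerm_of_tendsto ((S.tendsto_slope he hC hme hA).congr' ?_)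
  filter_upwards [eventually_pos] with τ hτ
  have hq : 0 < √τ := Real.sqrt_pos.2 hτ
  rw [S.coeff_one τ hτ, Real.rpow_sub hτ, ← Real.sqrt_eq_rpow]
  have := Real.rpow_pos_of_pos hτ m
  field_simp

end Slope

end Price

/-- The terms `D/φ` and `-1/s` are both of order `τ^{-e}` and contribute side by side, while `s
χ²/4` tends to zero. `L ≠ 0` is needed to invert `s`. -/
theorem hasLeadingTerm_coeff_two_of_stable (he : 0 < e) (hL : L ≠ 0)
    (hC : Tendsto (fun τ => C τ / τ ^ e) (𝓝[>] 0) (𝓝 L))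
    (hA : Tendsto (fun τ => 1 / 2 - A τ) (𝓝[>] 0) (𝓝 M))
    (hD : Tendsto (fun τ => τ ^ e * D τ) (𝓝[>] 0) (𝓝 N)) :
    HasLeadingTerm χ₂ (-(1 / (√(2 * Real.pi) * L)) + √(2 * Real.pi) * N) (-e - 1 / 2) := by
  have hC' : Tendsto (fun τ => (C τ - atmPrice (0 * √τ)) / τ ^ e) (𝓝[>] 0) (𝓝 L) := by
    simpa [atmPrice_zero] using hC
  have hA' : Tendsto (fun τ => ((1 - atmPrice (0 * √τ)) / 2 - A τ) / τ ^ (0 : ℝ)) (𝓝[>] 0)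
      (𝓝 M) := by
    simpa [atmPrice_zero] using hA
  have hφ := S.tendsto_stdNormalPDF he hC'
  have hs := S.tendsto_totalVol_sub he hC'
  have hs0 := S.tendsto_totalVol_zero he hC'
  have hχ := S.tendsto_slope he hC' he hA'
  have hq : √(2 * Real.pi) ≠ 0 := by positivity
  have h1 := ((hs.inv₀ (mul_ne_zero hq hL)).neg.add (hD.div hφ (inv_ne_zero hq))).add
    (((tendsto_rpow_zero_of_pos he).mul (hs0.div_const 4)).mul (hχ.pow 2))
  have e1 : -(√(2 * Real.pi) * L)⁻¹ + N / (√(2 * Real.pi))⁻¹ +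
      0 * (0 / 4) * (√(2 * Real.pi) * M) ^ 2 =
      -(1 / (√(2 * Real.pi) * L)) + √(2 * Real.pi) * N := by
    rw [div_inv_eq_mul, one_div]; ring
  rw [e1] at h1
  refine hasLeadingTerm_of_tendsto (h1.congr' ?_)
  filter_upwards [eventually_pos] with τ hτ
  have hq : 0 < √τ := Real.sqrt_pos.2 hτ
  have := (Real.rpow_pos_of_pos hτ e).ne'
  have := (stdNormalPDF_pos (s τ / 2)).ne'
  have := (S.pos τ hτ).ne'
  rw [S.coeff_two τ hτ, Real.rpow_sub hτ, ← Real.sqrt_eq_rpow, Real.rpow_neg hτ.le]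
  simp only [Pi.div_apply, zero_mul, sub_zero, Real.rpow_zero, div_one]
  field_simp
  ring

/-- Both `D/φ` and `1/s` are compared with `1/(σ√τ)`, which cancels. What remains is the density
correction `N` and `(s - σ√τ)/(s σ√τ)`, the source of `L/σ²`. -/
theorem hasLeadingTerm_coeff_two_of_gauss (he : 1 / 2 < e) (hσ : 0 < σ)
    (hC : Tendsto (fun τ => (C τ - atmPrice (σ * √τ)) / τ ^ e) (𝓝[>] 0) (𝓝 L))
    (hA : Tendsto (fun τ => ((1 - atmPrice (σ * √τ)) / 2 - A τ) / τ ^ (e - 1 / 2)) (𝓝[>] 0)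
      (𝓝 M))
    (hD : Tendsto (fun τ => (D τ - stdNormalPDF (σ * √τ / 2) / (σ * √τ)) / τ ^ (e - 1)) (𝓝[>] 0)
      (𝓝 N)) :
    HasLeadingTerm χ₂ (√(2 * Real.pi) * (L / σ ^ 2 + N)) (e - 1 - 1 / 2) := by
  have he0 : 0 < e := by linarith
  have hφ := S.tendsto_stdNormalPDF he0 hC
  have hs := S.tendsto_totalVol_sub he0 hC
  have hs0 := S.tendsto_totalVol_zero he0 hC
  have hχ := S.tendsto_slope he0 hC (by linarith) hA
  have hq : √(2 * Real.pi) ≠ 0 := by positivity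
  have hσ0 : Tendsto (fun τ : ℝ => σ * √τ) (𝓝[>] 0) (𝓝 0) := by
    simpa using TSParams.tendsto_sqrt_zero.const_mul σ
  have hr : Tendsto (fun τ => s τ / √τ) (𝓝[>] 0) (𝓝 σ) := by
    have h := (tendsto_div_rpow_of_lt he hs).add_const σ
    rw [zero_add] at h
    refine h.congr' ?_
    filter_upwards [eventually_pos] with τ hτ
    have hq : 0 < √τ := Real.sqrt_pos.2 hτ
    rw [← Real.sqrt_eq_rpow]
    field_simp
    ring
  -- Changing the point at which the density is evaluated costs `O(s - σ√τ) = O(τ^e)`, thus a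
  -- relative `O(√τ)` after division.
  have hψ : Tendsto (fun τ => (stdNormalPDF (σ * √τ / 2) - stdNormalPDF (s τ / 2)) /
      (σ * √τ) / τ ^ (e - 1)) (𝓝[>] 0) (𝓝 0) := by
    have hd : HasStrictDerivAt stdNormalPDF 0 0 := by
      have := hasStrictDerivAt_of_hasDerivAt_of_continuousAt (x := 0)
        (Eventually.of_forall hasDerivAt_stdNormalPDF) (by
          have : Continuous stdNormalPDF := contDiff_stdNormalPDF (n := 0).continuous
          fun_prop)
      simpa using this
    have h1 : (fun τ => stdNormalPDF (σ * √τ / 2) - stdNormalPDF (s τ / 2)) =O[𝓝[>] 0]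
        fun τ => s τ - σ * √τ := by
      have h := (hd.isBigO_sub).comp_tendsto
        ((by simpa using (hσ0.div_const 2).prodMk_nhds (hs0.div_const 2)) :
          Tendsto (fun τ => (σ * √τ / 2, s τ / 2)) (𝓝[>] 0) (𝓝 ((0 : ℝ), (0 : ℝ))))
      refine h.trans (IsBigO.of_bound 1 (Eventually.of_forall fun τ => ?_))
      simp only [Function.comp_apply]
      rw [← sub_div, norm_div, norm_sub_rev, one_mul]
      have : ‖(2 : ℝ)‖ = 2 := by norm_num
      rw [this]
      linarith [norm_nonneg (s τ - σ * √τ)]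
    obtain ⟨K, hK⟩ := h1.bound
    have h2 : Tendsto (fun τ => K / σ * (‖(s τ - σ * √τ) / τ ^ e‖ * √τ)) (𝓝[>] 0) (𝓝 0) := by
      simpa using (hs.norm.mul TSParams.tendsto_sqrt_zero).const_mul (K / σ)
    refine squeeze_zero_norm' ?_ h2
    filter_upwards [eventually_pos, hK] with τ hτ hb
    have hq : 0 < √τ := Real.sqrt_pos.2 hτ
    have hqq : √τ * √τ = τ := Real.mul_self_sqrt hτ.le
    have hte := Real.rpow_pos_of_pos hτ e
    rw [Real.rpow_sub_one hτ.ne', norm_div, norm_div, norm_div, norm_div,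
      Real.norm_of_nonneg hte.le, Real.norm_of_nonneg (by positivity : 0 ≤ σ * √τ),
      Real.norm_of_nonneg hτ.le]
    calc _ ≤ K * ‖s τ - σ * √τ‖ / (σ * √τ) / (τ ^ e / τ) := by gcongr
      _ = _ := by
        field_simp
        rw [Real.sq_sqrt hτ.le]
        ring
  have h1 := ((hD.add hψ).div hφ (inv_ne_zero hq)).add ((hs.div (hr.mul_const σ)
    (mul_ne_zero hσ.ne' hσ.ne')).add (((tendsto_rpow_zero_of_pos (s := e + 1 / 2)
      (by linarith)).mul (hr.div_const 4)).mul (hχ.pow 2)))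
  have e1 : (N + 0) / (√(2 * Real.pi))⁻¹ + (√(2 * Real.pi) * L / (σ * σ) +
      0 * (σ / 4) * (√(2 * Real.pi) * M) ^ 2) = √(2 * Real.pi) * (L / σ ^ 2 + N) := by
    rw [div_inv_eq_mul]; ring
  rw [e1] at h1
  refine hasLeadingTerm_of_tendsto (h1.congr' ?_)
  filter_upwards [eventually_pos] with τ hτ
  have hq : 0 < √τ := Real.sqrt_pos.2 hτ
  have hqq : √τ * √τ = τ := Real.mul_self_sqrt hτ.le
  have := (Real.rpow_pos_of_pos hτ e).ne'
  have := (stdNormalPDF_pos (s τ / 2)).ne'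
  have := (S.pos τ hτ).ne'
  have p1 : τ ^ (e - 1 - 1 / 2) = τ ^ e / τ / √τ := by
    rw [Real.rpow_sub hτ, Real.rpow_sub_one hτ.ne', Real.sqrt_eq_rpow]
  have p2 : τ ^ (e - 1 / 2) = τ ^ e / √τ := by rw [Real.rpow_sub hτ, Real.sqrt_eq_rpow]
  have p3 : τ ^ (e + 1 / 2) = τ ^ e * √τ := by rw [Real.rpow_add hτ, Real.sqrt_eq_rpow]
  rw [S.coeff_two τ hτ]
  simp only [Pi.div_apply]
  rw [p1, p2, p3, Real.rpow_sub_one hτ.ne']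
  -- With independent variables for the transcendental quantities and `τ = q²`, the identity becomes
  -- rational.
  generalize stdNormalPDF (s τ / 2) = φ at *
  generalize stdNormalPDF (σ * √τ / 2) = φ' at *
  generalize τ ^ e = E at *
  generalize s τ = t at *
  generalize D τ = d at *
  generalize χ τ = x at *
  generalize √τ = q at *
  subst hqq
  field_simp
  ring

end SmileRelations

/-! ### At-the-money prices of the tempered stable model -/

section Bounds

variable {Ω : Type*} [MeasurableSpace Ω] {P : Measure Ω} {Y : Ω → ℝ}

lemma integrable_call (hY : Measurable Y) (hexp : Integrable (fun ω => Real.exp (Y ω)) P) (k : ℝ) :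
    Integrable (fun ω => max (Real.exp (Y ω) - Real.exp k) 0) P := by
  refine hexp.mono' (Measurable.aestronglyMeasurable (by fun_prop)) (Eventually.of_forall fun ω => ?_)
  rw [Real.norm_of_nonneg (le_max_right _ _)]
  exact max_le (by linarith [Real.exp_pos k]) (Real.exp_pos _).le

lemma integral_call_lt_one [IsProbabilityMeasure P] (hY : Measurable Y) (hexp : Integrable (fun ω => Real.exp (Y ω)) P)
    (hone : ∫ ω, Real.exp (Y ω) ∂P = 1) : ∫ ω, max (Real.exp (Y ω) - Real.exp 0) 0 ∂P < 1 := by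
  have hc := integrable_call hY hexp 0
  rw [← hone, ← sub_pos, ← integral_sub hexp hc]
  have hp : ∀ ω, 0 < Real.exp (Y ω) - max (Real.exp (Y ω) - Real.exp 0) 0 := fun ω => by
    rw [Real.exp_zero, sub_pos, max_lt_iff]
    exact ⟨by linarith, Real.exp_pos _⟩
  refine (integral_nonneg fun ω => (hp ω).le).lt_of_ne fun h => ?_
  have h0 := (integral_eq_zero_iff_of_nonneg (fun ω => (hp ω).le) (hexp.sub hc)).1 h.symm
  obtain ⟨ω, hω⟩ := h0.exists
  exact (hp ω).ne' hω

/-- A zero price forces `e^Y ≤ 1` almost surely, and mean one then forces equality. -/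
lemma ae_eq_zero_of_integral_call_eq_zero [IsProbabilityMeasure P] (hY : Measurable Y)
    (hexp : Integrable (fun ω => Real.exp (Y ω)) P) (hone : ∫ ω, Real.exp (Y ω) ∂P = 1)
    (h : ∫ ω, max (Real.exp (Y ω) - Real.exp 0) 0 ∂P = 0) : ∀ᵐ ω ∂P, Y ω = 0 := by
  have h1 := (integral_eq_zero_iff_of_nonneg (fun ω => le_max_right _ _)
    (integrable_call hY hexp 0)).1 h
  have h2 : ∀ᵐ ω ∂P, 0 ≤ 1 - Real.exp (Y ω) := by
    filter_upwards [h1] with ω hω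
    have : Real.exp (Y ω) - Real.exp 0 ≤ 0 := (le_max_left _ _).trans_eq hω
    rw [Real.exp_zero] at this
    linarith
  have h3 : ∫ ω, (1 - Real.exp (Y ω)) ∂P = 0 := by
    rw [integral_sub (integrable_const 1) hexp, hone]
    simp
  filter_upwards [(integral_eq_zero_iff_of_nonneg_ae h2 ((integrable_const 1).sub hexp)).1 h3]
    with ω hω
  have : 1 - Real.exp (Y ω) = 0 := hω
  rw [← Real.exp_eq_one_iff]
  linarith

end Bounds

namespace TSParams

variable {θ : TSParams}

/-- The at-the-money call price. -/
noncomputable def atmCall (θ : TSParams) (τ : ℝ) : ℝ :=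
  1 - 1 / (2 * Real.pi) *
    (∫ u : ℝ, Complex.exp (τ * θ.cumulant u) / ((u : ℂ) ^ 2 + 1 / 4)).re

/-- The at-the-money digital price. -/
noncomputable def atmDigital (θ : TSParams) (τ : ℝ) : ℝ :=
  1 / (2 * Real.pi) * (∫ u : ℝ, Complex.exp (τ * θ.cumulant u) / (Complex.I * u + 1 / 2)).re

/-- The density of the log-price at the money. -/
noncomputable def atmDensity (θ : TSParams) (τ : ℝ) : ℝ :=
  1 / (2 * Real.pi) * (∫ u : ℝ, Complex.exp (τ * θ.cumulant u)).re

lemma re_inv_two_pi_mul (z : ℂ) :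
    (1 / (2 * Real.pi) * z : ℂ).re = 1 / (2 * Real.pi) * z.re := by
  rw [← Complex.re_ofReal_mul]
  push_cast
  rfl

theorem smile_of_triplet {Ω : Type*} [MeasurableSpace Ω] {P : Measure Ω}
    [IsProbabilityMeasure P] (hθ : θ.Admissible) {X : ℝ≥0 → Ω → ℝ} {b : ℝ}
    (hX : ∀ t, Measurable (X t)) (htriplet : HasLevyTriplet X P b θ.σ θ.levyMeasure)
    (hmart : ∀ t : ℝ≥0, ∫ ω, Real.exp (X t ω) ∂P = 1) {τ : ℝ} (hτ : 0 < τ) :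
    ((∀ᶠ k in 𝓝 (0 : ℝ), ∃! s, IsImpliedVol (callPrice X P) τ k s) ∧
      ContDiffAt ℝ 2 (fun k => impliedVol (callPrice X P) τ k) 0) ∧
    HasDerivAt (callPrice X P τ) (-θ.atmDigital τ) 0 ∧
    ∃ s χ : ℝ, 0 < s ∧ atmPrice s = θ.atmCall τ ∧ smileCoeff (callPrice X P) 0 τ = s / √τ ∧
      χ = ((1 - θ.atmCall τ) / 2 - θ.atmDigital τ) / stdNormalPDF (s / 2) ∧
      smileCoeff (callPrice X P) 1 τ = χ / √τ ∧
      smileCoeff (callPrice X P) 2 τ =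
        (θ.atmDensity τ / stdNormalPDF (s / 2) - 1 / s + s / 4 * χ ^ 2) / √τ := by
  set t : ℝ≥0 := τ.toNNReal with ht
  have htτ : (t : ℝ) = τ := Real.coe_toNNReal _ hτ.le
  have hexp : Integrable (fun ω => Real.exp (X t ω)) P :=
    Integrable.of_integral_ne_zero (by rw [hmart t]; exact one_ne_zero)
  set G : ℝ → ℂ := fun u => Complex.exp (τ * θ.cumulant u) with hGd
  have hGi : Integrable G := integrable_exp_cumulant hθ hτ
  have hG : ∀ u : ℝ, ∫ ω, Complex.exp ((Complex.I * u + 1 / 2) * X t ω) ∂P = G u := fun u => by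
    rw [integral_exp_half_add_eq hθ hX htriplet hmart t u, htτ]
  have hF := integral_call_eq_fourier (hX t) hexp (hmart t) hG
  have hC0 : callPrice X P τ 0 = θ.atmCall τ := by
    have h := congrArg Complex.re (hF 0)
    simp only [Complex.ofReal_zero, mul_zero, Complex.exp_zero, one_mul] at h
    rw [Complex.ofReal_re, Complex.sub_re, Complex.one_re, re_inv_two_pi_mul] at h
    exact h
  obtain ⟨C₁, C₂, h1, h2, h3, h4, h5⟩ := exists_deriv_of_fourier (C := callPrice X P τ) hGi hF
  rw [re_inv_two_pi_mul] at h4 h5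
  -- If the price vanished, `X(τ)` would be almost surely `0` and `G` identically `1`, contradicting
  -- its integrability on the line.
  have hpos : 0 < callPrice X P τ 0 := by
    refine (integral_nonneg fun ω => le_max_right _ _).lt_of_ne fun h => ?_
    have h0 := ae_eq_zero_of_integral_call_eq_zero (hX t) hexp (hmart t) h.symm
    have hG1 : G = fun _ => 1 := by
      ext u
      rw [← hG, integral_congr_ae (g := fun _ => (1 : ℂ)) (h0.mono fun ω hω => by simp [hω])]
      simp
    rw [hG1] at hGi
    rcases integrable_const_iff.1 hGi with h | h
    · exact one_ne_zero h
    · simpa using (isFiniteMeasure_iff _).1 h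
  have hlt : callPrice X P τ 0 < 1 := integral_call_lt_one (hX t) hexp (hmart t)
  obtain ⟨hE, s, χ, hs, hs0, hc0, hχ, hc1, hc2⟩ := smile_at_money hτ h1 h2 h3 hpos hlt
  have hd : C₁ 0 = -θ.atmDigital τ := h4
  refine ⟨hE, hd ▸ h1 0, s, χ, hs, hs0.trans hC0, hc0, ?_, hc1, ?_⟩
  · rw [hχ, stdNormalCDF_neg_half, hs0, hC0, hd, ← sub_eq_add_neg]
  · rw [hc2, h5]
    rfl

/-! #### Comparison with the Gaussian model -/

lemma integrable_div_half_line {f : ℝ → ℂ} (hf : Integrable f) :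
    Integrable fun u : ℝ => f u / (Complex.I * u + 1 / 2) := by
  refine (integrable_mul_of_norm_le hf (f := fun u : ℝ => (Complex.I * u + 1 / 2)⁻¹) (c := 2)
    (by fun_prop) fun u => ?_).congr (Eventually.of_forall fun u => (div_eq_inv_mul _ _).symm)
  rw [norm_inv, inv_le_comm₀ (by linarith [half_le_norm_half_line u]) two_pos]
  linarith [half_le_norm_half_line u]

lemma integrable_div_sq_add_quarter {f : ℝ → ℂ} (hf : Integrable f) :
    Integrable fun u : ℝ => f u / ((u : ℂ) ^ 2 + 1 / 4) := by
  refine (integrable_mul_of_norm_le hf (f := fun u : ℝ => ((u : ℂ) ^ 2 + 1 / 4)⁻¹) (c := 4)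
    (by fun_prop) fun u => ?_).congr (Eventually.of_forall fun u => (div_eq_inv_mul _ _).symm)
  rw [norm_inv, norm_sq_add_quarter, inv_le_comm₀ (by positivity) (by norm_num)]
  nlinarith [sq_nonneg u]

lemma re_integral_gaussFactor_div_half_line {s : ℝ} (hs : 0 < s) :
    (∫ u : ℝ, (gaussFactor s u : ℂ) / (Complex.I * u + 1 / 2)).re =
      Real.pi * (1 - atmPrice s) := by
  have hi := integrable_div_half_line (f := fun u => (gaussFactor s u : ℂ))
    (integrable_gaussFactor hs).ofReal
  have h := Complex.reCLM.integral_comp_comm hi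
  have e : ∀ u : ℝ, Complex.reCLM ((gaussFactor s u : ℂ) / (Complex.I * u + 1 / 2)) =
      1 / 2 * (gaussFactor s u * (u ^ 2 + 1 / 4)⁻¹) := fun u => by
    rw [Complex.reCLM_apply, div_eq_mul_inv, Complex.re_ofReal_mul, re_inv_half_line]
    ring
  simp_rw [e] at h
  rw [integral_const_mul, integral_gaussFactor_div hs.le, Complex.reCLM_apply] at h
  exact h.symm.trans (by ring)

lemma gaussFactor_mul_exp_sub_one {τ : ℝ} (hτ : 0 ≤ τ) (u : ℝ) :
    (gaussFactor (θ.σ * √τ) u : ℂ) * (Complex.exp (τ * θ.jumpCumulant u) - 1) =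
      Complex.exp (τ * θ.cumulant u) - gaussFactor (θ.σ * √τ) u := by
  rw [exp_cumulant_eq hτ]
  ring

lemma atmCall_sub (hθ : θ.Admissible) {τ : ℝ} (hτ : 0 < τ) :
    θ.atmCall τ - atmPrice (θ.σ * √τ) = -(1 / (2 * Real.pi)) *
      (∫ u : ℝ, (gaussFactor (θ.σ * √τ) u : ℂ) * (Complex.exp (τ * θ.jumpCumulant u) - 1) /
        ((u : ℂ) ^ 2 + 1 / 4)).re := by
  have hs : 0 ≤ θ.σ * √τ := mul_nonneg hθ.σ_nonneg (Real.sqrt_nonneg _)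
  have i1 := integrable_div_sq_add_quarter (integrable_exp_cumulant hθ hτ)
  have e : ∀ u : ℝ, ((gaussFactor (θ.σ * √τ) u * (u ^ 2 + 1 / 4)⁻¹ : ℝ) : ℂ) =
      (gaussFactor (θ.σ * √τ) u : ℂ) / ((u : ℂ) ^ 2 + 1 / 4) := fun u => by
    rw [ofReal_sq_add_quarter, ← Complex.ofReal_div, ← div_eq_mul_inv]
  have i2 : Integrable fun u : ℝ =>
      ((gaussFactor (θ.σ * √τ) u * (u ^ 2 + 1 / 4)⁻¹ : ℝ) : ℂ) :=
    (integrable_gaussFactor_div _).ofReal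
  have hv : (∫ u : ℝ, (gaussFactor (θ.σ * √τ) u : ℂ) / ((u : ℂ) ^ 2 + 1 / 4)).re =
      2 * Real.pi * (1 - atmPrice (θ.σ * √τ)) := by
    simp_rw [← e]
    rw [integral_complex_ofReal, Complex.ofReal_re, integral_gaussFactor_div hs]
  simp_rw [e] at i2
  simp_rw [gaussFactor_mul_exp_sub_one hτ.le, sub_div]
  rw [integral_sub i1 i2, Complex.sub_re, hv, atmCall]
  field_simp
  ring_nf

/-- The comparison scale `s` is left free: it is `σ√τ` when there is diffusion and `τ^{1/α}` in the
stable regime. -/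
lemma sub_atmDigital (hθ : θ.Admissible) {τ s : ℝ} (hτ : 0 < τ) (hs : 0 < s) :
    (1 - atmPrice s) / 2 - θ.atmDigital τ = -(1 / (2 * Real.pi)) *
      (∫ u : ℝ, (Complex.exp (τ * θ.cumulant u) - gaussFactor s u) /
        (Complex.I * u + 1 / 2)).re := by
  have i1 := integrable_div_half_line (integrable_exp_cumulant hθ hτ)
  have i2 := integrable_div_half_line (f := fun u => (gaussFactor s u : ℂ))
    (integrable_gaussFactor hs).ofReal
  simp_rw [sub_div]
  rw [integral_sub i1 i2, Complex.sub_re, re_integral_gaussFactor_div_half_line hs, atmDigital]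
  field_simp
  ring_nf

lemma atmDensity_sub (hθ : θ.Admissible) (hσ : 0 < θ.σ) {τ : ℝ} (hτ : 0 < τ) :
    θ.atmDensity τ - stdNormalPDF (θ.σ * √τ / 2) / (θ.σ * √τ) = 1 / (2 * Real.pi) *
      (∫ u : ℝ, (gaussFactor (θ.σ * √τ) u : ℂ) *
        (Complex.exp (τ * θ.jumpCumulant u) - 1)).re := by
  have hs : 0 < θ.σ * √τ := mul_pos hσ (Real.sqrt_pos.2 hτ)
  have i2 : Integrable fun u => (gaussFactor (θ.σ * √τ) u : ℂ) := (integrable_gaussFactor hs).ofReal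
  simp_rw [gaussFactor_mul_exp_sub_one hτ.le]
  rw [integral_sub (integrable_exp_cumulant hθ hτ) i2, Complex.sub_re, integral_complex_ofReal,
    Complex.ofReal_re, integral_gaussFactor hs, atmDensity]
  field_simp

end TSParams

lemma tendsto_rpow_nhdsGT_zero {a : ℝ} (ha : 0 < a) :
    Tendsto (fun τ : ℝ => τ ^ a) (𝓝[>] 0) (𝓝[>] 0) := by
  refine tendsto_nhdsWithin_iff.2 ⟨tendsto_rpow_zero_of_pos ha, ?_⟩
  filter_upwards [self_mem_nhdsWithin] with τ hτ using Real.rpow_pos_of_pos hτ a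

lemma tendsto_sqrt_nhdsGT_zero : Tendsto (fun τ : ℝ => √τ) (𝓝[>] 0) (𝓝[>] 0) := by
  simp_rw [Real.sqrt_eq_rpow]
  exact tendsto_rpow_nhdsGT_zero (by norm_num)

lemma sqrt_rpow {τ : ℝ} (hτ : 0 ≤ τ) (a : ℝ) : √τ ^ a = τ ^ (a / 2) := by
  rw [Real.sqrt_eq_rpow, ← Real.rpow_mul hτ]
  ring_nf

/-- Taking real parts in the limit of a rescaled integral. -/
lemma tendsto_re_comp {F : ℝ → ℂ} {c : ℂ} {h : ℝ → ℝ} (hF : Tendsto F (𝓝[>] 0) (𝓝 c))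
    (hh : Tendsto h (𝓝[>] 0) (𝓝[>] 0)) (a : ℝ) :
    Tendsto (fun τ => a * (F (h τ)).re) (𝓝[>] 0) (𝓝 (a * c.re)) :=
  (((Complex.continuous_re.tendsto _).comp hF).comp hh).const_mul a

/-! ### Small-time limits of at-the-money price, digital and density -/

namespace TSParams

variable {θ : TSParams}

section Gauss

variable {β K : ℝ} {Λ : ℝ → ℂ}

theorem tendsto_atmDensity_gauss (hθ : θ.Admissible) (hσ : 0 < θ.σ) (hβ2 : β < 2) (hβ0 : 0 < β)
    (hK0 : 0 ≤ K) (hK : ∀ u : ℝ, ‖θ.jumpCumulant u‖ ≤ K * ‖Complex.I * u + 1 / 2‖ ^ β)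
    (hΛ : ∀ v : ℝ, v ≠ 0 → Tendsto (fun h : ℝ => ((h ^ β : ℝ) : ℂ) * θ.jumpCumulant (v / h))
      (𝓝[>] 0) (𝓝 (Λ v))) :
    Tendsto (fun τ => (θ.atmDensity τ - stdNormalPDF (θ.σ * √τ / 2) / (θ.σ * √τ)) /
      τ ^ ((1 - β) / 2)) (𝓝[>] 0) (𝓝 (1 / (2 * Real.pi) *
        (∫ v : ℝ, (Real.exp (-(θ.σ ^ 2 / 2) * v ^ 2) : ℂ) * Λ v).re)) := by
  refine (tendsto_re_comp (tendsto_gauss_density hθ hσ hβ2 hβ0 hK0 hK hΛ) tendsto_sqrt_nhdsGT_zero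
    _).congr' ?_
  filter_upwards [self_mem_nhdsWithin] with τ hτ
  have hτ0 : 0 < τ := hτ
  rw [atmDensity_sub hθ hσ hτ, Complex.re_ofReal_mul, Real.sq_sqrt hτ0.le, sqrt_rpow hτ0.le,
    show (β - 1) / 2 = -((1 - β) / 2) by ring, Real.rpow_neg hτ0.le]
  ring

theorem tendsto_atmDigital_gauss (hθ : θ.Admissible) (hσ : 0 < θ.σ) (hβ2 : β < 2) (hβ0 : 0 < β)
    (hK0 : 0 ≤ K) (hK : ∀ u : ℝ, ‖θ.jumpCumulant u‖ ≤ K * ‖Complex.I * u + 1 / 2‖ ^ β)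
    (hΛ : ∀ v : ℝ, v ≠ 0 → Tendsto (fun h : ℝ => ((h ^ β : ℝ) : ℂ) * θ.jumpCumulant (v / h))
      (𝓝[>] 0) (𝓝 (Λ v))) :
    Tendsto (fun τ => ((1 - atmPrice (θ.σ * √τ)) / 2 - θ.atmDigital τ) / τ ^ ((2 - β) / 2))
      (𝓝[>] 0) (𝓝 (-(1 / (2 * Real.pi)) * (∫ v : ℝ,
        (Real.exp (-(θ.σ ^ 2 / 2) * v ^ 2) : ℂ) * (Λ v * (Complex.I * v)⁻¹)).re)) := by
  refine (tendsto_re_comp (tendsto_gauss_prob hθ hσ hβ2 hβ0 hK0 hK hΛ) tendsto_sqrt_nhdsGT_zero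
    _).congr' ?_
  filter_upwards [self_mem_nhdsWithin] with τ hτ
  have hτ0 : 0 < τ := hτ
  rw [sub_atmDigital hθ hτ0 (mul_pos hσ (Real.sqrt_pos.2 hτ)), Complex.re_ofReal_mul,
    Real.sq_sqrt hτ0.le, sqrt_rpow hτ0.le,
    show (β - 2) / 2 = -((2 - β) / 2) by ring, Real.rpow_neg hτ0.le]
  simp_rw [← gaussFactor_mul_exp_sub_one hτ0.le]
  ring

theorem tendsto_atmCall_gauss (hθ : θ.Admissible) (hσ : 0 < θ.σ) (hβ2 : β < 2) (hβ1 : 1 < β)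
    (hK0 : 0 ≤ K) (hK : ∀ u : ℝ, ‖θ.jumpCumulant u‖ ≤ K * ‖Complex.I * u + 1 / 2‖ ^ β)
    (hΛ : ∀ v : ℝ, v ≠ 0 → Tendsto (fun h : ℝ => ((h ^ β : ℝ) : ℂ) * θ.jumpCumulant (v / h))
      (𝓝[>] 0) (𝓝 (Λ v))) :
    Tendsto (fun τ => (θ.atmCall τ - atmPrice (θ.σ * √τ)) / τ ^ ((3 - β) / 2)) (𝓝[>] 0)
      (𝓝 (-(1 / (2 * Real.pi)) * (∫ v : ℝ,
        (Real.exp (-(θ.σ ^ 2 / 2) * v ^ 2) : ℂ) * (Λ v * ((v : ℂ) ^ 2)⁻¹)).re)) := by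
  refine (tendsto_re_comp (tendsto_gauss_price hθ hσ hβ2 hβ1 hK0 hK hΛ) tendsto_sqrt_nhdsGT_zero
    _).congr' ?_
  filter_upwards [self_mem_nhdsWithin] with τ hτ
  have hτ0 : 0 < τ := hτ
  rw [atmCall_sub hθ hτ0, Complex.re_ofReal_mul, Real.sq_sqrt hτ0.le, sqrt_rpow hτ0.le,
    show (β - 3) / 2 = -((3 - β) / 2) by ring, Real.rpow_neg hτ0.le]
  ring

end Gauss

/-! #### The stable regime -/

section Stable

lemma exp_cumulant_of_sigma_eq_zero (hσ : θ.σ = 0) (τ : ℝ) (u : ℝ) :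
    Complex.exp (τ * θ.cumulant u) = Complex.exp (τ * θ.jumpCumulant u) := by
  simp [cumulant, hσ]

variable (hθ : θ.Admissible) (hσ : θ.σ = 0)
include hθ hσ

lemma p_neg_of_sigma_eq_zero : θ.p < 0 :=
  p_neg hθ (hθ.nondegenerate.resolve_right (by simp [hσ]))

theorem tendsto_atmDensity_stable (hγ : θ.γ = 0 ∨ 1 < θ.α) :
    Tendsto (fun τ => τ ^ θ.α' * θ.atmDensity τ) (𝓝[>] 0) (𝓝 θ.CN_B) := by
  have hp := p_neg_of_sigma_eq_zero hθ hσ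
  have hα := hθ.α_pos
  have ha : 0 < θ.α' := by rw [α']; positivity
  have h := tendsto_re_comp (tendsto_stable_density hθ hp hγ) (tendsto_rpow_nhdsGT_zero ha)
    (1 / (2 * Real.pi))
  rw [re_integral_stable_density hθ hp] at h
  have e : 1 / (2 * Real.pi) * (2 * Real.pi * θ.CN_B) = θ.CN_B := by field_simp
  rw [e] at h
  refine h.congr' ?_
  filter_upwards [self_mem_nhdsWithin] with τ hτ
  have hτ0 : 0 < τ := hτ
  rw [Complex.re_ofReal_mul, ← Real.rpow_mul hτ0.le, α', one_div_mul_cancel hα.ne', Real.rpow_one,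
    atmDensity]
  simp_rw [exp_cumulant_of_sigma_eq_zero hσ]
  ring

theorem tendsto_atmDigital_stable (hγ : θ.γ = 0 ∨ 1 < θ.α) :
    Tendsto (fun τ => 1 / 2 - θ.atmDigital τ) (𝓝[>] 0) (𝓝 θ.CM_B) := by
  have hp := p_neg_of_sigma_eq_zero hθ hσ
  have hα := hθ.α_pos
  have ha : 0 < θ.α' := by rw [α']; positivity
  have h := tendsto_re_comp (tendsto_stable_prob hθ hp hγ) (tendsto_rpow_nhdsGT_zero ha)
    (-(1 / (2 * Real.pi)))
  have h2 : Tendsto (fun τ : ℝ => atmPrice (τ ^ θ.α') / 2) (𝓝[>] 0) (𝓝 0) := by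
    have := ((continuous_atmPrice.tendsto _).comp (tendsto_rpow_zero_of_pos ha)).div_const 2
    rwa [atmPrice_zero, zero_div] at this
  rw [re_integral_stable_prob hθ hp] at h
  have e : -(1 / (2 * Real.pi)) * -(2 * Real.pi * θ.CM_B) + 0 = θ.CM_B := by field_simp; ring
  have h3 := h.add h2
  rw [e] at h3
  refine h3.congr' ?_
  filter_upwards [self_mem_nhdsWithin] with τ hτ
  have hτ0 : 0 < τ := hτ
  have h4 := sub_atmDigital hθ hτ0 (Real.rpow_pos_of_pos hτ0 θ.α')
  simp_rw [exp_cumulant_of_sigma_eq_zero hσ] at h4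
  have h5 : (τ ^ θ.α') ^ θ.α = τ := by
    rw [← Real.rpow_mul hτ0.le, α', one_div_mul_cancel hα.ne', Real.rpow_one]
  rw [h5, ← h4]
  ring

theorem tendsto_atmCall_stable (hα1 : 1 < θ.α) :
    Tendsto (fun τ => θ.atmCall τ / τ ^ θ.α') (𝓝[>] 0) (𝓝 θ.CL_B) := by
  have hp := p_neg_of_sigma_eq_zero hθ hσ
  have hα := hθ.α_pos
  have ha : 0 < θ.α' := by rw [α']; positivity
  have h := tendsto_re_comp (tendsto_stable_price hθ hα1) (tendsto_rpow_nhdsGT_zero ha)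
    (-(1 / (2 * Real.pi)))
  rw [re_integral_stable_price hα1 hp] at h
  have e : -(1 / (2 * Real.pi)) * -(2 * Real.pi * θ.CL_B) = θ.CL_B := by field_simp
  rw [e] at h
  refine h.congr' ?_
  filter_upwards [self_mem_nhdsWithin] with τ hτ
  have hτ0 : 0 < τ := hτ
  have h4 := atmCall_sub hθ hτ0
  rw [hσ, zero_mul, atmPrice_zero, sub_zero] at h4
  have h5 : (τ ^ θ.α') ^ θ.α = τ := by
    rw [← Real.rpow_mul hτ0.le, α', one_div_mul_cancel hα.ne', Real.rpow_one]
  have hg : ∀ u, gaussFactor 0 u = 1 := fun u => by simp [gaussFactor]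
  rw [h4, h5, ← Complex.ofReal_inv, Complex.re_ofReal_mul]
  simp_rw [hg, Complex.ofReal_one, one_mul]
  ring

/-- Since `α' < 1` and the angle is an arctangent, the argument of the cosine stays inside `(-π/2,
π/2)`. -/
lemma CL_B_pos (hα1 : 1 < θ.α) : 0 < θ.CL_B := by
  have hp := p_neg_of_sigma_eq_zero hθ hσ
  have ha : 0 < θ.α' := by rw [α']; positivity
  have ha1 : θ.α' < 1 := by rw [α', div_lt_one (by linarith)]; exact hα1
  have hG : 0 < Real.Gamma (1 - θ.α') := Real.Gamma_pos_of_pos (by linarith)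
  have hr : 0 < θ.r := by
    rw [r]
    have := sq_pos_of_neg hp
    positivity
  have hcos : 0 < Real.cos (θ.α' * θ.angle) := by
    have h1 := Real.arctan_lt_pi_div_two (-θ.q / θ.p)
    have h2 := Real.neg_pi_div_two_lt_arctan (-θ.q / θ.p)
    have hπ := Real.pi_pos
    rw [angle]
    refine Real.cos_pos_of_mem_Ioo ⟨?_, ?_⟩ <;> nlinarith
  rw [CL_B]
  positivity

end Stable

/-! #### Finite variation: at-the-money prices -/

/-- With `R` the residual, `e^{τψ} - 1` splits into `e^{iτγu} - 1` and `e^{iτγu} (e^{τR} - 1)`. The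
second part is handled by domination; the first depends on whether there is diffusion and enters
through `c`. -/
theorem tendsto_atmCall_finite_variation (hθ : θ.Admissible) (hα : θ.α < 1) {c : ℝ}
    (hdrift : Tendsto (fun τ : ℝ => (∫ u : ℝ, (gaussFactor (θ.σ * √τ) u : ℂ) *
      (Complex.exp (Complex.I * (τ * (θ.γ * u) : ℝ)) - 1) /
      ((u : ℂ) ^ 2 + 1 / 4)).re / τ) (𝓝[>] 0) (𝓝 c)) :
    Tendsto (fun τ => (θ.atmCall τ - atmPrice (θ.σ * √τ)) / τ ^ (1 : ℝ)) (𝓝[>] 0)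
      (𝓝 (-(θ.γ / 2 + θ.δ + θ.ϱ) - 1 / (2 * Real.pi) * c)) := by
  have h := ((((Complex.continuous_re.tendsto _).comp (tendsto_residual_price hθ hα θ.σ)).add
    hdrift).const_mul (-(1 / (2 * Real.pi))))
  rw [re_integral_residual hθ hα] at h
  have e : -(1 / (2 * Real.pi)) * (2 * Real.pi * (θ.γ / 2 + θ.δ + θ.ϱ) + c) =
      -(θ.γ / 2 + θ.δ + θ.ϱ) - 1 / (2 * Real.pi) * c := by field_simp; ring
  rw [e] at h
  refine h.congr' ?_
  filter_upwards [self_mem_nhdsWithin] with τ hτ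
  have hτ0 : 0 < τ := hτ
  have hτc : (τ : ℂ) ≠ 0 := Complex.ofReal_ne_zero.2 hτ0.ne'
  set g : ℝ → ℂ := fun u => (gaussFactor (θ.σ * √τ) u : ℂ) with hg
  set S : ℝ → ℂ := fun u => g u * (Complex.exp (Complex.I * (τ * (θ.γ * u) : ℝ)) - 1) /
    ((u : ℂ) ^ 2 + 1 / 4) with hS
  set R : ℝ → ℂ := fun u => g u * (Complex.exp (Complex.I * (τ * (θ.γ * u) : ℝ)) *
    ((Complex.exp (τ * θ.residualCumulant u) - 1) / (τ : ℂ))) / ((u : ℂ) ^ 2 + 1 / 4) with hR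
  set T : ℝ → ℂ := fun u => g u * (Complex.exp (τ * θ.jumpCumulant u) - 1) /
    ((u : ℂ) ^ 2 + 1 / 4) with hT
  have hgi : Integrable fun u : ℝ => g u / ((u : ℂ) ^ 2 + 1 / 4) := by
    have i : Integrable fun u : ℝ =>
        ((gaussFactor (θ.σ * √τ) u * (u ^ 2 + 1 / 4)⁻¹ : ℝ) : ℂ) :=
      (integrable_gaussFactor_div _).ofReal
    refine i.congr (Eventually.of_forall fun u => ?_)
    simp only [hg]
    rw [ofReal_sq_add_quarter, ← Complex.ofReal_div, ← div_eq_mul_inv]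
  have hTi : Integrable T := by
    have := (integrable_div_sq_add_quarter (integrable_exp_cumulant hθ hτ0)).sub hgi
    refine this.congr (Eventually.of_forall fun u => ?_)
    simp only [Pi.sub_apply, hT, hg]
    rw [gaussFactor_mul_exp_sub_one hτ0.le, sub_div]
  have hSi : Integrable S := by
    refine (integrable_mul_of_norm_le hgi
      (f := fun u : ℝ => Complex.exp (Complex.I * (τ * (θ.γ * u) : ℝ)) - 1) (c := 2)
      (by fun_prop) fun u => ?_).congr (Eventually.of_forall fun u => ?_)
    · refine (norm_sub_le _ _).trans ?_
      rw [mul_comm Complex.I, Complex.norm_exp_ofReal_mul_I]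
      norm_num
    · simp only [hS]
      ring
  have hTS : ∀ u, T u - S u = τ * R u := fun u => by
    simp only [hT, hS, hR]
    rw [jumpCumulant_eq_residual, mul_add, Complex.exp_add,
      show (τ : ℂ) * (Complex.I * (θ.γ * u : ℝ)) = Complex.I * (τ * (θ.γ * u) : ℝ) by
        push_cast; ring]
    field_simp
    ring
  have key : τ * (∫ u, R u).re = (∫ u, T u).re - (∫ u, S u).re := by
    rw [← Complex.sub_re, ← integral_sub hTi hSi, ← Complex.re_ofReal_mul, ← integral_const_mul]
    simp_rw [hTS]
  rw [atmCall_sub hθ hτ0, Real.rpow_one]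
  have hRe : (∫ u, R u).re = ((∫ u, T u).re - (∫ u, S u).re) / τ := by
    rw [← key]; field_simp
  simp only [Function.comp_apply]
  change -(1 / (2 * Real.pi)) * ((∫ u, R u).re + (∫ u, S u).re / τ) =
    -(1 / (2 * Real.pi)) * (∫ u, T u).re / τ
  rw [hRe]
  ring

theorem tendsto_atmCall_of_sigma_eq_zero (hθ : θ.Admissible) (hα : θ.α < 1) (hσ : θ.σ = 0) :
    Tendsto (fun τ => (θ.atmCall τ - atmPrice (θ.σ * √τ)) / τ ^ (1 : ℝ)) (𝓝[>] 0)
      (𝓝 θ.CL_A) := by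
  have h := tendsto_atmCall_finite_variation hθ hα (c := -Real.pi * |θ.γ|) (by
    have hg : ∀ u, gaussFactor 0 u = 1 := fun u => by simp [gaussFactor]
    simp_rw [hσ, zero_mul, hg, Complex.ofReal_one, one_mul]
    exact tendsto_drift_price_of_eq_zero θ.γ)
  have e : -(θ.γ / 2 + θ.δ + θ.ϱ) - 1 / (2 * Real.pi) * (-Real.pi * |θ.γ|) = θ.CL_A := by
    have hπ := Real.pi_ne_zero
    have : 1 / (2 * Real.pi) * (-Real.pi * |θ.γ|) = -|θ.γ| / 2 := by field_simp
    rw [this, CL_A]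
    rcases le_total 0 θ.γ with h0 | h0
    · rw [min_eq_right h0, abs_of_nonneg h0]; ring
    · rw [min_eq_left h0, abs_of_nonpos h0]; ring
  rwa [e] at h

theorem tendsto_atmCall_of_sigma_pos (hθ : θ.Admissible) (hα : θ.α < 1) (hσ : 0 < θ.σ) :
    Tendsto (fun τ => (θ.atmCall τ - atmPrice (θ.σ * √τ)) / τ ^ (1 : ℝ)) (𝓝[>] 0)
      (𝓝 θ.CL_C) := by
  have h := tendsto_atmCall_finite_variation hθ hα (tendsto_drift_price_of_pos θ.γ hσ)
  rwa [mul_zero, sub_zero] at h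

end TSParams

/-! ### Digital prices in the finite variation case without diffusion -/

/-- The strike derivative of the call price, where it exists, is minus the digital price. -/
lemma eq_measureReal_of_hasDerivAt_call {Ω : Type*} [MeasurableSpace Ω] {P : Measure Ω}
    [IsProbabilityMeasure P] {Y : Ω → ℝ} (hY : Measurable Y)
    (hexp : Integrable (fun ω => Real.exp (Y ω)) P) {a : ℝ}
    (h : HasDerivAt (fun k => ∫ ω, max (Real.exp (Y ω) - Real.exp k) 0 ∂P) (-a) 0) :
    a = P.real {ω | 0 < Y ω} := by
  set Q := P.real {ω | 0 < Y ω} with hQ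
  have hm : MeasurableSet {ω | 0 < Y ω} := measurableSet_lt measurable_const hY
  -- The payoff is convex in `e^k`, with subgradient minus the indicator of `Y > 0` at `e^k = 1`.
  -- Hence call price plus `(e^k - 1) Q` is minimal at `k = 0`, where its derivative must vanish.
  have hle : ∀ k, ∫ ω, max (Real.exp (Y ω) - Real.exp 0) 0 ∂P ≤
      (∫ ω, max (Real.exp (Y ω) - Real.exp k) 0 ∂P) + (Real.exp k - 1) * Q := fun k => by
    have e : (Real.exp k - 1) * Q =
        ∫ ω, {ω | 0 < Y ω}.indicator (fun _ => Real.exp k - 1) ω ∂P := by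
      rw [integral_indicator_const _ hm, smul_eq_mul, mul_comm]
    have hi : Integrable ({ω | 0 < Y ω}.indicator fun _ => Real.exp k - 1) P :=
      (integrable_const _).indicator hm
    rw [e, ← integral_add (integrable_call hY hexp k) hi]
    refine integral_mono (integrable_call hY hexp 0) ((integrable_call hY hexp k).add hi)
      fun ω => ?_
    simp only [Real.exp_zero]
    by_cases hω : 0 < Y ω
    · have h1 : 1 ≤ Real.exp (Y ω) := Real.one_le_exp hω.le
      rw [indicator_of_mem (show ω ∈ {ω | 0 < Y ω} from hω), max_eq_left (by linarith)]
      linarith [le_max_left (Real.exp (Y ω) - Real.exp k) 0]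
    · have h1 : Real.exp (Y ω) ≤ 1 := Real.exp_le_one_iff.2 (not_lt.1 hω)
      rw [indicator_of_notMem (show ω ∉ {ω | 0 < Y ω} from hω), max_eq_right (by linarith),
        add_zero]
      exact le_max_right _ _
  have hd := h.add (((Real.hasDerivAt_exp 0).sub_const 1).mul_const Q)
  have hmin : IsLocalMin ((fun k => ∫ ω, max (Real.exp (Y ω) - Real.exp k) 0 ∂P) +
      fun k => (Real.exp k - 1) * Q) 0 := Eventually.of_forall fun k => by
    simpa using hle k
  have := hmin.hasDerivAt_eq_zero hd
  rw [Real.exp_zero, one_mul] at this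
  linarith

namespace TSParams

variable {θ : TSParams}

/-- With `‖w‖ = O(1/τ)` the product is `O(τ^{1-α})`. This removes the jump terms of the exponent at
frequency `y/τ`. -/
lemma tendsto_mul_norm_rpow {α κ y : ℝ} (h0 : 0 < α) (h1 : α < 1) {w : ℝ → ℂ}
    (hw : ∀ τ, 0 < τ → ‖w τ‖ ≤ κ + |y| / τ) (hκ : 0 ≤ κ) (a : ℂ) :
    Tendsto (fun τ : ℝ => (τ : ℂ) * (a * w τ ^ (α : ℂ))) (𝓝[>] 0) (𝓝 0) := by
  have hl : Tendsto (fun τ : ℝ => ‖a‖ * (κ + |y|) ^ α * τ ^ (1 - α)) (𝓝[>] 0) (𝓝 0) := by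
    simpa using (tendsto_rpow_zero_of_pos (sub_pos.2 h1)).const_mul (‖a‖ * (κ + |y|) ^ α)
  refine squeeze_zero_norm' ?_ hl
  filter_upwards [eventually_pos_le_one] with τ hτ
  have e : τ ^ (1 - α) * τ ^ α = τ := by rw [← Real.rpow_add hτ.1]; simp
  have h2 : τ * ‖w τ‖ ≤ κ + |y| := by
    have := mul_le_mul_of_nonneg_left (hw τ hτ.1) hτ.1.le
    have h3 : τ * (κ + |y| / τ) = τ * κ + |y| := by have := hτ.1.ne'; field_simp
    have h4 : τ * κ ≤ κ := mul_le_of_le_one_left hκ hτ.2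
    linarith
  have h3 : τ ^ α * ‖w τ‖ ^ α ≤ (κ + |y|) ^ α := by
    rw [← Real.mul_rpow hτ.1.le (norm_nonneg _)]
    exact Real.rpow_le_rpow (mul_nonneg hτ.1.le (norm_nonneg _)) h2 h0.le
  rw [norm_mul, norm_mul, Complex.norm_cpow_real, Complex.norm_real, Real.norm_of_nonneg hτ.1.le]
  nth_rw 1 [← e]
  calc _ = ‖a‖ * (τ ^ α * ‖w τ‖ ^ α) * τ ^ (1 - α) := by ring
    _ ≤ _ := by
      have := Real.rpow_nonneg hτ.1.le (1 - α)
      gcongr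

section Drift

variable {Ω : Type*} [MeasurableSpace Ω] {P : Measure Ω} [IsProbabilityMeasure P]
  {X : ℝ≥0 → Ω → ℝ} {b : ℝ}

/-- Without diffusion and with jumps of finite variation, `X(τ) / τ` tends to the drift in
probability. -/
theorem tendsto_measureReal_abs_sub_drift (hθ : θ.Admissible) (hα : θ.α < 1) (hσ : θ.σ = 0)
    (hX : ∀ t, Measurable (X t)) (htriplet : HasLevyTriplet X P b θ.σ θ.levyMeasure)
    (hmart : ∀ t : ℝ≥0, ∫ ω, Real.exp (X t ω) ∂P = 1) {r : ℝ} (hr : 0 < r) :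
    Tendsto (fun τ : ℝ => P.real {ω | r < |X τ.toNNReal ω / τ - θ.γ|}) (𝓝[>] 0) (𝓝 0) := by
  have hm : ∀ τ : ℝ, Measurable fun ω => X τ.toNNReal ω / τ - θ.γ := fun τ =>
    ((hX _).div_const τ).sub_const _
  have hprob : ∀ τ : ℝ, IsProbabilityMeasure (P.map fun ω => X τ.toNNReal ω / τ - θ.γ) := fun τ =>
    Measure.isProbabilityMeasure_map (hm τ).aemeasurable
  have hchar : ∀ y : ℝ, Tendsto (fun τ : ℝ =>
      charFun (P.map fun ω => X τ.toNNReal ω / τ - θ.γ) y) (𝓝[>] 0) (𝓝 1) := fun y => by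
    have l1 : Tendsto (fun τ : ℝ => (τ : ℂ) * θ.δ) (𝓝[>] 0) (𝓝 0) := by
      have hc : Continuous fun τ : ℝ => (τ : ℂ) * θ.δ := by fun_prop
      simpa using tendsto_nhdsWithin_of_tendsto_nhds (s := Ioi 0) (hc.tendsto 0)
    have hn : ∀ τ : ℝ, 0 < τ → ‖Complex.I * (y / τ : ℝ)‖ = |y| / τ := fun τ hτ => by
      rw [norm_mul, Complex.norm_I, one_mul, Complex.norm_real, Real.norm_eq_abs, abs_div,
        abs_of_pos hτ]
    have hκ : 0 ≤ θ.κPos := zero_le_one.trans hθ.one_le_κPos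
    have l2 := tendsto_mul_norm_rpow hθ.α_pos hα (κ := θ.κPos) (y := y)
      (w := fun τ => (θ.κPos : ℂ) - Complex.I * (y / τ : ℝ)) (fun τ hτ => by
        refine (norm_sub_le _ _).trans ?_
        rw [hn τ hτ, Complex.norm_real, Real.norm_of_nonneg hκ]) hκ θ.aPos
    have l3 := tendsto_mul_norm_rpow hθ.α_pos hα (κ := θ.κNeg) (y := y)
      (w := fun τ => (θ.κNeg : ℂ) + Complex.I * (y / τ : ℝ)) (fun τ hτ => by
        refine (norm_add_le _ _).trans ?_
        rw [hn τ hτ, Complex.norm_real, Real.norm_of_nonneg hθ.κNeg_nonneg]) hθ.κNeg_nonneg θ.aNeg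
    have l := (Complex.continuous_exp.tendsto _).comp ((l1.add l2).add l3)
    simp only [add_zero, Complex.exp_zero] at l
    refine l.congr' ?_
    filter_upwards [self_mem_nhdsWithin] with τ hτ
    have hτ0 : 0 < τ := hτ
    have hτc : (τ : ℂ) ≠ 0 := Complex.ofReal_ne_zero.2 hτ0.ne'
    have ht : ((τ.toNNReal : ℝ≥0) : ℝ) = τ := Real.coe_toNNReal _ hτ0.le
    have hE := integral_exp_mul_eq hθ hX htriplet hmart τ.toNNReal
      (z := Complex.I * (y / τ : ℝ)) (by simp) (by simp)
    rw [ht] at hE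
    rw [charFun_apply_real, integral_map (hm τ).aemeasurable
      (Continuous.aestronglyMeasurable (by fun_prop))]
    have e : ∀ ω, Complex.exp (y * ((X τ.toNNReal ω / τ - θ.γ : ℝ) : ℂ) * Complex.I) =
        Complex.exp (-(θ.γ * y * Complex.I)) *
          Complex.exp (Complex.I * (y / τ : ℝ) * X τ.toNNReal ω) := fun ω => by
      rw [← Complex.exp_add]
      congr 1
      push_cast
      ring
    simp_rw [e]
    rw [integral_const_mul, hE, ← Complex.exp_add, Function.comp_apply, affineCumulant, hσ]
    congr 1
    push_cast
    field_simp
    ring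
  -- The tail probability beyond `r` is bounded by an integral of `1 - charFun` over `|y| ≤ 2/r`,
  -- and pointwise convergence with the bound `2` sends it to zero.
  have hint : Tendsto (fun τ : ℝ => ∫ y in (-2 * r⁻¹)..(2 * r⁻¹),
      1 - charFun (P.map fun ω => X τ.toNNReal ω / τ - θ.γ) y) (𝓝[>] 0)
      (𝓝 (∫ _ in (-2 * r⁻¹)..(2 * r⁻¹), (0 : ℂ))) := by
    refine intervalIntegral.tendsto_integral_filter_of_dominated_convergence (fun _ => 2) ?_ ?_
      intervalIntegrable_const ?_
    · refine Eventually.of_forall fun τ => ?_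
      exact ((measurable_charFun).const_sub 1).aestronglyMeasurable
    · exact Eventually.of_forall fun τ => Eventually.of_forall fun y _ => by
        have := hprob τ
        exact norm_one_sub_charFun_le_two
    · refine Eventually.of_forall fun y _ => ?_
      simpa using (hchar y).const_sub 1
  have hb := (hint.norm.const_mul (2⁻¹ * r))
  simp only [intervalIntegral.integral_zero, norm_zero, mul_zero] at hb
  refine squeeze_zero (fun τ => measureReal_nonneg) (fun τ => ?_) hb
  have := hprob τ
  have h := measureReal_abs_gt_le_integral_charFun
    (μ := P.map fun ω => X τ.toNNReal ω / τ - θ.γ) hr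
  rwa [map_measureReal_apply (hm τ) (measurableSet_lt measurable_const (by fun_prop))] at h

/-- Since `X(τ)/τ` concentrates near `γ ≠ 0`, a deviation larger than `|γ|/2` is needed for `X(τ)`
to have the wrong sign. -/
theorem tendsto_measureReal_pos (hθ : θ.Admissible) (hα : θ.α < 1) (hσ : θ.σ = 0)
    (hX : ∀ t, Measurable (X t)) (htriplet : HasLevyTriplet X P b θ.σ θ.levyMeasure)
    (hmart : ∀ t : ℝ≥0, ∫ ω, Real.exp (X t ω) ∂P = 1) (hγ : θ.γ ≠ 0) :
    Tendsto (fun τ : ℝ => P.real {ω | 0 < X τ.toNNReal ω}) (𝓝[>] 0)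
      (𝓝 (1 / 2 + 1 / 2 * Real.sign θ.γ)) := by
  have h := tendsto_measureReal_abs_sub_drift hθ hα hσ hX htriplet hmart
    (r := |θ.γ| / 2) (by positivity)
  rcases hγ.lt_or_gt with h0 | h0
  · rw [Real.sign_of_neg h0, show (1 / 2 + 1 / 2 * -1 : ℝ) = 0 by norm_num]
    refine squeeze_zero' (Eventually.of_forall fun τ => measureReal_nonneg) ?_ h
    filter_upwards [self_mem_nhdsWithin] with τ hτ
    refine measureReal_mono fun ω hω => ?_
    have h1 : 0 < X τ.toNNReal ω / τ := div_pos hω hτ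
    rw [mem_ofPred_eq, abs_of_neg h0]
    exact lt_of_lt_of_le (by linarith) (le_abs_self _)
  · rw [Real.sign_of_pos h0, show (1 / 2 + 1 / 2 * 1 : ℝ) = 1 by norm_num]
    have h2 : Tendsto (fun τ : ℝ => 1 - P.real {ω | |θ.γ| / 2 < |X τ.toNNReal ω / τ - θ.γ|})
        (𝓝[>] 0) (𝓝 1) := by simpa using h.const_sub 1
    refine tendsto_of_tendsto_of_tendsto_of_le_of_le' h2 tendsto_const_nhds ?_
      (Eventually.of_forall fun τ => measureReal_le_one)
    filter_upwards [self_mem_nhdsWithin] with τ hτ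
    have hm : MeasurableSet {ω | 0 < X τ.toNNReal ω} := measurableSet_lt measurable_const (hX _)
    rw [sub_le_comm, ← probReal_compl_eq_one_sub hm]
    refine measureReal_mono fun ω hω => ?_
    have h1 : X τ.toNNReal ω / τ ≤ 0 :=
      div_nonpos_of_nonpos_of_nonneg (not_lt.1 hω) (mem_Ioi.1 hτ).le
    rw [mem_ofPred_eq, abs_of_pos h0]
    exact lt_of_lt_of_le (by linarith) (neg_le_abs _)

end Drift

/-- At the scale `β = 1` the stable part is of order `h^{1-α}` and vanishes, leaving the drift
alone. -/
lemma tendsto_scaled_jumpCumulant_drift (hθ : θ.Admissible) (hα : θ.α < 1) {v : ℝ} (hv : v ≠ 0) :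
    Tendsto (fun h : ℝ => ((h ^ (1 : ℝ) : ℝ) : ℂ) * θ.jumpCumulant (v / h)) (𝓝[>] 0)
      (𝓝 (θ.γ * (Complex.I * v))) := by
  have h := tendsto_scaled_jumpCumulant (θ := θ) one_pos (D := θ.γ) (Λ := 0) (v := v) ?_ (by simp)
  · simpa using h
  · have h1 := ((Complex.continuous_ofReal.tendsto 0).comp (tendsto_rpow_zero_of_pos
      (sub_pos.2 hα))).mul (tendsto_upsilonTilde hθ hv)
    rw [Complex.ofReal_zero, zero_mul] at h1
    refine h1.congr' ?_
    filter_upwards [self_mem_nhdsWithin] with h hh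
    have e : h ^ (1 - θ.α) * h ^ θ.α = h ^ (1 : ℝ) := by
      rw [← Real.rpow_add hh, sub_add_cancel]
    rw [← e]
    push_cast
    rw [mul_assoc]
    rfl

lemma CM_B_of_symm (h : θ.cPos = θ.cNeg) : θ.CM_B = 0 := by
  simp [CM_B, angle, q, aPos, aNeg, h]

end TSParams

end ShortTimeSmile

/-! ### Assembly of the four cases -/

open ShortTimeSmile in
theorem mainTheorem2 {Ω : Type*} [MeasurableSpace Ω] (P : Measure Ω) [IsProbabilityMeasure P]
    (θ : TSParams) (hθ : θ.Admissible)
    (X : ℝ≥0 → Ω → ℝ) (b : ℝ) (hX : IsLevyProcess X P)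
    (htriplet : HasLevyTriplet X P b θ.σ θ.levyMeasure)
    (hmart : ∀ t : ℝ≥0, ∫ ω, Real.exp (X t ω) ∂P = 1) :
    -- near the money the implied volatility exists, is unique, and is twice differentiable
    (∀ τ : ℝ, 0 < τ →
      (∀ᶠ k in 𝓝 (0 : ℝ), ∃! s, IsImpliedVol (callPrice X P) τ k s) ∧
      ContDiffAt ℝ 2 (fun k => impliedVol (callPrice X P) τ k) 0) ∧
    -- case (A)
    (θ.α < 1 → θ.σ = 0 →
      HasLeadingTerm (fun τ => smileCoeff (callPrice X P) 0 τ - θ.σ)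
        (√(2 * Real.pi) * θ.CL_A) (1 / 2) ∧
      (θ.γ ≠ 0 ∨ θ.cPos = θ.cNeg →
        HasLeadingTerm (smileCoeff (callPrice X P) 1)
          (√(2 * Real.pi) * θ.CM_A) (-(1 / 2)))) ∧
    -- case (B)
    (1 < θ.α → θ.σ = 0 →
      HasLeadingTerm (fun τ => smileCoeff (callPrice X P) 0 τ - θ.σ)
        (√(2 * Real.pi) * θ.CL_B) (θ.α' - 1 / 2) ∧
      HasLeadingTerm (smileCoeff (callPrice X P) 1)
        (√(2 * Real.pi) * θ.CM_B) (-(1 / 2)) ∧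
      HasLeadingTerm (smileCoeff (callPrice X P) 2)
        (-(1 / (√(2 * Real.pi) * θ.CL_B)) + √(2 * Real.pi) * θ.CN_B) (-θ.α' - 1 / 2)) ∧
    -- case (C)
    (θ.α < 1 → 0 < θ.σ →
      HasLeadingTerm (fun τ => smileCoeff (callPrice X P) 0 τ - θ.σ)
        (√(2 * Real.pi) * θ.CL_C) (1 / 2) ∧
      HasLeadingTerm (smileCoeff (callPrice X P) 1)
        (√(2 * Real.pi) * θ.CM_C) 0 ∧
      HasLeadingTerm (smileCoeff (callPrice X P) 2)
        (√(2 * Real.pi) * θ.CL_C / θ.σ ^ 2) (-(1 / 2))) ∧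
    -- case (D)
    (1 < θ.α → 0 < θ.σ →
      HasLeadingTerm (fun τ => smileCoeff (callPrice X P) 0 τ - θ.σ)
        (√(2 * Real.pi) * θ.CL_D) ((2 - θ.α) / 2) ∧
      HasLeadingTerm (smileCoeff (callPrice X P) 1)
        (√(2 * Real.pi) * θ.CM_D) ((1 - θ.α) / 2) ∧
      HasLeadingTerm (smileCoeff (callPrice X P) 2)
        (√(2 * Real.pi) * (θ.CL_D / θ.σ ^ 2 + θ.CN_D)) (-θ.α / 2)) := by
  have hsm := fun τ (hτ : 0 < τ) => TSParams.smile_of_triplet hθ hX.measurable htriplet hmart hτ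
  choose! s χ hs using fun τ hτ => (hsm τ hτ).2.2
  have S : SmileRelations θ.atmCall θ.atmDigital θ.atmDensity s χ (smileCoeff (callPrice X P) 0)
      (smileCoeff (callPrice X P) 1) (smileCoeff (callPrice X P) 2) :=
    ⟨fun τ hτ => (hs τ hτ).1, fun τ hτ => (hs τ hτ).2.1, fun τ hτ => (hs τ hτ).2.2.2.1,
      fun τ hτ => (hs τ hτ).2.2.1, fun τ hτ => (hs τ hτ).2.2.2.2.1,
      fun τ hτ => (hs τ hτ).2.2.2.2.2⟩
  have hα0 := hθ.α_pos
  have hα2 := hθ.α_lt_two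
  have hπ := Real.pi_pos
  refine ⟨fun τ hτ => (hsm τ hτ).1, fun hα hσ => ?_, fun hα hσ => ?_, fun hα hσ => ?_,
    fun hα hσ => ?_⟩
  · have hC := TSParams.tendsto_atmCall_of_sigma_eq_zero hθ hα hσ
    refine ⟨?_, fun hγ => ?_⟩
    · have h := S.hasLeadingTerm_coeff_zero one_pos hC
      rwa [show (1 : ℝ) - 1 / 2 = 1 / 2 by norm_num] at h
    · have hA : Tendsto (fun τ => 1 / 2 - θ.atmDigital τ) (𝓝[>] 0) (𝓝 θ.CM_A) := by
        -- For `γ = 0` the stable scaling applies even though `α < 1`, and `c₊ = c₋` makes `q`,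
        -- hence the limit, vanish. For `γ ≠ 0` the drift decides the sign of `X(τ)`.
        by_cases h0 : θ.γ = 0
        · have h := TSParams.tendsto_atmDigital_stable hθ hσ (Or.inl h0)
          rw [TSParams.CM_B_of_symm (hγ.resolve_left (not_not.2 h0))] at h
          rwa [TSParams.CM_A, h0, Real.sign_zero, mul_zero]
        · have h := (TSParams.tendsto_measureReal_pos hθ hα hσ hX.measurable htriplet hmart
            h0).const_sub (1 / 2)
          rw [show 1 / 2 - (1 / 2 + 1 / 2 * Real.sign θ.γ) = θ.CM_A by
            rw [TSParams.CM_A]; ring] at h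
          refine h.congr' ?_
          filter_upwards [self_mem_nhdsWithin] with τ hτ
          rw [← eq_measureReal_of_hasDerivAt_call (hX.measurable _)
            (Integrable.of_integral_ne_zero (by rw [hmart]; exact one_ne_zero))
            (hsm τ hτ).2.1]
      have h := S.hasLeadingTerm_coeff_one one_pos hC zero_lt_one (M := θ.CM_A) (by
        simpa [hσ, atmPrice_zero] using hA)
      rwa [show (0 : ℝ) - 1 / 2 = -(1 / 2) by norm_num] at h
  · have ha : 0 < θ.α' := by rw [TSParams.α']; positivity
    have hC := TSParams.tendsto_atmCall_stable hθ hσ hα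
    have hA := TSParams.tendsto_atmDigital_stable hθ hσ (Or.inr hα)
    have hD := TSParams.tendsto_atmDensity_stable hθ hσ (Or.inr hα)
    have hC' : Tendsto (fun τ => (θ.atmCall τ - atmPrice (θ.σ * √τ)) / τ ^ θ.α') (𝓝[>] 0)
        (𝓝 θ.CL_B) := by
      simpa [hσ, atmPrice_zero] using hC
    refine ⟨S.hasLeadingTerm_coeff_zero ha hC', ?_,
      S.hasLeadingTerm_coeff_two_of_stable ha (TSParams.CL_B_pos hθ hσ hα).ne' hC hA hD⟩
    have h := S.hasLeadingTerm_coeff_one ha hC' ha (M := θ.CM_B) (by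
      simpa [hσ, atmPrice_zero] using hA)
    rwa [show (0 : ℝ) - 1 / 2 = -(1 / 2) by norm_num] at h
  -- Gaussian scaling with `β = 1`. The limiting drift exponent is purely imaginary, so the density
  -- correction is `N = 0` and `χ₂` retains only `L/σ²`; the price comes from the finite variation
  -- argument instead.
  · obtain ⟨K, hK0, hK⟩ := TSParams.exists_norm_jumpCumulant_le hθ hα.le (Or.inr le_rfl)
    have hC := TSParams.tendsto_atmCall_of_sigma_pos hθ hα hσ
    have hA := TSParams.tendsto_atmDigital_gauss hθ hσ one_lt_two one_pos hK0 hK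
      fun v hv => TSParams.tendsto_scaled_jumpCumulant_drift hθ hα hv
    have hD := TSParams.tendsto_atmDensity_gauss hθ hσ one_lt_two one_pos hK0 hK
      fun v hv => TSParams.tendsto_scaled_jumpCumulant_drift hθ hα hv
    rw [TSParams.re_integral_drift_prob _ hσ, show ((2 : ℝ) - 1) / 2 = 1 - 1 / 2 by norm_num,
      show -(1 / (2 * Real.pi)) * (√(2 * Real.pi) * θ.γ / θ.σ) = θ.CM_C by
        have hq : √(2 * Real.pi) * √(2 * Real.pi) = 2 * Real.pi :=
          Real.mul_self_sqrt (by positivity)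
        have hq0 : 0 < √(2 * Real.pi) := by positivity
        rw [TSParams.CM_C]
        nth_rw 1 [← hq]
        field_simp] at hA
    rw [TSParams.re_integral_drift_density _ hσ, mul_zero,
      show ((1 : ℝ) - 1) / 2 = 1 - 1 by norm_num] at hD
    have h0 := S.hasLeadingTerm_coeff_zero one_pos hC
    have h1 := S.hasLeadingTerm_coeff_one one_pos hC (by norm_num) hA
    have h2 := S.hasLeadingTerm_coeff_two_of_gauss (by norm_num) hσ hC hA hD
    rw [show (1 : ℝ) - 1 / 2 = 1 / 2 by norm_num] at h0
    rw [show (1 : ℝ) - 1 / 2 - 1 / 2 = 0 by norm_num] at h1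
    rw [show (1 : ℝ) - 1 - 1 / 2 = -(1 / 2) by norm_num, add_zero, ← mul_div_assoc] at h2
    exact ⟨h0, h1, h2⟩
  -- Gaussian scaling with `β = α`, for price, digital and density alike; the price correction has
  -- order `e = (3 - α)/2`.
  · obtain ⟨K, hK0, hK⟩ := TSParams.exists_norm_jumpCumulant_le hθ le_rfl (Or.inr hα.le)
    have hΛ := fun v (hv : v ≠ 0) =>
      TSParams.tendsto_scaled_jumpCumulant_stable hθ (Or.inr hα) hv
    have hC := TSParams.tendsto_atmCall_gauss hθ hσ hα2 hα hK0 hK hΛ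
    have hA := TSParams.tendsto_atmDigital_gauss hθ hσ hα2 hα0 hK0 hK hΛ
    have hD := TSParams.tendsto_atmDensity_gauss hθ hσ hα2 hα0 hK0 hK hΛ
    rw [TSParams.re_integral_gauss_price hα hσ,
      show -(1 / (2 * Real.pi)) * -(2 * Real.pi * θ.CL_D) = θ.CL_D by field_simp] at hC
    rw [TSParams.re_integral_gauss_prob hθ hσ,
      show -(1 / (2 * Real.pi)) * -(2 * Real.pi * θ.CM_D) = θ.CM_D by field_simp,
      show (2 - θ.α) / 2 = (3 - θ.α) / 2 - 1 / 2 by ring] at hA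
    rw [TSParams.re_integral_gauss_density hθ hσ,
      show 1 / (2 * Real.pi) * (2 * Real.pi * θ.CN_D) = θ.CN_D by field_simp,
      show (1 - θ.α) / 2 = (3 - θ.α) / 2 - 1 by ring] at hD
    have he : 0 < (3 - θ.α) / 2 := by linarith
    have h0 := S.hasLeadingTerm_coeff_zero he hC
    have h1 := S.hasLeadingTerm_coeff_one he hC (by linarith) hA
    have h2 := S.hasLeadingTerm_coeff_two_of_gauss (by linarith) hσ hC hA hD
    rw [show (3 - θ.α) / 2 - 1 / 2 = (2 - θ.α) / 2 by ring] at h0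
    rw [show (3 - θ.α) / 2 - 1 / 2 - 1 / 2 = (1 - θ.α) / 2 by ring] at h1
    rw [show (3 - θ.α) / 2 - 1 - 1 / 2 = -θ.α / 2 by ring] at h2
    exact ⟨h0, h1, h2⟩
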